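/- **Setting.** Let $\Gamma$ be a finite tree with integer vertex weights whose intersection matrix $A=A(\Gamma)$ (diagonal entries the weights, off-diagonal entries $1$ or $0$ according as the vertices are adjacent or not) is negative definite, and let $*$ be a distinguished leaf (vertex of valency $1$), the root; a single vertex is also allowed, and then $*$ is that vertex and also plays the role of the only non-root leaf. Write $d_v$ for the valency of $v$. The splice diagram weight at $v$ on an edge $vu$ is $\det(-A(\Gamma_{vu}))$, where $\Gamma_{vu}$ is the component of $\Gamma\setminus v$ containing $u$. The linking number $\ell_{vw}$ is the product of the splice diagram weights adjacent to but not on the path from $v$ to $w$ (for $v=w$: the product of all weights at $v$). The discriminant group is $D=\mathbb Z^{\mathrm{vert}(\Gamma)}/A\,\mathbb Z^{\mathrm{vert}(\Gamma)}$, with $e_v\in D$ the class of the vertex $v$ and with the $\mathbb Q/\mathbb Z$-valued form for which $e_v\cdot e_w$ is the $vw$-entry of $A^{-1}$. Let $w_1,\dots,w_m$ be the non-root leaves, with coordinates $Y_1,\dots,Y_m$ on $\mathbb C^m$, and let $s=\gcd_j \ell_{w_j,*}$. Let $G\subset(\mathbb C^*)^m$ be the subgroup generated by the image of $D$ under $e\mapsto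 (e^{2\pi i\, e\cdot e_{w_j}})_j$ and by the one-parameter group $\{(u^{\ell_{w_j,*}/s})_j : u\in\mathbb C^*\}$. Let $C=C(\Gamma,*)\subset\mathbb C^m$ be the closure of $G$, a reduced weighted homogeneous curve on which $D$ acts. Let $R$ be its coordinate ring, $\widetilde R$ the normalization of $R$ (integral closure in the total ring of fractions), $\delta(C)=\dim_{\mathbb C}\widetilde R/R$, and $r$ the number of branches (irreducible components) of $C$. Put $$\nu(\Gamma,*)=\sum_{v\ne *}(d_v-2)\,\ell_{*,v},$$ with $\nu(\Gamma,*)=-1$ if $*$ is the only vertex. **Theorem.** $\delta(C)$ is finite and $2\delta(C)-r\le\nu(\Gamma,*)$. If equality holds, then: 1. $C$ is a complete intersection: the ideal of $C$ in $\mathbb C[Y_1,\dots,Y_m]$ is generated by $m-1$ polynomials. 2. The semigroup and congruence conditions hold at every node $v$ (vertex with $d_v\ge 3$) in the directions away from $*$: for the outgoing edges $vu$ at $v$ with $*\notin\Gamma_{vu}$ one can choose monomials $M_{vu}=\prod_j Y_j^{a_j}$, with $a_j\geq 0$, involving only variables $Y_j$ with $w_j\in\Gamma_{vu}$ and of $v$-weight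 $\sum_j a_j\ell_{v,w_j}=\ell_{vv}$, such that for fixed $v$ all these $M_{vu}$ transform by the same character of $D$, where $e\in D$ acts on $Y_j$ by $e^{2\pi i\, e\cdot e_{w_j}}$. -/

import Mathlib

open scoped Matrix

open Classical in
/-- The intersection matrix of a graph with vertex weights `b`: the diagonal entries are the
weights, the off-diagonal entries are `1` or `0` according as the vertices are adjacent or not. -/
noncomputable def weightedGraphMatrix {V : Type*} [DecidableEq V] (G : SimpleGraph V)
    (b : V → ℤ) : Matrix V V ℤ :=
  Matrix.of fun v w => if v = w then b v else if G.Adj v w then 1 else 0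

/-- A rooted resolution diagram with vertex set `V`: a finite tree `graph` of rational exceptional
curves with self-intersection weights `weight`, whose intersection matrix is negative definite,
together with a distinguished leaf `root`.  (If the diagram has a single vertex, that vertex is
the root; hence the bound `≤ 1` on the number of neighbours of the root.) -/
structure RootedResolutionDiagram (V : Type*) [Fintype V] [DecidableEq V] where
  graph : SimpleGraph V
  isTree : graph.IsTree
  weight : V → ℤ
  negDef : (-((weightedGraphMatrix graph weight).map (Int.cast : ℤ → ℝ))).PosDef
  root : V
  root_isLeaf : (graph.neighborSet root).ncard ≤ 1

namespace RootedResolutionDiagram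

section

variable {V : Type*} [Fintype V] [DecidableEq V] (Γ : RootedResolutionDiagram V)

/-- The number of edges at `v`. -/
noncomputable def valency (v : V) : ℕ := (Γ.graph.neighborSet v).ncard

/-- The intersection matrix `A(Γ)`. -/
noncomputable def intersectionMatrix : Matrix V V ℤ := weightedGraphMatrix Γ.graph Γ.weight

/-- The intersection matrix with real entries. -/
noncomputable def realMatrix : Matrix V V ℝ := Γ.intersectionMatrix.map (Int.cast : ℤ → ℝ)

/-! ### Splice diagram weights and linking numbers -/

/-- The vertices of the connected component containing `u` of the graph obtained
from `Γ` by removing `v`. -/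
def branch (v u : V) : Set V := {x | ∃ p : Γ.graph.Walk u x, v ∉ p.support}

open Classical in
/-- The splice diagram weight at `v` on the edge from `v` to `u`: the discriminant
`det(-A)` of the subgraph `branch v u`. -/
noncomputable def spliceWeight (v u : V) : ℤ :=
  ((-Γ.intersectionMatrix).submatrix
    (Subtype.val : {x : V // x ∈ Γ.branch v u} → V) Subtype.val).det

/-- `x` is a vertex of the shortest path from `v` to `w`. -/
def OnPath (v w x : V) : Prop := ∃ p : Γ.graph.Walk v w, p.IsPath ∧ x ∈ p.support

open Classical in
/-- The linking number `ℓ_{vw}`: the product of all splice diagram weights adjacent to but not on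
the shortest path from `v` to `w`. -/
noncomputable def linking (v w : V) : ℤ :=
  ∏ x with Γ.OnPath v w x, ∏ y with Γ.graph.Adj x y ∧ ¬ Γ.OnPath v w y, Γ.spliceWeight x y

open Classical in
/-- `ν(Γ,*) = ∑_{v ≠ *} (d_v - 2) ℓ_{*,v}`.  If `*` is the only vertex, it also plays the role of
the non-root leaf (with `d = 1` and `ℓ = 1`), and the value is `(1 - 2) * 1 = -1`. -/
noncomputable def nu : ℤ :=
  if Γ.valency Γ.root = 0 then -1
  else ∑ v with v ≠ Γ.root, ((Γ.valency v : ℤ) - 2) * Γ.linking Γ.root v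

/-! ### The discriminant group -/

/-- The discriminant group `D(Γ)`, the cokernel of `A(Γ) : ℤ^V → ℤ^V`. -/
abbrev Disc : Type _ :=
  (V → ℤ) ⧸ (LinearMap.range Γ.intersectionMatrix.mulVecLin).toAddSubgroup

/-- The class `e_v` in `D(Γ)` of a vertex `v`. -/
noncomputable def vertexClass (v : V) : Γ.Disc := QuotientAddGroup.mk (Pi.single v 1)

theorem realMatrix_isUnit_det : IsUnit Γ.realMatrix.det := by
  have h : (-Γ.realMatrix).PosDef := Γ.negDef
  exact (Matrix.isUnit_iff_isUnit_det _).1 (neg_neg Γ.realMatrix ▸ h.isUnit.neg)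

theorem realMatrix_isSymm : Γ.realMatrix.IsSymm := by
  have h : (-Γ.realMatrix).PosDef := Γ.negDef
  have h' := h.isHermitian.eq
  ext v w
  have := congrFun (congrFun h' v) w
  simpa using this

/-- The form `(x, y) ↦ xᵗ A(Γ)⁻¹ y` on `ℤ^V`, modulo `1`. -/
noncomputable def latticeForm : (V → ℤ) →+ (V → ℤ) →+ UnitAddCircle :=
  AddMonoidHom.mk' (fun x => AddMonoidHom.mk'
      (fun y => (((fun v => (x v : ℝ)) ⬝ᵥ (Γ.realMatrix⁻¹ *ᵥ fun v => (y v : ℝ)) : ℝ) :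
        UnitAddCircle))
      (fun y y' => by
        rw [← AddCircle.coe_add, ← dotProduct_add, ← Matrix.mulVec_add]
        congr 3
        ext v
        simp))
    (fun x x' => by
      refine AddMonoidHom.ext fun y => ?_
      have h : (fun v => ((x + x') v : ℝ)) = (fun v => (x v : ℝ)) + fun v => (x' v : ℝ) := by
        ext v
        simp
      simp only [AddMonoidHom.mk'_apply, AddMonoidHom.add_apply]
      rw [h, add_dotProduct, AddCircle.coe_add])

theorem cast_mulVec (z : V → ℤ) : (fun v => ((Γ.intersectionMatrix *ᵥ z) v : ℝ)) =
    Γ.realMatrix *ᵥ fun v => (z v : ℝ) := by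
  ext v
  simp [Matrix.mulVec, dotProduct, realMatrix]

theorem latticeForm_right (x z : V → ℤ) :
    Γ.latticeForm x (Γ.intersectionMatrix *ᵥ z) = 0 := by
  have h : (fun v => (x v : ℝ)) ⬝ᵥ (Γ.realMatrix⁻¹ *ᵥ
      fun v => ((Γ.intersectionMatrix *ᵥ z) v : ℝ)) = ((x ⬝ᵥ z : ℤ) : ℝ) := by
    rw [cast_mulVec, Matrix.mulVec_mulVec, Matrix.nonsing_inv_mul _ Γ.realMatrix_isUnit_det,
      Matrix.one_mulVec]
    simp [dotProduct]
  change ((_ : ℝ) : UnitAddCircle) = 0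
  rw [h]
  exact AddCircle.coe_eq_zero_iff 1 |>.2 ⟨x ⬝ᵥ z, by simp⟩

theorem latticeForm_symm (x y : V → ℤ) : Γ.latticeForm x y = Γ.latticeForm y x := by
  change ((_ : ℝ) : UnitAddCircle) = ((_ : ℝ) : UnitAddCircle)
  congr 1
  rw [Matrix.dotProduct_mulVec, ← Matrix.mulVec_transpose, Matrix.transpose_nonsing_inv,
    Γ.realMatrix_isSymm.eq, dotProduct_comm]

/-- The `ℚ/ℤ`-valued (here viewed in `ℝ/ℤ`) bilinear form `e · e'` on `D(Γ)`,
with `e_v · e_w` the class of the `vw`-entry of `A(Γ)⁻¹`. -/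
noncomputable def discForm : Γ.Disc →+ Γ.Disc →+ UnitAddCircle :=
  QuotientAddGroup.lift _
    (AddMonoidHom.mk' (fun x => QuotientAddGroup.lift _ (Γ.latticeForm x) (by
        rintro _ ⟨z, rfl⟩
        exact Γ.latticeForm_right x z))
      (fun x x' => by
        ext y
        simp))
    (by
      rintro _ ⟨z, rfl⟩
      ext y
      exact (Γ.latticeForm_symm _ _).trans (Γ.latticeForm_right _ z))

/-- The character `e ↦ exp(2πi e · e_w)` of `D(Γ)` attached to a vertex `w`. -/
noncomputable def discChar (w : V) : Multiplicative Γ.Disc →* ℂˣ :=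
  Circle.toUnits.comp
    { toFun := fun e => AddCircle.toCircle (Γ.discForm e.toAdd (Γ.vertexClass w))
      map_one' := by simp
      map_mul' := fun e e' => by simp [AddCircle.toCircle_add] }

/-! ### The `D`-curve `C(Γ,*)` -/

/-- `w` is a non-root leaf; if `*` is the only vertex, it plays both roles. -/
def IsNonRootLeaf (w : V) : Prop :=
  (w ≠ Γ.root ∧ Γ.valency w = 1) ∨ (w = Γ.root ∧ Γ.valency Γ.root = 0)

/-- The type of non-root leaves, indexing the coordinates `Y_w` of affine space. -/
abbrev Leaf : Type _ := {w : V // Γ.IsNonRootLeaf w}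

noncomputable instance : Fintype Γ.Leaf := Fintype.ofFinite _

/-- The greatest common divisor of the linking numbers `ℓ_{w,*}` of the non-root leaves. -/
noncomputable def weightGcd : ℤ := Finset.univ.gcd fun w : Γ.Leaf => Γ.linking w Γ.root

/-- The action of `D(Γ)` on affine space by diagonal matrices. -/
noncomputable def discAction : Multiplicative Γ.Disc →* (Γ.Leaf → ℂˣ) :=
  MonoidHom.pi fun w => Γ.discChar w

/-- The one-parameter group `u ↦ (u^(ℓ_{w,*}/s))_w` given by the reduced weights. -/
noncomputable def scaling : ℂˣ →* (Γ.Leaf → ℂˣ) :=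
  MonoidHom.pi fun w => zpowGroupHom (Γ.linking w Γ.root / Γ.weightGcd)

/-- The group `G` of diagonal matrices generated by `D(Γ)` and the one-parameter group. -/
noncomputable def diagGroup : Subgroup (Γ.Leaf → ℂˣ) :=
  Γ.discAction.range ⊔ Γ.scaling.range

/-- The curve `C(Γ,*)`: the closure of the `G`-orbit of `(1,…,1)`. -/
noncomputable def curve : Set (Γ.Leaf → ℂ) :=
  closure ((fun g w => (g w : ℂ)) '' (Γ.diagGroup : Set (Γ.Leaf → ℂˣ)))

/-- The ideal of all polynomials vanishing on `C(Γ,*)`. -/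
noncomputable def curveIdeal : Ideal (MvPolynomial Γ.Leaf ℂ) :=
  MvPolynomial.vanishingIdeal ℂ Γ.curve

/-- The (graded) coordinate ring `R` of `C(Γ,*)`. -/
abbrev CoordRing : Type _ := MvPolynomial Γ.Leaf ℂ ⧸ Γ.curveIdeal

/-- The normalization of `R`: its integral closure in its total ring of fractions. -/
abbrev Normalization : Type _ := integralClosure Γ.CoordRing (FractionRing Γ.CoordRing)

/-- The quotient of the normalization of `R` by `R`. -/
abbrev DeltaModule : Type _ :=
  Γ.Normalization ⧸ LinearMap.range (Algebra.linearMap Γ.CoordRing Γ.Normalization)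

/-- The delta invariant, the complex dimension of the normalization modulo `R`.
(Meaningful only when `DeltaModule` is finite dimensional.) -/
noncomputable def delta : ℕ := Module.finrank ℂ Γ.DeltaModule

/-- The number `r` of branches (irreducible components) of `C(Γ,*)`. -/
noncomputable def numBranches : ℕ := Γ.curveIdeal.minimalPrimes.ncard

/-- The curve `C(Γ,*)` in affine `m`-space is a complete intersection: its ideal is generated
by `m - 1` polynomials. -/
def IsCompleteIntersection : Prop :=
  ∃ (n : ℕ) (f : Fin n → MvPolynomial Γ.Leaf ℂ),
    n + 1 = Fintype.card Γ.Leaf ∧ Γ.curveIdeal = Ideal.span (Set.range f)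

/-! ### Semigroup and congruence conditions away from the root -/

/-- The edge from `v` to `u` is an outgoing edge at `v` in a direction away from the root. -/
def AwayFromRoot (v u : V) : Prop := Γ.graph.Adj v u ∧ Γ.root ∉ Γ.branch v u

/-- `M` is the exponent of an admissible monomial for the outgoing edge from `v` to `u`: it only
involves variables of leaves beyond that edge, and its `v`-weight is `ℓ_{vv}`. -/
def IsAdmissible (v u : V) (M : Γ.Leaf → ℕ) : Prop :=
  (∀ w, M w ≠ 0 → (w : V) ∈ Γ.branch v u) ∧
    ∑ w, (M w : ℤ) * Γ.linking v w = Γ.linking v v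

/-- The `D`-character by which the monomial with exponent `M` transforms. -/
noncomputable def monomialChar (M : Γ.Leaf → ℕ) : Multiplicative Γ.Disc →* ℂˣ :=
  ∏ w : Γ.Leaf, Γ.discChar w ^ M w

/-- The semigroup and congruence conditions at `v` in the directions away from the root: there are
admissible monomials for all outgoing edges at `v` leading away from the root,
all transforming by the same character of `D`. -/
def SemigroupCongruenceAt (v : V) : Prop :=
  ∃ M : V → Γ.Leaf → ℕ,
    (∀ u, Γ.AwayFromRoot v u → Γ.IsAdmissible v u (M u)) ∧
    ∀ u u', Γ.AwayFromRoot v u → Γ.AwayFromRoot v u' →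
      Γ.monomialChar (M u) = Γ.monomialChar (M u')

end

end RootedResolutionDiagram

/-! Let X be `ℤ^V` modulo the columns of A other than the root's, graded so that the class of a
vertex v has degree ℓ_{*,v}. Elements of X are distinct characters of D × ℂˣ, and characters are
linearly independent, so the ideal of C is the kernel of the map from polynomials to the group
algebra of X sending each variable to its leaf class (`curveIdeal_eq_ker`). Thus R is the semigroup
ring of the semigroup S generated by the leaf classes. Its normalization is a product of polynomial
rings, one for each character of the finite group of degree-zero elements. Hence δ is the number of
gaps of S, i.e. elements of X of nonnegative degree outside S, and r is the number of elements of
degree zero (`finite_deltaModule_and_delta_eq`, `numBranches_eq`).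

The inequality is then combinatorial. Suppose two semigroups span groups H₁, H₂ with H₁ ∩ H₂ = ℤe
and deg e > 0. Every element of H₁ + H₂ is uniquely q₁ + q₂ + ne with each qᵢ of degree in [0, deg
e). For fixed q₁, q₂ the gaps are subadditive, and the total number of carries (deg q₁ + deg q₂ ≥
deg e) is computed exactly from the symmetry q ↦ e - q. This is `glue_gaps`. Divide 2δ - r by the
number of group elements per unit of degree: the normalized value of the glued semigroup is at most
the sum of the two normalized values plus deg e, and a single leaf has the value -deg
(`GluedSemigroup.exists_bound`).

The tree prescribes the gluings: at a vertex u with k ≥ 1 children, the semigroups of the k outward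
branches are glued k - 1 times along the class of u (`isGluedOn_branch`), so the bounds add up to ∑
(d_v - 2) ℓ_{*,v}. That the groups of different branches meet only in multiples of that class is
`mk_mem_zmultiples_of_branch`; it rests on the linking numbers being the entries of the adjugate of
-A (`linking_eq_adjugate`). Since D has det(-A) elements, X has one element per unit of degree
(`ncard_degreeSlab_rootRelation`), and the normalization disappears.

If equality holds, it holds at every gluing, and the gluing element e lies in both semigroups.
Writing e in two ways as a sum of leaf classes gives one binomial per gluing, m - 1 in all, and
these generate the ideal (`GluedSemigroup.exists_binomials`). At a node v these expressions of the
class of v are the admissible monomials, and all of them carry the D-character of v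
(`exists_isAdmissible`). -/

/-! ### Gaps of sumsets of integers, and counting along fibres -/

open scoped Pointwise in
-- Let b be the least element of B. A gap of A + B below b is a gap of B; one that is at least b
-- becomes a gap of A after subtracting b.
theorem ncard_nonneg_compl_add_le {A B : Set ℤ} (hB : ∀ n ∈ B, 0 ≤ n)
    (hA' : {n : ℤ | 0 ≤ n ∧ n ∉ A}.Finite) (hB' : {n : ℤ | 0 ≤ n ∧ n ∉ B}.Finite) :
    {n : ℤ | 0 ≤ n ∧ n ∉ A + B}.Finite ∧
    {n : ℤ | 0 ≤ n ∧ n ∉ A + B}.ncard ≤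
      {n : ℤ | 0 ≤ n ∧ n ∉ A}.ncard + {n : ℤ | 0 ≤ n ∧ n ∉ B}.ncard := by
  obtain ⟨b, hb, hmin⟩ : ∃ b ∈ B, ∀ n ∈ B, b ≤ n := by
    have hne : ∃ n : ℕ, (n : ℤ) ∈ B := by
      by_contra! h
      have : (Set.range ((↑) : ℕ → ℤ)) ⊆ {n : ℤ | 0 ≤ n ∧ n ∉ B} := by
        rintro _ ⟨n, rfl⟩
        exact ⟨by positivity, h n⟩
      exact (Set.infinite_range_of_injective Nat.cast_injective) (hB'.subset this)
    classical
    refine ⟨Nat.find hne, Nat.find_spec hne, fun n hn => ?_⟩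
    lift n to ℕ using hB n hn
    exact_mod_cast Nat.find_min' hne hn
  have hsub : {n : ℤ | 0 ≤ n ∧ n ∉ A + B} ⊆
      ((fun n => n + b) '' {n : ℤ | 0 ≤ n ∧ n ∉ A}) ∪ {n : ℤ | 0 ≤ n ∧ n ∉ B} := by
    rintro n ⟨hn, hnAB⟩
    by_cases h : n < b
    · exact Or.inr ⟨hn, fun hnB => absurd (hmin n hnB) (not_le.2 h)⟩
    · refine Or.inl ⟨n - b, ⟨by omega, fun hnA => hnAB ?_⟩, by simp⟩
      exact Set.mem_add.2 ⟨_, hnA, b, hb, by ring⟩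
  have hfin := (hA'.image (fun n => n + b)).union hB'
  refine ⟨hfin.subset hsub, (Set.ncard_le_ncard hsub hfin).trans ((Set.ncard_union_le _ _).trans ?_)⟩
  exact Nat.add_le_add_right (Set.ncard_image_le hA') _

open scoped Pointwise in
-- As 0 lies in both sets, a gap of A + B is a gap of A and of B. Equality of the count with the sum
-- therefore leaves no gaps in either set.
theorem one_mem_of_ncard_nonneg_compl_add_eq {A B : Set ℤ} (hA0 : 0 ∈ A) (hB0 : 0 ∈ B)
    (hA' : {n : ℤ | 0 ≤ n ∧ n ∉ A}.Finite) (hB' : {n : ℤ | 0 ≤ n ∧ n ∉ B}.Finite)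
    (h : {n : ℤ | 0 ≤ n ∧ n ∉ A + B}.ncard =
      {n : ℤ | 0 ≤ n ∧ n ∉ A}.ncard + {n : ℤ | 0 ≤ n ∧ n ∉ B}.ncard) : 1 ∈ A ∧ 1 ∈ B := by
  have h1 : {n : ℤ | 0 ≤ n ∧ n ∉ A + B}.ncard ≤ {n : ℤ | 0 ≤ n ∧ n ∉ A}.ncard :=
    Set.ncard_le_ncard (fun n hn => ⟨hn.1, fun hA => hn.2 ⟨n, hA, 0, hB0, by simp⟩⟩) hA'
  have h2 : {n : ℤ | 0 ≤ n ∧ n ∉ A + B}.ncard ≤ {n : ℤ | 0 ≤ n ∧ n ∉ B}.ncard :=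
    Set.ncard_le_ncard (fun n hn => ⟨hn.1, fun hB => hn.2 ⟨0, hA0, n, hB, by simp⟩⟩) hB'
  have h3 : {n : ℤ | 0 ≤ n ∧ n ∉ A} = ∅ := (Set.ncard_eq_zero hA').1 (by omega)
  have h4 : {n : ℤ | 0 ≤ n ∧ n ∉ B} = ∅ := (Set.ncard_eq_zero hB').1 (by omega)
  constructor
  · by_contra h
    exact Set.notMem_empty (1 : ℤ) (h3 ▸ ⟨by norm_num, h⟩)
  · by_contra h
    exact Set.notMem_empty (1 : ℤ) (h4 ▸ ⟨by norm_num, h⟩)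

/-- Counting a set along the fibres of a parametrization by `Q × ℤ`. -/
theorem finite_and_ncard_eq_sum_fiber {X ι : Type*} [AddCommGroup X] (Q : Finset ι) (base : ι → X)
    (e : X)
    (hinj : ∀ q ∈ Q, ∀ q' ∈ Q, ∀ n n' : ℤ, base q + n • e = base q' + n' • e → q = q' ∧ n = n')
    (s : Set X) (hcov : ∀ x ∈ s, ∃ q ∈ Q, ∃ n : ℤ, x = base q + n • e)
    (hfin : ∀ q ∈ Q, {n : ℤ | base q + n • e ∈ s}.Finite) :
    s.Finite ∧ s.ncard = ∑ q ∈ Q, {n : ℤ | base q + n • e ∈ s}.ncard := by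
  classical
  let t : ι → Finset ℤ := fun q => if h : q ∈ Q then (hfin q h).toFinset else ∅
  have ht : ∀ q ∈ Q, ∀ n, n ∈ t q ↔ base q + n • e ∈ s := by
    intro q hq n
    simp [t, hq]
  have hs : s = (((Q.sigma t).image fun p => base p.1 + p.2 • e : Finset X) : Set X) := by
    ext x
    simp only [Finset.coe_image, Set.mem_image, Finset.mem_coe, Finset.mem_sigma]
    constructor
    · intro hx
      obtain ⟨q, hq, n, rfl⟩ := hcov x hx
      exact ⟨⟨q, n⟩, ⟨hq, (ht q hq n).2 hx⟩, rfl⟩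
    · rintro ⟨⟨q, n⟩, ⟨hq, hn⟩, rfl⟩
      exact (ht q hq n).1 hn
  refine ⟨hs ▸ Finset.finite_toSet _, ?_⟩
  conv_lhs => rw [hs]
  rw [Set.ncard_coe_finset, Finset.card_image_of_injOn, Finset.card_sigma]
  · refine Finset.sum_congr rfl fun q hq => ?_
    rw [← Set.ncard_coe_finset]
    congr 1
    ext n
    exact ht q hq n
  · rintro ⟨q, n⟩ hp ⟨q', n'⟩ hp' h
    simp only [Finset.coe_sigma, Set.mem_sigma_iff, Finset.mem_coe] at hp hp'
    obtain ⟨rfl, rfl⟩ := hinj q hp.1 q' hp'.1 n n' h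
    rfl

/-! ### Elements of a graded group in a range of degrees -/

section Counting

variable {X : Type*} [AddCommGroup X] (deg : X →+ ℤ)

/-- The elements of `H` of degree in `[0, P)`. -/
def degreeSlab (H : AddSubgroup X) (P : ℤ) : Set X := {x | x ∈ H ∧ 0 ≤ deg x ∧ deg x < P}

/-- The elements of `H` of nonnegative degree which are not in `S`. -/
def semigroupGaps (H : AddSubgroup X) (S : AddSubmonoid X) : Set X :=
  {x | x ∈ H ∧ 0 ≤ deg x ∧ x ∉ S}

theorem exists_mem_degreeSlab_add_zsmul {H : AddSubgroup X} {e : X} (he : e ∈ H)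
    (hpos : 0 < deg e) {x : X} (hx : x ∈ H) :
    ∃ q ∈ degreeSlab deg H (deg e), ∃ n : ℤ, x = q + n • e := by
  refine ⟨x - (deg x / deg e) • e, ⟨H.sub_mem hx (H.zsmul_mem he _), ?_, ?_⟩, deg x / deg e,
    by abel⟩
  · rw [map_sub, map_zsmul, smul_eq_mul]
    have := Int.emod_nonneg (deg x) hpos.ne'
    rw [Int.emod_def] at this
    linarith [mul_comm (deg e) (deg x / deg e)]
  · rw [map_sub, map_zsmul, smul_eq_mul]
    have := Int.emod_lt_of_pos (deg x) hpos
    rw [Int.emod_def] at this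
    linarith [mul_comm (deg e) (deg x / deg e)]

theorem eq_zero_of_abs_mul_lt {P n x y : ℤ} (hx : 0 ≤ x) (hx' : x < P) (hy : 0 ≤ y) (hy' : y < P)
    (h : x - y = n * P) : n = 0 := by
  have hP : 0 < P := by linarith
  have h1 : n < 1 := by
    by_contra! h1
    nlinarith
  have h2 : -1 < n := by
    by_contra! h2
    nlinarith
  omega

theorem degreeSlab_injective {H : AddSubgroup X} {e : X} {q q' : X}
    (hq : q ∈ degreeSlab deg H (deg e)) (hq' : q' ∈ degreeSlab deg H (deg e)) {n n' : ℤ}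
    (h : q + n • e = q' + n' • e) : q = q' ∧ n = n' := by
  have hn : n' - n = 0 := by
    refine eq_zero_of_abs_mul_lt hq.2.1 hq.2.2 hq'.2.1 hq'.2.2 ?_
    have := congrArg deg h
    simp only [map_add, map_zsmul, smul_eq_mul] at this
    linear_combination this
  have hn' : n = n' := by omega
  subst hn'
  exact ⟨add_right_cancel h, rfl⟩

theorem degreeSlab_mul_finite {H : AddSubgroup X} {e : X} (he : e ∈ H) (hpos : 0 < deg e)
    (hfin : (degreeSlab deg H (deg e)).Finite) (k : ℕ) :
    (degreeSlab deg H (k * deg e)).Finite ∧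
    (degreeSlab deg H (k * deg e)).ncard = k * (degreeSlab deg H (deg e)).ncard := by
  classical
  have key : ∀ q ∈ hfin.toFinset, {n : ℤ | id q + n • e ∈ degreeSlab deg H (k * deg e)} =
      ((Finset.Ico (0 : ℤ) k : Finset ℤ) : Set ℤ) := by
    intro q hq
    rw [Set.Finite.mem_toFinset] at hq
    obtain ⟨h1, h2, h3⟩ := hq
    ext n
    simp only [id, degreeSlab, Set.mem_ofPred_eq, map_add, map_zsmul, smul_eq_mul, Finset.coe_Ico,
      Set.mem_Ico]
    constructor
    · rintro ⟨-, h4, h5⟩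
      constructor
      · by_contra! h
        nlinarith
      · by_contra! h
        nlinarith
    · rintro ⟨h4, h5⟩
      refine ⟨H.add_mem h1 (H.zsmul_mem he _), by nlinarith, by nlinarith⟩
  have := finite_and_ncard_eq_sum_fiber hfin.toFinset id e
    (fun q hq q' hq' n n' h => degreeSlab_injective deg (by simpa using hq) (by simpa using hq') h)
    (degreeSlab deg H (k * deg e))
    (fun x hx => by
      obtain ⟨q, hq, n, h⟩ := exists_mem_degreeSlab_add_zsmul deg he hpos hx.1
      exact ⟨q, by simpa using hq, n, h⟩)
    (fun q hq => by rw [key q hq]; exact Finset.finite_toSet _)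
  refine ⟨this.1, this.2.trans ?_⟩
  rw [Finset.sum_congr rfl fun q hq => by rw [key q hq, Set.ncard_coe_finset]]
  simp [Set.ncard_eq_toFinset_card _ hfin, mul_comm]

theorem degreeSlab_finite_of_finite {H : AddSubgroup X} {e : X} (he : e ∈ H) (hpos : 0 < deg e)
    (hfin : (degreeSlab deg H (deg e)).Finite) (P : ℤ) : (degreeSlab deg H P).Finite := by
  refine (degreeSlab_mul_finite deg he hpos hfin P.toNat).1.subset fun x hx => ⟨hx.1, hx.2.1, ?_⟩
  have : P ≤ P.toNat := Int.self_le_toNat P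
  nlinarith [hx.2.2, hx.2.1]

/-- Both sides count the elements of degree in [0, deg e · deg e'). So the number of elements per
unit of degree does not depend on the chosen period. -/
theorem deg_mul_ncard_degreeSlab {H : AddSubgroup X} {e e' : X} (he : e ∈ H) (hpos : 0 < deg e)
    (he' : e' ∈ H) (hpos' : 0 < deg e') (hfin : (degreeSlab deg H (deg e)).Finite) :
    deg e * (degreeSlab deg H (deg e')).ncard = deg e' * (degreeSlab deg H (deg e)).ncard := by
  have h1 := (degreeSlab_mul_finite deg he hpos hfin (deg e').toNat).2
  have h2 := (degreeSlab_mul_finite deg he' hpos'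
    (degreeSlab_finite_of_finite deg he hpos hfin _) (deg e).toNat).2
  have e1 : ((deg e').toNat : ℤ) = deg e' := Int.toNat_of_nonneg hpos'.le
  have e2 : ((deg e).toNat : ℤ) = deg e := Int.toNat_of_nonneg hpos.le
  rw [e1, mul_comm] at h1
  rw [e2] at h2
  rw [h1] at h2
  have h3 := congrArg (Nat.cast : ℕ → ℤ) h2
  push_cast at h3
  rw [e1, e2] at h3
  exact h3.symm

end Counting

/-! ### Gluing two semigroups along a common element -/

section Counting

variable {X : Type*} [AddCommGroup X] (deg : X →+ ℤ)

/-- The map is q ↦ e - q, except that q ↦ -q in degree zero, where e - q would leave the half-open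
slab. -/
theorem exists_reflection {H : AddSubgroup X} {e : X} (he : e ∈ H) (hpos : 0 < deg e) :
    ∃ ι : X → X, (∀ q ∈ degreeSlab deg H (deg e), ι q ∈ degreeSlab deg H (deg e)) ∧
      (∀ q ∈ degreeSlab deg H (deg e), ι (ι q) = q) ∧
      (∀ q, deg q = 0 → deg (ι q) = 0) ∧ (∀ q, deg q ≠ 0 → deg (ι q) = deg e - deg q) := by
  classical
  refine ⟨fun q => if deg q = 0 then -q else e - q, fun q hq => ?_, fun q hq => ?_,
    fun q hq => by simp [hq], fun q hq => by simp [hq]⟩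
  · obtain ⟨h1, h2, h3⟩ := hq
    by_cases h : deg q = 0
    · simp only [h, if_true]
      exact ⟨H.neg_mem h1, by simp [h], by simpa [h] using hpos⟩
    · simp only [h, if_false]
      refine ⟨H.sub_mem he h1, ?_, ?_⟩ <;> rw [map_sub] <;> omega
  · obtain ⟨h1, h2, h3⟩ := hq
    by_cases h : deg q = 0
    · simp [h]
    · have h' : deg e - deg q ≠ 0 := by omega
      simp [h, h']

/-- The reflection symmetry evaluates the number of carries in a sum of two slabs. -/
theorem sum_carry_eq_zero {H₁ H₂ : AddSubgroup X} {e : X} (he₁ : e ∈ H₁) (he₂ : e ∈ H₂)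
    (hpos : 0 < deg e) (Q₁ Q₂ : Finset X) (hQ₁ : (Q₁ : Set X) = degreeSlab deg H₁ (deg e))
    (hQ₂ : (Q₂ : Set X) = degreeSlab deg H₂ (deg e)) :
    ∑ q ∈ Q₁ ×ˢ Q₂, ((2 * (if deg e ≤ deg q.1 + deg q.2 then 1 else 0) - 1
      - (if deg q.1 + deg q.2 = 0 ∨ deg q.1 + deg q.2 = deg e then 1 else 0)
      + (if deg q.1 = 0 then 1 else 0) + (if deg q.2 = 0 then 1 else 0) : ℤ)) = 0 := by
  obtain ⟨ι, i1, i2, i3, i4⟩ := exists_reflection deg he₁ hpos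
  obtain ⟨κ, k1, k2, k3, k4⟩ := exists_reflection deg he₂ hpos
  simp only [← hQ₁, ← hQ₂, Finset.mem_coe] at i1 i2 k1 k2
  set t : X × X → ℤ := fun q => 2 * (if deg e ≤ deg q.1 + deg q.2 then 1 else 0) - 1
      - (if deg q.1 + deg q.2 = 0 ∨ deg q.1 + deg q.2 = deg e then 1 else 0)
      + (if deg q.1 = 0 then 1 else 0) + (if deg q.2 = 0 then 1 else 0) with ht
  have hsum : ∑ q ∈ Q₁ ×ˢ Q₂, t q = ∑ q ∈ Q₁ ×ˢ Q₂, t (ι q.1, κ q.2) := by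
    refine Finset.sum_nbij' (fun q => (ι q.1, κ q.2)) (fun q => (ι q.1, κ q.2)) ?_ ?_ ?_ ?_ ?_
    · intro q hq
      rw [Finset.mem_product] at hq ⊢
      exact ⟨i1 _ hq.1, k1 _ hq.2⟩
    · intro q hq
      rw [Finset.mem_product] at hq ⊢
      exact ⟨i1 _ hq.1, k1 _ hq.2⟩
    · intro q hq
      rw [Finset.mem_product] at hq
      simp [i2 _ hq.1, k2 _ hq.2]
    · intro q hq
      rw [Finset.mem_product] at hq
      simp [i2 _ hq.1, k2 _ hq.2]
    · intro q hq
      rw [Finset.mem_product] at hq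
      simp [i2 _ hq.1, k2 _ hq.2]
  -- If both degrees are nonzero, reflection turns their sum s into 2 deg e - s and exchanges carry
  -- with no carry; s = deg e gives 0. If some degree is zero, the summand itself is 0.
  have hneg : ∀ q ∈ Q₁ ×ˢ Q₂, t q + t (ι q.1, κ q.2) = 0 := by
    rintro ⟨x, y⟩ hq
    rw [Finset.mem_product] at hq
    have hx : x ∈ degreeSlab deg H₁ (deg e) := hQ₁ ▸ hq.1
    have hy : y ∈ degreeSlab deg H₂ (deg e) := hQ₂ ▸ hq.2
    obtain ⟨-, x1, x2⟩ := hx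
    obtain ⟨-, y1, y2⟩ := hy
    simp only [ht]
    by_cases hx0 : deg x = 0 <;> by_cases hy0 : deg y = 0
    · rw [i3 x hx0, k3 y hy0]
      split_ifs <;> omega
    · rw [i3 x hx0, k4 y hy0]
      split_ifs <;> omega
    · rw [i4 x hx0, k3 y hy0]
      split_ifs <;> omega
    · rw [i4 x hx0, k4 y hy0]
      split_ifs <;> omega
  have h2 := Finset.sum_congr (rfl : Q₁ ×ˢ Q₂ = Q₁ ×ˢ Q₂) hneg
  rw [Finset.sum_add_distrib, ← hsum, Finset.sum_const_zero] at h2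
  change ∑ q ∈ Q₁ ×ˢ Q₂, t q = 0
  omega

open scoped Pointwise in
/-- Gluing two semigroups along a common element `e` of positive degree. -/
theorem glue_gaps {H₁ H₂ : AddSubgroup X} {S₁ S₂ : AddSubmonoid X} {e : X}
    (hinf : H₁ ⊓ H₂ = AddSubgroup.zmultiples e) (hpos : 0 < deg e)
    (hS₁ : S₁ ≤ H₁.toAddSubmonoid) (hS₂ : S₂ ≤ H₂.toAddSubmonoid)
    (hd₁ : ∀ x ∈ S₁, 0 ≤ deg x) (hd₂ : ∀ x ∈ S₂, 0 ≤ deg x)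
    (hf₁ : (degreeSlab deg H₁ (deg e)).Finite) (hf₂ : (degreeSlab deg H₂ (deg e)).Finite)
    (hg₁ : (semigroupGaps deg H₁ S₁).Finite) (hg₂ : (semigroupGaps deg H₂ S₂).Finite) :
    (degreeSlab deg (H₁ ⊔ H₂) (deg e)).Finite ∧
    (degreeSlab deg (H₁ ⊔ H₂) (deg e)).ncard =
      (degreeSlab deg H₁ (deg e)).ncard * (degreeSlab deg H₂ (deg e)).ncard ∧
    (semigroupGaps deg (H₁ ⊔ H₂) (S₁ ⊔ S₂)).Finite ∧
    (2 * (semigroupGaps deg (H₁ ⊔ H₂) (S₁ ⊔ S₂)).ncard - (degreeSlab deg (H₁ ⊔ H₂) 1).ncard : ℤ) ≤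
      (degreeSlab deg H₂ (deg e)).ncard *
        (2 * (semigroupGaps deg H₁ S₁).ncard - (degreeSlab deg H₁ 1).ncard) +
      (degreeSlab deg H₁ (deg e)).ncard *
        (2 * (semigroupGaps deg H₂ S₂).ncard - (degreeSlab deg H₂ 1).ncard) +
      (degreeSlab deg H₁ (deg e)).ncard * (degreeSlab deg H₂ (deg e)).ncard ∧
    ((2 * (semigroupGaps deg (H₁ ⊔ H₂) (S₁ ⊔ S₂)).ncard
        - (degreeSlab deg (H₁ ⊔ H₂) 1).ncard : ℤ) =
      (degreeSlab deg H₂ (deg e)).ncard *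
        (2 * (semigroupGaps deg H₁ S₁).ncard - (degreeSlab deg H₁ 1).ncard) +
      (degreeSlab deg H₁ (deg e)).ncard *
        (2 * (semigroupGaps deg H₂ S₂).ncard - (degreeSlab deg H₂ 1).ncard) +
      (degreeSlab deg H₁ (deg e)).ncard * (degreeSlab deg H₂ (deg e)).ncard →
      e ∈ S₁ ∧ e ∈ S₂) := by
  classical
  have he₁ : e ∈ H₁ := (hinf.ge (AddSubgroup.mem_zmultiples e)).1
  have he₂ : e ∈ H₂ := (hinf.ge (AddSubgroup.mem_zmultiples e)).2
  set P := deg e with hP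
  obtain ⟨Q₁, hQ₁⟩ := hf₁.exists_finset_coe
  obtain ⟨Q₂, hQ₂⟩ := hf₂.exists_finset_coe
  have m₁ : ∀ q, q ∈ Q₁ ↔ q ∈ degreeSlab deg H₁ P := fun q => by rw [← hQ₁]; rfl
  have m₂ : ∀ q, q ∈ Q₂ ↔ q ∈ degreeSlab deg H₂ P := fun q => by rw [← hQ₂]; rfl
  have hn₁ : (degreeSlab deg H₁ P).ncard = Q₁.card := by rw [← hQ₁, Set.ncard_coe_finset]
  have hn₂ : (degreeSlab deg H₂ P).ncard = Q₂.card := by rw [← hQ₂, Set.ncard_coe_finset]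
  -- unique representation
  have uniq : ∀ q ∈ Q₁ ×ˢ Q₂, ∀ q' ∈ Q₁ ×ˢ Q₂, ∀ n n' : ℤ,
      (q.1 + q.2) + n • e = (q'.1 + q'.2) + n' • e → q = q' ∧ n = n' := by
    rintro ⟨x, y⟩ hq ⟨x', y'⟩ hq' n n' h
    rw [Finset.mem_product] at hq hq'
    have hx := (m₁ _).1 hq.1
    have hy := (m₂ _).1 hq.2
    have hx' := (m₁ _).1 hq'.1
    have hy' := (m₂ _).1 hq'.2
    simp only at h hx hy hx' hy'
    -- The difference lies in ℤe, and two elements of one slab that differ by a multiple of e are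
    -- equal.
    have hmem : x - x' ∈ H₁ ⊓ H₂ := by
      refine ⟨H₁.sub_mem hx.1 hx'.1, ?_⟩
      have : x - x' = y' - y + (n' - n) • e := by
        rw [sub_smul, ← sub_eq_zero]
        rw [← sub_eq_zero] at h
        rw [← h]
        abel
      rw [this]
      exact H₂.add_mem (H₂.sub_mem hy'.1 hy.1) (H₂.zsmul_mem he₂ _)
    rw [hinf] at hmem
    obtain ⟨k, hk⟩ := AddSubgroup.mem_zmultiples_iff.1 hmem
    have hk' : x + (-k) • e = x' + (0 : ℤ) • e := by
      rw [neg_smul, hk]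
      simp
    obtain ⟨rfl, -⟩ := degreeSlab_injective deg hx hx' hk'
    have h' : y + n • e = y' + n' • e := by
      rw [add_assoc, add_assoc] at h
      exact add_left_cancel h
    obtain ⟨rfl, rfl⟩ := degreeSlab_injective deg hy hy' h'
    exact ⟨rfl, rfl⟩
  have cov : ∀ x ∈ H₁ ⊔ H₂, ∃ q ∈ Q₁ ×ˢ Q₂, ∃ n : ℤ, x = (q.1 + q.2) + n • e := by
    intro x hx
    obtain ⟨x₁, h₁, x₂, h₂, rfl⟩ := AddSubgroup.mem_sup.1 hx
    obtain ⟨q₁, hq₁, n₁, rfl⟩ := exists_mem_degreeSlab_add_zsmul deg he₁ hpos h₁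
    obtain ⟨q₂, hq₂, n₂, rfl⟩ := exists_mem_degreeSlab_add_zsmul deg he₂ hpos h₂
    refine ⟨(q₁, q₂), Finset.mem_product.2 ⟨(m₁ _).2 hq₁, (m₂ _).2 hq₂⟩, n₁ + n₂, ?_⟩
    rw [add_smul]
    abel
  have memH : ∀ q ∈ Q₁ ×ˢ Q₂, ∀ n : ℤ, (q.1 + q.2) + n • e ∈ H₁ ⊔ H₂ := by
    intro q hq n
    rw [Finset.mem_product] at hq
    refine AddSubgroup.add_mem _ (AddSubgroup.add_mem_sup ((m₁ _).1 hq.1).1 ((m₂ _).1 hq.2).1)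
      (AddSubgroup.zsmul_mem _ (AddSubgroup.mem_sup_left he₁) _)
  have rng : ∀ q ∈ Q₁ ×ˢ Q₂, 0 ≤ deg q.1 ∧ deg q.1 < P ∧ 0 ≤ deg q.2 ∧ deg q.2 < P := by
    intro q hq
    rw [Finset.mem_product] at hq
    exact ⟨((m₁ _).1 hq.1).2.1, ((m₁ _).1 hq.1).2.2, ((m₂ _).1 hq.2).2.1, ((m₂ _).1 hq.2).2.2⟩
  have degf : ∀ (q : X × X) (n : ℤ), deg ((q.1 + q.2) + n • e) = deg q.1 + deg q.2 + n * P := by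
    intro q n
    simp [hP]
  -- the slab
  have slab : ∀ q ∈ Q₁ ×ˢ Q₂, {n : ℤ | (q.1 + q.2) + n • e ∈ degreeSlab deg (H₁ ⊔ H₂) P} =
      {if P ≤ deg q.1 + deg q.2 then (-1 : ℤ) else 0} := by
    intro q hq
    obtain ⟨a, b, c, d⟩ := rng q hq
    ext n
    simp only [degreeSlab, Set.mem_ofPred_eq, degf, memH q hq n, true_and, Set.mem_singleton_iff]
    split_ifs with h
    · constructor
      · rintro ⟨h1, h2⟩
        have : n < 0 := by by_contra! h; nlinarith
        have : -2 < n := by by_contra! h; nlinarith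
        omega
      · rintro rfl
        constructor <;> linarith
    · constructor
      · rintro ⟨h1, h2⟩
        have : n < 1 := by by_contra! h; nlinarith
        have : -1 < n := by by_contra! h; nlinarith
        omega
      · rintro rfl
        constructor <;> linarith
  have slabN := finite_and_ncard_eq_sum_fiber (Q₁ ×ˢ Q₂) (fun q => q.1 + q.2) e uniq
    (degreeSlab deg (H₁ ⊔ H₂) P) (fun x hx => cov x hx.1)
    (fun q hq => by rw [slab q hq]; exact Set.finite_singleton _)
  have slabNcard : (degreeSlab deg (H₁ ⊔ H₂) P).ncard = Q₁.card * Q₂.card := by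
    rw [slabN.2, Finset.sum_congr rfl fun q hq => by rw [slab q hq, Set.ncard_singleton]]
    simp
  -- elements of degree zero
  have zero : ∀ q ∈ Q₁ ×ˢ Q₂, {n : ℤ | (q.1 + q.2) + n • e ∈ degreeSlab deg (H₁ ⊔ H₂) 1} =
      if deg q.1 + deg q.2 = 0 ∨ deg q.1 + deg q.2 = P then
        {if P ≤ deg q.1 + deg q.2 then (-1 : ℤ) else 0} else ∅ := by
    intro q hq
    obtain ⟨a, b, c, d⟩ := rng q hq
    ext n
    simp only [degreeSlab, Set.mem_ofPred_eq, degf, memH q hq n, true_and]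
    have key : (0 ≤ deg q.1 + deg q.2 + n * P ∧ deg q.1 + deg q.2 + n * P < 1) →
        n = 0 ∨ n = -1 := by
      rintro ⟨h1, h2⟩
      have : n < 1 := by by_contra! h; nlinarith
      have : -2 < n := by by_contra! h; nlinarith
      omega
    split_ifs with h h'
    · simp only [Set.mem_singleton_iff]
      constructor
      · intro h1
        rcases key h1 with rfl | rfl <;> omega
      · rintro rfl
        omega
    · simp only [Set.mem_singleton_iff]
      constructor
      · intro h1
        rcases key h1 with rfl | rfl <;> omega
      · rintro rfl
        omega
    · simp only [Set.mem_empty_iff_false, iff_false]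
      intro h1
      rcases key h1 with rfl | rfl <;> omega
  have zeroN := finite_and_ncard_eq_sum_fiber (Q₁ ×ˢ Q₂) (fun q => q.1 + q.2) e uniq
    (degreeSlab deg (H₁ ⊔ H₂) 1) (fun x hx => cov x hx.1)
    (fun q hq => by
      rw [zero q hq]
      split_ifs
      exacts [Set.finite_singleton _, Set.finite_singleton _, Set.finite_empty])
  have zeroCard : ((degreeSlab deg (H₁ ⊔ H₂) 1).ncard : ℤ) = ∑ q ∈ Q₁ ×ˢ Q₂,
      if deg q.1 + deg q.2 = 0 ∨ deg q.1 + deg q.2 = P then 1 else 0 := by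
    rw [zeroN.2]
    push_cast
    refine Finset.sum_congr rfl fun q hq => ?_
    rw [zero q hq]
    split_ifs <;> simp
  have zero₁ : ∀ (H : AddSubgroup X) (Q : Finset X), (Q : Set X) = degreeSlab deg H P →
      ((degreeSlab deg H 1).ncard : ℤ) = ∑ q ∈ Q, if deg q = 0 then 1 else 0 := by
    intro H Q hQ
    have : degreeSlab deg H 1 = ((Q.filter fun q => deg q = 0 : Finset X) : Set X) := by
      ext x
      simp only [Finset.coe_filter, ← Finset.mem_coe, hQ, degreeSlab, Set.mem_ofPred_eq]
      constructor
      · rintro ⟨h1, h2, h3⟩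
        exact ⟨⟨h1, h2, by omega⟩, by omega⟩
      · rintro ⟨⟨h1, h2, h3⟩, h4⟩
        exact ⟨h1, by omega, by omega⟩
    rw [this, Set.ncard_coe_finset, Finset.card_filter]
    push_cast
    rfl
  -- gaps of the two semigroups
  have gapsOf : ∀ (H : AddSubgroup X) (S : AddSubmonoid X) (Q : Finset X),
      (Q : Set X) = degreeSlab deg H P → e ∈ H → (semigroupGaps deg H S).Finite →
      (∀ q ∈ Q, {n : ℤ | 0 ≤ n ∧ n ∉ {n : ℤ | q + n • e ∈ S}}.Finite) ∧
      (semigroupGaps deg H S).ncard =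
        ∑ q ∈ Q, {n : ℤ | 0 ≤ n ∧ n ∉ {n : ℤ | q + n • e ∈ S}}.ncard := by
    intro H S Q hQ he hfin
    have mQ : ∀ q, q ∈ Q ↔ q ∈ degreeSlab deg H P := fun q => by rw [← hQ]; rfl
    have key : ∀ q ∈ Q, {n : ℤ | id q + n • e ∈ semigroupGaps deg H S} =
        {n : ℤ | 0 ≤ n ∧ n ∉ {n : ℤ | q + n • e ∈ S}} := by
      intro q hq
      obtain ⟨h1, h2, h3⟩ := (mQ q).1 hq
      ext n
      simp only [id, semigroupGaps, Set.mem_ofPred_eq, map_add, map_zsmul, smul_eq_mul, ← hP]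
      constructor
      · rintro ⟨-, h4, h5⟩
        exact ⟨by by_contra! h; nlinarith, h5⟩
      · rintro ⟨h4, h5⟩
        exact ⟨H.add_mem h1 (H.zsmul_mem he _), by nlinarith, h5⟩
    have hfin' : ∀ q ∈ Q, {n : ℤ | id q + n • e ∈ semigroupGaps deg H S}.Finite := by
      intro q hq
      refine Set.Finite.preimage (f := fun n : ℤ => id q + n • e) ?_ hfin
      intro n _ n' _ h
      exact (degreeSlab_injective deg ((mQ q).1 hq) ((mQ q).1 hq) h).2
    have := finite_and_ncard_eq_sum_fiber Q id e
      (fun q hq q' hq' n n' h => degreeSlab_injective deg ((mQ q).1 hq) ((mQ q').1 hq') h)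
      (semigroupGaps deg H S)
      (fun x hx => by
        obtain ⟨q, hq, n, h⟩ := exists_mem_degreeSlab_add_zsmul deg he hpos hx.1
        exact ⟨q, (mQ q).2 hq, n, h⟩) hfin'
    refine ⟨fun q hq => key q hq ▸ hfin' q hq, this.2.trans ?_⟩
    exact Finset.sum_congr rfl fun q hq => by rw [key q hq]
  obtain ⟨gf₁, gc₁⟩ := gapsOf H₁ S₁ Q₁ hQ₁ he₁ hg₁
  obtain ⟨gf₂, gc₂⟩ := gapsOf H₂ S₂ Q₂ hQ₂ he₂ hg₂
  have nonneg₁ : ∀ q ∈ Q₁, ∀ n ∈ {n : ℤ | q + n • e ∈ S₁}, 0 ≤ n := by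
    intro q hq n hn
    have h1 := hd₁ _ hn
    have h2 := ((m₁ q).1 hq).2.2
    rw [map_add, map_zsmul, smul_eq_mul, ← hP] at h1
    by_contra! h
    nlinarith
  have nonneg₂ : ∀ q ∈ Q₂, ∀ n ∈ {n : ℤ | q + n • e ∈ S₂}, 0 ≤ n := by
    intro q hq n hn
    have h1 := hd₂ _ hn
    have h2 := ((m₂ q).1 hq).2.2
    rw [map_add, map_zsmul, smul_eq_mul, ← hP] at h1
    by_contra! h
    nlinarith
  have sumset : ∀ q ∈ Q₁ ×ˢ Q₂, ∀ n : ℤ, (q.1 + q.2) + n • e ∈ S₁ ⊔ S₂ ↔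
      n ∈ {n : ℤ | q.1 + n • e ∈ S₁} + {n : ℤ | q.2 + n • e ∈ S₂} := by
    intro q hq n
    rw [Set.mem_add, AddSubmonoid.mem_sup]
    constructor
    · rintro ⟨s₁, h₁, s₂, h₂, h⟩
      obtain ⟨q₁, hq₁, n₁, rfl⟩ := exists_mem_degreeSlab_add_zsmul deg he₁ hpos (hS₁ h₁)
      obtain ⟨q₂, hq₂, n₂, rfl⟩ := exists_mem_degreeSlab_add_zsmul deg he₂ hpos (hS₂ h₂)
      have h' : ((q₁, q₂).1 + (q₁, q₂).2) + (n₁ + n₂) • e = (q.1 + q.2) + n • e := by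
        rw [← h, add_smul]
        abel
      obtain ⟨rfl, rfl⟩ := uniq _ (Finset.mem_product.2 ⟨(m₁ _).2 hq₁, (m₂ _).2 hq₂⟩) _ hq _ _ h'
      exact ⟨n₁, h₁, n₂, h₂, rfl⟩
    · rintro ⟨n₁, h₁, n₂, h₂, rfl⟩
      refine ⟨_, h₁, _, h₂, ?_⟩
      rw [add_smul]
      abel
  have nn : ∀ q ∈ Q₁ ×ˢ Q₂, ∀ n ∈ {n : ℤ | q.1 + n • e ∈ S₁} + {n : ℤ | q.2 + n • e ∈ S₂},
      0 ≤ n := by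
    intro q hq n hn
    rw [Finset.mem_product] at hq
    obtain ⟨a, ha, b, hb, rfl⟩ := Set.mem_add.1 hn
    exact add_nonneg (nonneg₁ _ hq.1 _ ha) (nonneg₂ _ hq.2 _ hb)
  -- A carry creates one extra gap, at n = -1: the degree is still nonnegative there, but elements
  -- of the semigroups only occur for n ≥ 0.
  have fib : ∀ q ∈ Q₁ ×ˢ Q₂,
      {n : ℤ | (q.1 + q.2) + n • e ∈ semigroupGaps deg (H₁ ⊔ H₂) (S₁ ⊔ S₂)} =
      {n : ℤ | 0 ≤ n ∧ n ∉ {n : ℤ | q.1 + n • e ∈ S₁} + {n : ℤ | q.2 + n • e ∈ S₂}} ∪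
      if P ≤ deg q.1 + deg q.2 then {-1} else ∅ := by
    intro q hq
    obtain ⟨a, b, c, d⟩ := rng q hq
    ext n
    rw [Set.mem_union]
    simp only [semigroupGaps, Set.mem_ofPred_eq, degf, memH q hq n, true_and, sumset q hq n]
    constructor
    · rintro ⟨h1, h2⟩
      by_cases hn : 0 ≤ n
      · exact Or.inl ⟨hn, h2⟩
      · right
        have : -2 < n := by by_contra! h; nlinarith
        obtain rfl : n = -1 := by omega
        rw [if_pos (by linarith)]
        exact Set.mem_singleton _
    · rintro (⟨h1, h2⟩ | h)
      · exact ⟨by nlinarith, h2⟩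
      · split_ifs at h with h'
        · rw [Set.mem_singleton_iff] at h
          subst h
          exact ⟨by linarith, fun h => absurd (nn q hq _ h) (by norm_num)⟩
        · exact absurd h (Set.notMem_empty _)
  have pair : ∀ q ∈ Q₁ ×ˢ Q₂, _ := fun q hq => ncard_nonneg_compl_add_le
    (nonneg₂ q.2 (Finset.mem_product.1 hq).2)
    (gf₁ q.1 (Finset.mem_product.1 hq).1) (gf₂ q.2 (Finset.mem_product.1 hq).2)
  have fibfin : ∀ q ∈ Q₁ ×ˢ Q₂,
      {n : ℤ | (q.1 + q.2) + n • e ∈ semigroupGaps deg (H₁ ⊔ H₂) (S₁ ⊔ S₂)}.Finite := by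
    intro q hq
    rw [fib q hq]
    refine (pair q hq).1.union ?_
    split_ifs
    exacts [Set.finite_singleton _, Set.finite_empty]
  have fibcard : ∀ q ∈ Q₁ ×ˢ Q₂,
      ({n : ℤ | (q.1 + q.2) + n • e ∈ semigroupGaps deg (H₁ ⊔ H₂) (S₁ ⊔ S₂)}.ncard : ℤ) =
      {n : ℤ | 0 ≤ n ∧ n ∉ {n : ℤ | q.1 + n • e ∈ S₁} + {n : ℤ | q.2 + n • e ∈ S₂}}.ncard +
      if P ≤ deg q.1 + deg q.2 then 1 else 0 := by
    intro q hq
    rw [fib q hq, Set.ncard_union_eq ?_ ?_ ?_]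
    · split_ifs <;> simp
    · rw [Set.disjoint_left]
      rintro n ⟨h1, -⟩ h
      split_ifs at h
      · rw [Set.mem_singleton_iff] at h
        omega
      · exact Set.notMem_empty _ h
    · exact (pair q hq).1
    · split_ifs
      exacts [Set.finite_singleton _, Set.finite_empty]
  have gapN := finite_and_ncard_eq_sum_fiber (Q₁ ×ˢ Q₂) (fun q => q.1 + q.2) e uniq
    (semigroupGaps deg (H₁ ⊔ H₂) (S₁ ⊔ S₂)) (fun x hx => cov x hx.1) fibfin
  set g₁ : X → ℕ := fun q => {n : ℤ | 0 ≤ n ∧ n ∉ {n : ℤ | q + n • e ∈ S₁}}.ncard with hg₁def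
  set g₂ : X → ℕ := fun q => {n : ℤ | 0 ≤ n ∧ n ∉ {n : ℤ | q + n • e ∈ S₂}}.ncard with hg₂def
  set g : X × X → ℕ := fun q =>
    {n : ℤ | 0 ≤ n ∧ n ∉ {n : ℤ | q.1 + n • e ∈ S₁} + {n : ℤ | q.2 + n • e ∈ S₂}}.ncard with hgdef
  have gapCard : ((semigroupGaps deg (H₁ ⊔ H₂) (S₁ ⊔ S₂)).ncard : ℤ) =
      ∑ q ∈ Q₁ ×ˢ Q₂, (g q : ℤ) + ∑ q ∈ Q₁ ×ˢ Q₂, if P ≤ deg q.1 + deg q.2 then 1 else 0 := by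
    rw [gapN.2]
    push_cast
    rw [Finset.sum_congr rfl fibcard, Finset.sum_add_distrib]
  have hle : ∀ q ∈ Q₁ ×ˢ Q₂, (g q : ℤ) ≤ g₁ q.1 + g₂ q.2 := fun q hq => by
    exact_mod_cast (pair q hq).2
  have carry := sum_carry_eq_zero deg he₁ he₂ hpos Q₁ Q₂ hQ₁ hQ₂
  have sfst : ∀ f : X → ℤ, ∑ q ∈ Q₁ ×ˢ Q₂, f q.1 = Q₂.card * ∑ q ∈ Q₁, f q := by
    intro f
    rw [Finset.sum_product, Finset.mul_sum]
    simp
  have ssnd : ∀ f : X → ℤ, ∑ q ∈ Q₁ ×ˢ Q₂, f q.2 = Q₁.card * ∑ q ∈ Q₂, f q := by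
    intro f
    rw [Finset.sum_product]
    simp
  have hsumle := Finset.sum_le_sum hle
  have hsumeq : ∑ q ∈ Q₁ ×ˢ Q₂, ((g₁ q.1 : ℤ) + g₂ q.2) =
      Q₂.card * (semigroupGaps deg H₁ S₁).ncard + Q₁.card * (semigroupGaps deg H₂ S₂).ncard := by
    rw [Finset.sum_add_distrib, sfst fun q => (g₁ q : ℤ), ssnd fun q => (g₂ q : ℤ), gc₁, gc₂]
    push_cast
    rfl
  simp only [Finset.sum_add_distrib, Finset.sum_sub_distrib, ← Finset.mul_sum] at carry
  rw [← hP, ← zeroCard, sfst fun q => if deg q = 0 then 1 else 0,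
    ssnd fun q => if deg q = 0 then 1 else 0, ← zero₁ H₁ Q₁ hQ₁, ← zero₁ H₂ Q₂ hQ₂] at carry
  have hone : ∑ q ∈ Q₁ ×ˢ Q₂, (1 : ℤ) = Q₁.card * Q₂.card := by simp
  rw [hone] at carry
  refine ⟨slabN.1, by rw [slabNcard, hn₁, hn₂], gapN.1, ?_, ?_⟩
  · rw [hn₁, hn₂, gapCard]
    rw [hsumeq] at hsumle
    linarith
  · intro heq
    rw [hn₁, hn₂, gapCard] at heq
    have hsum : ∑ q ∈ Q₁ ×ˢ Q₂, (g q : ℤ) = ∑ q ∈ Q₁ ×ˢ Q₂, ((g₁ q.1 : ℤ) + g₂ q.2) := by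
      rw [hsumeq]
      linarith
    -- Equality of the sums is equality on every fibre. On the fibre of (0, 0) the two sets are {n |
    -- ne ∈ Sᵢ}, both contain 0, and so both contain 1.
    have z₁ : (0 : X) ∈ Q₁ := (m₁ 0).2 ⟨H₁.zero_mem, by simp, by simpa using hpos⟩
    have z₂ : (0 : X) ∈ Q₂ := (m₂ 0).2 ⟨H₂.zero_mem, by simp, by simpa using hpos⟩
    have h0 := (Finset.sum_eq_sum_iff_of_le hle).1 hsum (0, 0) (Finset.mem_product.2 ⟨z₁, z₂⟩)
    have := one_mem_of_ncard_nonneg_compl_add_eq (A := {n : ℤ | (0 : X) + n • e ∈ S₁})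
      (B := {n : ℤ | (0 : X) + n • e ∈ S₂}) (by simp) (by simp) (gf₁ 0 z₁) (gf₂ 0 z₂)
      (by exact_mod_cast h0)
    simpa using this

end Counting

/-! ### Semigroups built by successive gluings, and the bound for 2δ - r -/

section GluedSemigroups

variable {X Λ : Type*} [AddCommGroup X] (deg : X →+ ℤ) (g : Λ → X)

/-- The group generated by the elements indexed by `L`. -/
def leafGroup (L : Finset Λ) : AddSubgroup X := AddSubgroup.closure (g '' L)

/-- The semigroup generated by the elements indexed by `L`. -/
def leafSemigroup (L : Finset Λ) : AddSubmonoid X := AddSubmonoid.closure (g '' L)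

/-- `GluedSemigroup deg g L W C`: the semigroup generated by the elements indexed by `L` arises
from cyclic ones by successive gluings.  `W` is the bound for `2δ - r` in units of degree, and
`C` records the pairs of an index set and an element along which it is glued. -/
inductive GluedSemigroup [DecidableEq Λ] : Finset Λ → ℤ → Set (Finset Λ × X) → Prop
  | leaf (w : Λ) : GluedSemigroup {w} (-deg (g w)) ∅
  | glue {L₁ L₂ : Finset Λ} {W₁ W₂ : ℤ} {C₁ C₂ : Set (Finset Λ × X)} {e : X}
      (hdisj : Disjoint L₁ L₂)
      (hinf : leafGroup g L₁ ⊓ leafGroup g L₂ = AddSubgroup.zmultiples e) (hpos : 0 < deg e)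
      (h₁ : GluedSemigroup L₁ W₁ C₁) (h₂ : GluedSemigroup L₂ W₂ C₂) :
      GluedSemigroup (L₁ ∪ L₂) (W₁ + W₂ + deg e) (C₁ ∪ C₂ ∪ {(L₁, e), (L₂, e)})

variable {deg g}

theorem leafGroup_union [DecidableEq Λ] (L₁ L₂ : Finset Λ) :
    leafGroup g (L₁ ∪ L₂) = leafGroup g L₁ ⊔ leafGroup g L₂ := by
  rw [leafGroup, Finset.coe_union, Set.image_union, AddSubgroup.closure_union]
  rfl

theorem leafSemigroup_union [DecidableEq Λ] (L₁ L₂ : Finset Λ) :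
    leafSemigroup g (L₁ ∪ L₂) = leafSemigroup g L₁ ⊔ leafSemigroup g L₂ := by
  rw [leafSemigroup, Finset.coe_union, Set.image_union, AddSubmonoid.closure_union]
  rfl

theorem leafSemigroup_le (L : Finset Λ) :
    leafSemigroup g L ≤ (leafGroup g L).toAddSubmonoid :=
  AddSubmonoid.closure_le.2 AddSubgroup.subset_closure

theorem deg_nonneg_of_mem_leafSemigroup (hg : ∀ w, 0 < deg (g w)) {L : Finset Λ} {x : X}
    (hx : x ∈ leafSemigroup g L) : 0 ≤ deg x := by
  induction hx using AddSubmonoid.closure_induction with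
  | mem x hx =>
    obtain ⟨w, -, rfl⟩ := hx
    exact (hg w).le
  | zero => simp
  | add x y _ _ hx hy =>
    rw [map_add]
    exact add_nonneg hx hy

theorem ncard_degreeSlab_pos {H : AddSubgroup X} {P : ℤ} (hP : 0 < P)
    (hfin : (degreeSlab deg H P).Finite) : 0 < (degreeSlab deg H P).ncard :=
  (Set.ncard_pos hfin).2 ⟨0, H.zero_mem, by simp, by simpa using hP⟩

theorem leafGroup_singleton_slab (w : Λ) (hw : 0 < deg (g w)) :
    degreeSlab deg (leafGroup g {w}) (deg (g w)) = {0} := by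
  ext x
  simp only [degreeSlab, leafGroup, Finset.coe_singleton, Set.image_singleton,
    Set.mem_ofPred_eq, Set.mem_singleton_iff, ← AddSubgroup.zmultiples_eq_closure]
  constructor
  · rintro ⟨hx, h1, h2⟩
    obtain ⟨n, rfl⟩ := AddSubgroup.mem_zmultiples_iff.1 hx
    rw [map_zsmul, smul_eq_mul] at h1 h2
    have : n < 1 := by by_contra! h; nlinarith
    have : -1 < n := by by_contra! h; nlinarith
    obtain rfl : n = 0 := by omega
    simp
  · rintro rfl
    exact ⟨AddSubgroup.zero_mem _, by simp, by simpa using hw⟩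

theorem leafGroup_singleton_gaps (w : Λ) (hw : 0 < deg (g w)) :
    semigroupGaps deg (leafGroup g {w}) (leafSemigroup g {w}) = ∅ := by
  rw [Set.eq_empty_iff_forall_notMem]
  rintro x ⟨hx, h1, h2⟩
  simp only [leafGroup, Finset.coe_singleton, Set.image_singleton,
    ← AddSubgroup.zmultiples_eq_closure] at hx
  obtain ⟨n, rfl⟩ := AddSubgroup.mem_zmultiples_iff.1 hx
  rw [map_zsmul, smul_eq_mul] at h1
  have h3 : 0 ≤ n := by by_contra! h; nlinarith
  lift n to ℕ using h3
  rw [natCast_zsmul] at h2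
  exact h2 (AddSubmonoid.nsmul_mem _ (AddSubmonoid.subset_closure
    (Set.mem_image_of_mem g (by simp))) _)

theorem leafGroup_singleton_slab_one (w : Λ) (hw : 0 < deg (g w)) :
    degreeSlab deg (leafGroup g {w}) 1 = {0} := by
  refine Set.Subset.antisymm ?_ ?_
  · rw [← leafGroup_singleton_slab w hw]
    exact fun x hx => ⟨hx.1, hx.2.1, lt_of_lt_of_le hx.2.2 hw⟩
  · rintro _ rfl
    exact ⟨AddSubgroup.zero_mem _, by simp, by simp⟩

/-- The normalized quantity is (2δ - r) deg e / N, where N is the number of group elements of degree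
in [0, deg e). Slab counts multiply under gluing, so dividing the inequality of `glue_gaps` by N₁N₂
makes it additive up to the term deg e. Any period e may be used, because the ratio deg e / N is the
same for all of them. -/
theorem GluedSemigroup.exists_bound [DecidableEq Λ] (hg : ∀ w, 0 < deg (g w)) {L : Finset Λ} {W : ℤ}
    {C : Set (Finset Λ × X)} (h : GluedSemigroup deg g L W C) :
    (semigroupGaps deg (leafGroup g L) (leafSemigroup g L)).Finite ∧
    ∃ e ∈ leafGroup g L, 0 < deg e ∧ (degreeSlab deg (leafGroup g L) (deg e)).Finite ∧
      deg e * (2 * (semigroupGaps deg (leafGroup g L) (leafSemigroup g L)).ncard -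
        (degreeSlab deg (leafGroup g L) 1).ncard) ≤
        W * (degreeSlab deg (leafGroup g L) (deg e)).ncard ∧
      (deg e * (2 * (semigroupGaps deg (leafGroup g L) (leafSemigroup g L)).ncard -
        (degreeSlab deg (leafGroup g L) 1).ncard) =
        W * (degreeSlab deg (leafGroup g L) (deg e)).ncard →
        ∀ p ∈ C, p.2 ∈ leafSemigroup g p.1) := by
  induction h with
  | leaf w =>
    have hw := hg w
    rw [leafGroup_singleton_gaps w hw, leafGroup_singleton_slab_one w hw]
    refine ⟨Set.finite_empty, g w, AddSubgroup.subset_closure ⟨w, by simp, rfl⟩, hw, ?_⟩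
    rw [leafGroup_singleton_slab w hw]
    simp
  | @glue L₁ L₂ W₁ W₂ C₁ C₂ e hdisj hinf hpos h₁ h₂ ih₁ ih₂ =>
    obtain ⟨gf₁, e₁, he₁, hp₁, hf₁, hle₁, heq₁⟩ := ih₁
    obtain ⟨gf₂, e₂, he₂, hp₂, hf₂, hle₂, heq₂⟩ := ih₂
    have m₁ : e ∈ leafGroup g L₁ := (hinf.ge (AddSubgroup.mem_zmultiples e)).1
    have m₂ : e ∈ leafGroup g L₂ := (hinf.ge (AddSubgroup.mem_zmultiples e)).2
    have c₁ := deg_mul_ncard_degreeSlab deg he₁ hp₁ m₁ hpos hf₁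
    have c₂ := deg_mul_ncard_degreeSlab deg he₂ hp₂ m₂ hpos hf₂
    have f₁ := degreeSlab_finite_of_finite deg he₁ hp₁ hf₁ (deg e)
    have f₂ := degreeSlab_finite_of_finite deg he₂ hp₂ hf₂ (deg e)
    have p₁ := ncard_degreeSlab_pos hpos f₁
    have p₂ := ncard_degreeSlab_pos hpos f₂
    obtain ⟨k1, k2, k3, k4, k5⟩ := glue_gaps deg hinf hpos (leafSemigroup_le L₁)
      (leafSemigroup_le L₂) (fun _ => deg_nonneg_of_mem_leafSemigroup hg)
      (fun _ => deg_nonneg_of_mem_leafSemigroup hg) f₁ f₂ gf₁ gf₂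
    simp only [leafGroup_union, leafSemigroup_union]
    refine ⟨k3, e, AddSubgroup.mem_sup_left m₁, hpos, k1, ?_⟩
    rw [k2]
    generalize ((semigroupGaps deg (leafGroup g L₁) (leafSemigroup g L₁)).ncard : ℤ) = δ₁ at *
    generalize ((semigroupGaps deg (leafGroup g L₂) (leafSemigroup g L₂)).ncard : ℤ) = δ₂ at *
    generalize (2 * ((semigroupGaps deg (leafGroup g L₁ ⊔ leafGroup g L₂)
      (leafSemigroup g L₁ ⊔ leafSemigroup g L₂)).ncard : ℤ) -
        (degreeSlab deg (leafGroup g L₁ ⊔ leafGroup g L₂) 1).ncard) = Φ at *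
    generalize (2 * δ₁ - (degreeSlab deg (leafGroup g L₁) 1).ncard) = Φ₁ at *
    generalize (2 * δ₂ - (degreeSlab deg (leafGroup g L₂) 1).ncard) = Φ₂ at *
    push_cast
    generalize (degreeSlab deg (leafGroup g L₁) (deg e)).ncard = N₁ at *
    generalize (degreeSlab deg (leafGroup g L₂) (deg e)).ncard = N₂ at *
    have q₁ : (0 : ℤ) < N₁ := by exact_mod_cast p₁
    have q₂ : (0 : ℤ) < N₂ := by exact_mod_cast p₂
    -- The inductive bound refers to its own period e₁; it is rescaled to the gluing element e.
    have b₁ : deg e * Φ₁ ≤ W₁ * N₁ := by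
      refine le_of_mul_le_mul_left ?_ hp₁
      calc deg e₁ * (deg e * Φ₁) = deg e * (deg e₁ * Φ₁) := by ring
        _ ≤ deg e * (W₁ * _) := mul_le_mul_of_nonneg_left hle₁ hpos.le
        _ = W₁ * (deg e₁ * N₁) := by rw [c₁]; ring
        _ = _ := by ring
    have b₂ : deg e * Φ₂ ≤ W₂ * N₂ := by
      refine le_of_mul_le_mul_left ?_ hp₂
      calc deg e₂ * (deg e * Φ₂) = deg e * (deg e₂ * Φ₂) := by ring
        _ ≤ deg e * (W₂ * _) := mul_le_mul_of_nonneg_left hle₂ hpos.le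
        _ = W₂ * (deg e₂ * N₂) := by rw [c₂]; ring
        _ = _ := by ring
    have t₁ : N₂ * (deg e * Φ₁) ≤ N₂ * (W₁ * N₁) := mul_le_mul_of_nonneg_left b₁ q₂.le
    have t₂ : N₁ * (deg e * Φ₂) ≤ N₁ * (W₂ * N₂) := mul_le_mul_of_nonneg_left b₂ q₁.le
    have t₃ := mul_le_mul_of_nonneg_left k4 hpos.le
    -- The bound is a sum of three inequalities, so equality in the total forces equality in both
    -- parts and in the gluing step.
    refine ⟨by linarith, fun heq => ?_⟩
    have u₁ : N₂ * (deg e * Φ₁) = N₂ * (W₁ * N₁) := by linarith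
    have u₂ : N₁ * (deg e * Φ₂) = N₁ * (W₂ * N₂) := by linarith
    have v₁ := mul_left_cancel₀ q₂.ne' u₁
    have v₂ := mul_left_cancel₀ q₁.ne' u₂
    have v₃ := k5 (mul_left_cancel₀ hpos.ne' (le_antisymm t₃ (by linarith)))
    have x₁ := heq₁ (mul_left_cancel₀ hpos.ne' (by
      rw [mul_left_comm, v₁, mul_left_comm (deg e), ← c₁]
      ring))
    have x₂ := heq₂ (mul_left_cancel₀ hpos.ne' (by
      rw [mul_left_comm, v₂, mul_left_comm (deg e), ← c₂]
      ring))
    rintro p ((hp | hp) | (rfl | rfl))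
    exacts [x₁ p hp, x₂ p hp, v₃.1, v₃.2]

/-- The hypothesis `hcard` says that the group has one element per unit of degree, so the
normalizing factor is 1. -/
theorem GluedSemigroup.bound [DecidableEq Λ] (hg : ∀ w, 0 < deg (g w)) {L : Finset Λ} {W : ℤ}
    {C : Set (Finset Λ × X)} (h : GluedSemigroup deg g L W C) {e : X} (he : e ∈ leafGroup g L)
    (hpos : 0 < deg e) (hcard : ((degreeSlab deg (leafGroup g L) (deg e)).ncard : ℤ) = deg e) :
    (2 * (semigroupGaps deg (leafGroup g L) (leafSemigroup g L)).ncard -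
        (degreeSlab deg (leafGroup g L) 1).ncard) ≤ W ∧
      ((2 * (semigroupGaps deg (leafGroup g L) (leafSemigroup g L)).ncard -
        (degreeSlab deg (leafGroup g L) 1).ncard) = W →
        ∀ p ∈ C, p.2 ∈ leafSemigroup g p.1) := by
  obtain ⟨-, e', he', hpos', hfin, hle, heq⟩ := h.exists_bound hg
  have c := deg_mul_ncard_degreeSlab deg he' hpos' he hpos hfin
  rw [hcard, mul_comm] at c
  have c' := mul_left_cancel₀ hpos.ne' c
  rw [← c', mul_comm] at hle heq
  exact ⟨le_of_mul_le_mul_right hle hpos', fun h => heq (by rw [h])⟩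

end GluedSemigroups

/-! ### Polynomial rings mapping to group algebras -/

section SemigroupAlgebra

variable (k : Type*) [CommRing k] {X Λ : Type*} [AddCommGroup X] (g : Λ → X)

/-- The homomorphism from the polynomial ring to the group algebra sending variables to the
group elements `g w`. -/
noncomputable def semigroupAlgHom : MvPolynomial Λ k →ₐ[k] AddMonoidAlgebra k X :=
  MvPolynomial.aeval fun w => AddMonoidAlgebra.single (g w) 1

theorem semigroupAlgHom_monomial (a : Λ →₀ ℕ) (c : k) :
    semigroupAlgHom k g (MvPolynomial.monomial a c) =
      AddMonoidAlgebra.single (Finsupp.linearCombination ℕ g a) c := by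
  classical
  rw [semigroupAlgHom, MvPolynomial.aeval_monomial, Finsupp.linearCombination_apply]
  have : (a.prod fun w n => (AddMonoidAlgebra.single (g w) (1 : k)) ^ n) =
      AddMonoidAlgebra.single (a.sum fun w n => n • g w) 1 := by
    induction a using Finsupp.induction with
    | zero => rfl
    | single_add w n f _ _ ih =>
      rw [Finsupp.prod_add_index' (by simp) (by simp [pow_add]),
        Finsupp.sum_add_index' (by simp) (by simp [add_smul]), ih,
        Finsupp.prod_single_index (by simp), Finsupp.sum_single_index (by simp),
        AddMonoidAlgebra.single_pow, AddMonoidAlgebra.single_mul_single]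
      simp
  rw [this, AddMonoidAlgebra.coe_algebraMap]
  simp [AddMonoidAlgebra.single_mul_single]

theorem mem_leafSemigroup_iff {L : Finset Λ} {x : X} :
    x ∈ leafSemigroup g L ↔
      ∃ a : Λ →₀ ℕ, (∀ w, a w ≠ 0 → w ∈ L) ∧ Finsupp.linearCombination ℕ g a = x := by
  classical
  constructor
  · intro hx
    induction hx using AddSubmonoid.closure_induction with
    | mem x hx =>
      obtain ⟨w, hw, rfl⟩ := hx
      refine ⟨Finsupp.single w 1, fun v hv => ?_, by simp⟩
      obtain rfl : w = v := by
        by_contra h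
        exact hv (Finsupp.single_eq_of_ne (Ne.symm h))
      exact hw
    | zero => exact ⟨0, by simp, by simp⟩
    | add x y _ _ hx hy =>
      obtain ⟨a, ha, rfl⟩ := hx
      obtain ⟨b, hb, rfl⟩ := hy
      refine ⟨a + b, fun w hw => ?_, map_add _ _ _⟩
      by_cases h : a w = 0
      · exact hb w fun h' => hw (by simp [h, h'])
      · exact ha w h
  · rintro ⟨a, ha, rfl⟩
    rw [Finsupp.linearCombination_apply, Finsupp.sum]
    refine AddSubmonoid.sum_mem _ fun w hw => AddSubmonoid.nsmul_mem _
      (AddSubmonoid.subset_closure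
        (Set.mem_image_of_mem g (ha w (Finsupp.mem_support_iff.1 hw)))) _

theorem linearCombination_mem_leafGroup {L : Finset Λ} {a : Λ →₀ ℕ} (ha : ∀ w, a w ≠ 0 → w ∈ L) :
    Finsupp.linearCombination ℕ g a ∈ leafGroup g L := by
  classical
  exact leafSemigroup_le L ((mem_leafSemigroup_iff g).2 ⟨a, ha, rfl⟩)

/-- The kernel of the map to the group algebra is generated by binomials. -/
theorem ker_semigroupAlgHom_le {J : Ideal (MvPolynomial Λ k)}
    (hJ : ∀ a b : Λ →₀ ℕ, Finsupp.linearCombination ℕ g a = Finsupp.linearCombination ℕ g b →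
      MvPolynomial.monomial a 1 - MvPolynomial.monomial b 1 ∈ J) :
    RingHom.ker (semigroupAlgHom k g) ≤ J := by
  classical
  -- One monomial is chosen above each attained group element. Modulo J every monomial equals the
  -- chosen one, so the class of f modulo J is recovered linearly from its image by `ψ`.
  let rep : X → (Λ →₀ ℕ) := fun x =>
    if h : ∃ a, Finsupp.linearCombination ℕ g a = x then h.choose else 0
  have hrep : ∀ a, Finsupp.linearCombination ℕ g (rep (Finsupp.linearCombination ℕ g a)) =
      Finsupp.linearCombination ℕ g a := by
    intro a
    have h : ∃ b, Finsupp.linearCombination ℕ g b = Finsupp.linearCombination ℕ g a := ⟨a, rfl⟩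
    simp only [rep, dif_pos h]
    exact h.choose_spec
  let ψ : (X →₀ k) →ₗ[k] MvPolynomial Λ k ⧸ J := Finsupp.linearCombination k fun x =>
    Ideal.Quotient.mk J (MvPolynomial.monomial (rep x) 1)
  have key : ∀ f : MvPolynomial Λ k,
      ψ (semigroupAlgHom k g f).coeff = Ideal.Quotient.mk J f := by
    intro f
    induction f using MvPolynomial.induction_on' with
    | monomial a c =>
      rw [semigroupAlgHom_monomial]
      have : MvPolynomial.monomial a c = c • MvPolynomial.monomial a (1 : k) := by
        rw [MvPolynomial.smul_monomial, smul_eq_mul, mul_one]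
      rw [this]
      have h2 : Ideal.Quotient.mk J (c • MvPolynomial.monomial a (1 : k)) =
        c • Ideal.Quotient.mk J (MvPolynomial.monomial a (1 : k)) := rfl
      rw [h2, Ideal.Quotient.eq.2 (hJ a _ (hrep a).symm)]
      simp [ψ]
    | add p q hp hq =>
      rw [map_add (semigroupAlgHom k g), AddMonoidAlgebra.coeff_add, map_add ψ, hp, hq, map_add]
  intro f hf
  rw [RingHom.mem_ker] at hf
  rw [← Ideal.Quotient.eq_zero_iff_mem, ← key f, hf]
  exact map_zero ψ

end SemigroupAlgebra

/-! ### Binomial generators of the ideal of a glued semigroup -/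

section Binomials

variable (k : Type*) [CommRing k] {X Λ : Type*} [AddCommGroup X] {g : Λ → X} {deg : X →+ ℤ}

/-- Split a and b into their L₁ and L₂ parts. If they represent the same element, their L₁ parts
differ by an element of the intersection, that is by ne. The relations on each side exhibit n copies
of m₁, respectively of m₂, and the single new binomial trades one for the other. -/
theorem monomial_sub_mem_of_glue {L₁ L₂ : Finset Λ} {e : X}
    (hinf : leafGroup g L₁ ⊓ leafGroup g L₂ = AddSubgroup.zmultiples e)
    {m₁ m₂ : Λ →₀ ℕ} (hm₁ : ∀ w, m₁ w ≠ 0 → w ∈ L₁) (hm₂ : ∀ w, m₂ w ≠ 0 → w ∈ L₂)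
    (he₁ : Finsupp.linearCombination ℕ g m₁ = e) (he₂ : Finsupp.linearCombination ℕ g m₂ = e)
    {J : Ideal (MvPolynomial Λ k)}
    (hJ₁ : ∀ a b : Λ →₀ ℕ, (∀ w, a w ≠ 0 → w ∈ L₁) → (∀ w, b w ≠ 0 → w ∈ L₁) →
      Finsupp.linearCombination ℕ g a = Finsupp.linearCombination ℕ g b →
      MvPolynomial.monomial a 1 - MvPolynomial.monomial b 1 ∈ J)
    (hJ₂ : ∀ a b : Λ →₀ ℕ, (∀ w, a w ≠ 0 → w ∈ L₂) → (∀ w, b w ≠ 0 → w ∈ L₂) →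
      Finsupp.linearCombination ℕ g a = Finsupp.linearCombination ℕ g b →
      MvPolynomial.monomial a 1 - MvPolynomial.monomial b 1 ∈ J)
    (hm : MvPolynomial.monomial m₁ 1 - MvPolynomial.monomial m₂ 1 ∈ J)
    (a b : Λ →₀ ℕ) (ha : ∀ w, a w ≠ 0 → w ∈ L₁ ∨ w ∈ L₂) (hb : ∀ w, b w ≠ 0 → w ∈ L₁ ∨ w ∈ L₂)
    (hab : Finsupp.linearCombination ℕ g a = Finsupp.linearCombination ℕ g b) :
    MvPolynomial.monomial a 1 - MvPolynomial.monomial b 1 ∈ J := by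
  classical
  let M : (Λ →₀ ℕ) → MvPolynomial Λ k ⧸ J := fun a =>
    Ideal.Quotient.mk J (MvPolynomial.monomial a 1)
  have Madd : ∀ a b, M (a + b) = M a * M b := fun a b => by
    simp only [M, ← map_mul, MvPolynomial.monomial_mul, mul_one]
  have Mnsmul : ∀ (n : ℕ) a, M (n • a) = M a ^ n := fun n a => by
    simp only [M, ← map_pow, MvPolynomial.monomial_pow, one_pow]
  have split : ∀ a : Λ →₀ ℕ, (∀ w, a w ≠ 0 → w ∈ L₁ ∨ w ∈ L₂) → ∃ a₁ a₂ : Λ →₀ ℕ,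
      (∀ w, a₁ w ≠ 0 → w ∈ L₁) ∧ (∀ w, a₂ w ≠ 0 → w ∈ L₂) ∧ a = a₁ + a₂ := by
    intro a ha
    refine ⟨a.filter (· ∈ L₁), a.filter (· ∉ L₁), fun w hw => ?_, fun w hw => ?_,
      (Finsupp.filter_add_filter_not a _).symm⟩
    · by_contra h
      exact hw (Finsupp.filter_apply_neg _ _ h)
    · by_cases h : w ∈ L₁
      · exact absurd (Finsupp.filter_apply_neg (fun x => x ∉ L₁) a (not_not.2 h)) hw
      · rw [Finsupp.filter_apply_pos (fun x => x ∉ L₁) a h] at hw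
        exact (ha w hw).resolve_left h
  suffices key : ∀ (a₁ b₁ a₂ b₂ : Λ →₀ ℕ) (n : ℕ), (∀ w, a₁ w ≠ 0 → w ∈ L₁) →
      (∀ w, b₁ w ≠ 0 → w ∈ L₁) → (∀ w, a₂ w ≠ 0 → w ∈ L₂) → (∀ w, b₂ w ≠ 0 → w ∈ L₂) →
      Finsupp.linearCombination ℕ g a₁ = Finsupp.linearCombination ℕ g b₁ + n • e →
      Finsupp.linearCombination ℕ g b₂ = Finsupp.linearCombination ℕ g a₂ + n • e →
      M (a₁ + a₂) = M (b₁ + b₂) by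
    obtain ⟨a₁, a₂, ha₁, ha₂, rfl⟩ := split a ha
    obtain ⟨b₁, b₂, hb₁, hb₂, rfl⟩ := split b hb
    rw [map_add, map_add] at hab
    have hmem : Finsupp.linearCombination ℕ g a₁ - Finsupp.linearCombination ℕ g b₁ ∈
        leafGroup g L₁ ⊓ leafGroup g L₂ := by
      refine ⟨AddSubgroup.sub_mem _ (linearCombination_mem_leafGroup g ha₁)
        (linearCombination_mem_leafGroup g hb₁), ?_⟩
      rw [sub_eq_sub_iff_add_eq_add.2 (hab.trans (add_comm _ _))]
      exact AddSubgroup.sub_mem _ (linearCombination_mem_leafGroup g hb₂)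
        (linearCombination_mem_leafGroup g ha₂)
    rw [hinf] at hmem
    obtain ⟨n, hn⟩ := AddSubgroup.mem_zmultiples_iff.1 hmem
    rw [← Ideal.Quotient.eq]
    have h2 : Finsupp.linearCombination ℕ g b₂ - Finsupp.linearCombination ℕ g a₂ = n • e := by
      rw [hn, sub_eq_sub_iff_add_eq_add, add_comm, ← hab, add_comm]
    -- For negative n the roles of a and b are exchanged, so that only nonnegative exponents occur.
    obtain ⟨n, rfl | rfl⟩ := n.eq_nat_or_neg
    · rw [natCast_zsmul] at hn h2
      exact key a₁ b₁ a₂ b₂ n ha₁ hb₁ ha₂ hb₂ (by rw [hn]; abel) (by rw [← h2]; abel)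
    · rw [neg_smul, natCast_zsmul] at hn h2
      have hn' : n • e = Finsupp.linearCombination ℕ g b₁ - Finsupp.linearCombination ℕ g a₁ := by
        rw [← neg_sub, ← hn, neg_neg]
      have h2' : n • e = Finsupp.linearCombination ℕ g a₂ - Finsupp.linearCombination ℕ g b₂ := by
        rw [← neg_sub, h2, neg_neg]
      exact (key b₁ a₁ b₂ a₂ n hb₁ ha₁ hb₂ ha₂ (by rw [hn']; abel)
        (by rw [h2']; abel)).symm
  intro a₁ b₁ a₂ b₂ n ha₁ hb₁ ha₂ hb₂ h₁ h₂
  have supp : ∀ (L : Finset Λ) (b m : Λ →₀ ℕ), (∀ w, b w ≠ 0 → w ∈ L) → (∀ w, m w ≠ 0 → w ∈ L) →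
      ∀ w, (b + n • m) w ≠ 0 → w ∈ L := by
    intro L b m hb hm w hw
    by_cases h : b w = 0
    · exact hm w fun h' => hw (by simp [h, h'])
    · exact hb w h
  have e₁ : M a₁ = M (b₁ + n • m₁) := Ideal.Quotient.eq.2
    (hJ₁ _ _ ha₁ (supp L₁ _ _ hb₁ hm₁) (by rw [h₁, map_add, map_nsmul, he₁]))
  have e₂ : M b₂ = M (a₂ + n • m₂) := Ideal.Quotient.eq.2
    (hJ₂ _ _ hb₂ (supp L₂ _ _ ha₂ hm₂) (by rw [h₂, map_add, map_nsmul, he₂]))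
  have e₃ : M m₁ = M m₂ := Ideal.Quotient.eq.2 hm
  rw [Madd, Madd, e₁, e₂, Madd, Madd, Mnsmul, Mnsmul, e₃]
  ring

/-- If all gluing elements lie in the semigroups, the congruence defining the glued semigroup is
generated by one binomial less than there are generators. -/
theorem GluedSemigroup.exists_binomials [DecidableEq Λ] (hg : ∀ w, 0 < deg (g w)) {L : Finset Λ}
    {W : ℤ} {C : Set (Finset Λ × X)} (h : GluedSemigroup deg g L W C)
    (hC : ∀ p ∈ C, p.2 ∈ leafSemigroup g p.1) :
    ∃ l : List (MvPolynomial Λ k), l.length + 1 = L.card ∧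
      (∀ f ∈ l, f ∈ RingHom.ker (semigroupAlgHom k g)) ∧
      ∀ a b : Λ →₀ ℕ, (∀ w, a w ≠ 0 → w ∈ L) → (∀ w, b w ≠ 0 → w ∈ L) →
        Finsupp.linearCombination ℕ g a = Finsupp.linearCombination ℕ g b →
        MvPolynomial.monomial a 1 - MvPolynomial.monomial b 1 ∈ Ideal.span {f | f ∈ l} := by
  induction h with
  | leaf w =>
    refine ⟨[], by simp, by simp, fun a b ha hb hab => ?_⟩
    have single : ∀ a : Λ →₀ ℕ, (∀ v, a v ≠ 0 → v ∈ ({w} : Finset Λ)) →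
        a = Finsupp.single w (a w) := by
      intro a ha
      ext v
      by_cases hv : v = w
      · simp [hv]
      · rw [Finsupp.single_eq_of_ne hv]
        by_contra h
        exact hv (by simpa using ha v h)
    -- The generator has positive degree, so its multiples are distinct and a single leaf needs no
    -- relation.
    have : a = b := by
      rw [single a ha, single b hb] at hab ⊢
      rw [Finsupp.linearCombination_single, Finsupp.linearCombination_single] at hab
      have := congrArg deg hab
      rw [map_nsmul, map_nsmul, nsmul_eq_mul, nsmul_eq_mul] at this
      have := mul_right_cancel₀ (hg w).ne' this
      rw [Nat.cast_injective this]
    rw [this, sub_self]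
    exact Ideal.zero_mem _
  | @glue L₁ L₂ W₁ W₂ C₁ C₂ e hdisj hinf hpos h₁ h₂ ih₁ ih₂ =>
    obtain ⟨l₁, hl₁, hk₁, hs₁⟩ := ih₁ fun p hp => hC p (Or.inl (Or.inl hp))
    obtain ⟨l₂, hl₂, hk₂, hs₂⟩ := ih₂ fun p hp => hC p (Or.inl (Or.inr hp))
    obtain ⟨m₁, hm₁, he₁⟩ := (mem_leafSemigroup_iff g).1 (hC (L₁, e) (Or.inr (Or.inl rfl)))
    obtain ⟨m₂, hm₂, he₂⟩ := (mem_leafSemigroup_iff g).1 (hC (L₂, e) (Or.inr (Or.inr rfl)))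
    -- The new relation equates two expressions of e, one on each side. Each gluing adds one
    -- binomial and lowers the number of pieces by one, which keeps the count at one less than the
    -- number of generators.
    refine ⟨(MvPolynomial.monomial m₁ 1 - MvPolynomial.monomial m₂ 1) :: (l₁ ++ l₂), ?_, ?_, ?_⟩
    · rw [Finset.card_union_of_disjoint hdisj, ← hl₁, ← hl₂, List.length_cons, List.length_append]
      omega
    · intro f hf
      rcases List.mem_cons.1 hf with rfl | hf
      · rw [RingHom.mem_ker, map_sub, semigroupAlgHom_monomial, semigroupAlgHom_monomial,
          he₁, he₂, sub_self]
      · rcases List.mem_append.1 hf with hf | hf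
        exacts [hk₁ f hf, hk₂ f hf]
    · intro a b ha hb hab
      refine monomial_sub_mem_of_glue k hinf hm₁ hm₂ he₁ he₂ ?_ ?_ ?_ a b
        (fun w hw => Finset.mem_union.1 (ha w hw)) (fun w hw => Finset.mem_union.1 (hb w hw)) hab
      · intro a b ha hb hab
        exact Ideal.span_mono (fun f hf => List.mem_cons_of_mem _ (List.mem_append_left _ hf))
          (hs₁ a b ha hb hab)
      · intro a b ha hb hab
        exact Ideal.span_mono (fun f hf => List.mem_cons_of_mem _ (List.mem_append_right _ hf))
          (hs₂ a b ha hb hab)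
      · exact Ideal.subset_span List.mem_cons_self

end Binomials

/-! ### Recognizing the normalization, its quotient, and the minimal primes -/

section Normalization

open scoped nonZeroDivisors

/-- A non-zero-divisor of the product has all components nonzero, so the total ring of fractions
maps to each fraction field. An integral fraction becomes an element of A i there, and these
elements assemble to one of the product. -/
theorem Pi.isIntegrallyClosed {ι : Type*} (A : ι → Type*) [∀ i, CommRing (A i)]
    [∀ i, IsDomain (A i)] [∀ i, IsIntegrallyClosed (A i)] : IsIntegrallyClosed (∀ i, A i) := by
  classical
  rw [isIntegrallyClosed_iff (FractionRing (∀ i, A i))]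
  intro x hx
  obtain ⟨⟨p, q⟩, hpq⟩ := IsLocalization.surj (∀ i, A i)⁰ x
  have hne : ∀ q : (∀ i, A i)⁰, ∀ i, (q : ∀ i, A i) i ≠ 0 := by
    intro q i hi
    have h := (mem_nonZeroDivisors_iff.1 q.2).1 (Pi.single i 1) (by
      ext j
      by_cases hj : j = i
      · subst hj
        simp [hi]
      · simp [hj])
    have := congrFun h i
    simp at this
  have comp : ∀ i, ∃ a : A i, (q : ∀ i, A i) i * a = p i := by
    intro i
    let φ : (∀ i, A i) →+* FractionRing (A i) :=
      (algebraMap (A i) (FractionRing (A i))).comp (Pi.evalRingHom A i)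
    have hφ : ∀ y : (∀ i, A i)⁰, IsUnit (φ y) := fun y => by
      refine IsUnit.mk0 _ fun h => hne y i ?_
      exact (IsFractionRing.injective (A i) (FractionRing (A i))) (by simpa [φ] using h)
    let ψ : FractionRing (∀ i, A i) →+* FractionRing (A i) := IsLocalization.lift hφ
    have hψ : ∀ y, ψ (algebraMap _ _ y) = φ y := IsLocalization.lift_eq hφ
    have hint : IsIntegral (A i) (ψ x) :=
      hx.map_of_comp_eq (Pi.evalRingHom A i) ψ (RingHom.ext fun y => (hψ y).symm)
    obtain ⟨a, ha⟩ := IsIntegrallyClosed.isIntegral_iff.1 hint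
    refine ⟨a, IsFractionRing.injective (A i) (FractionRing (A i)) ?_⟩
    have := congrArg ψ hpq
    rw [map_mul, hψ, hψ] at this
    rw [map_mul, ha, mul_comm]
    exact this
  choose a ha using comp
  refine ⟨a, ?_⟩
  have hu : IsUnit (algebraMap (∀ i, A i) (FractionRing (∀ i, A i)) q) :=
    IsLocalization.map_units _ q
  rw [← hu.mul_left_inj, hpq, ← map_mul]
  congr 1
  ext i
  rw [Pi.mul_apply, mul_comm, ha]

variable {R P : Type*} [CommRing R] [CommRing P] [Algebra R P]

/-- A criterion for a ring extension to be the normalization: it is integral, integrally closed,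
and has a regular conductor element. -/
theorem nonempty_integralClosure_algEquiv (hinj : Function.Injective (algebraMap R P))
    [Algebra.IsIntegral R P] [IsIntegrallyClosed P] {c : P} (hc : c ∈ P⁰)
    (hcond : ∀ p : P, ∃ r : R, algebraMap R P r = c * p) :
    Nonempty (integralClosure R (FractionRing R) ≃ₐ[R] P) := by
  have hfaith : FaithfulSMul R P := (faithfulSMul_iff_algebraMap_injective R P).2 hinj
  have hreg : ∀ r : R, r ∈ R⁰ → algebraMap R P r ∈ P⁰ := by
    intro r hr
    rw [mem_nonZeroDivisors_iff_right] at hr hc ⊢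
    intro p hp
    obtain ⟨s, hs⟩ := hcond p
    have : s * r = 0 := hinj (by rw [map_mul, hs, mul_assoc, hp, mul_zero, map_zero])
    have h0 := hr s this
    rw [h0, map_zero] at hs
    exact hc p (by rw [mul_comm, ← hs])
  -- R and P have the same total ring of fractions: p/q = cp/cq, and multiplication by c carries P
  -- into R.
  have hfrac : IsFractionRing R (FractionRing P) := by
    refine ⟨⟨fun y => ?_, fun x => ?_, fun {x y} h => ?_⟩⟩
    · rw [IsScalarTower.algebraMap_apply R P (FractionRing P)]
      exact IsLocalization.map_units (FractionRing P) ⟨_, hreg y y.2⟩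
    · obtain ⟨⟨p, q⟩, hpq⟩ := IsLocalization.surj P⁰ x
      obtain ⟨a, ha⟩ := hcond p
      obtain ⟨b, hb⟩ := hcond q
      have hb' : b ∈ R⁰ := by
        rw [mem_nonZeroDivisors_iff_right]
        intro r hr
        have h1 : algebraMap R P r * (c * q) = 0 := by rw [← hb, ← map_mul, hr, map_zero]
        have h2 := (mem_nonZeroDivisors_iff_right.1 (mul_mem hc q.2)) _ h1
        exact hinj (by rw [h2, map_zero])
      refine ⟨(a, ⟨b, hb'⟩), ?_⟩
      simp only at hpq ⊢
      rw [IsScalarTower.algebraMap_apply R P (FractionRing P), hb,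
        IsScalarTower.algebraMap_apply R P (FractionRing P), ha, map_mul, map_mul, ← hpq]
      ring
    · refine ⟨1, ?_⟩
      rw [IsScalarTower.algebraMap_apply R P (FractionRing P),
        IsScalarTower.algebraMap_apply R P (FractionRing P)] at h
      rw [hinj (IsFractionRing.injective P (FractionRing P) h)]
  have e₁ : FractionRing R ≃ₐ[R] FractionRing P :=
    IsLocalization.algEquiv R⁰ (FractionRing R) (FractionRing P)
  have : IsIntegralClosure P R (FractionRing P) :=
    IsIntegralClosure.of_isIntegrallyClosed P R (FractionRing P)
  exact ⟨e₁.mapIntegralClosure.trans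
    (IsIntegralClosure.equiv R (integralClosure R (FractionRing P)) (FractionRing P) P)⟩

/-- For use with Ψ reading off the coefficients at the gaps of a semigroup, whose common kernel is
the semigroup ring. -/
theorem finite_and_finrank_normalization_quotient {k : Type*} [Field k] [Algebra k R] [Algebra k P]
    [IsScalarTower k R P] (e : integralClosure R (FractionRing R) ≃ₐ[R] P) {γ : Type*} [Fintype γ]
    (Ψ : P →ₗ[k] (γ → k)) (hsurj : Function.Surjective Ψ)
    (hker : ∀ p, Ψ p = 0 ↔ ∃ r, algebraMap R P r = p) :
    Module.Finite k (integralClosure R (FractionRing R) ⧸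
      LinearMap.range (Algebra.linearMap R (integralClosure R (FractionRing R)))) ∧
    Module.finrank k (integralClosure R (FractionRing R) ⧸
      LinearMap.range (Algebra.linearMap R (integralClosure R (FractionRing R)))) =
      Fintype.card γ := by
  have h1 : (LinearMap.range (Algebra.linearMap R (integralClosure R (FractionRing R)))).map
      (e.toLinearEquiv : integralClosure R (FractionRing R) →ₗ[R] P) =
      LinearMap.range (Algebra.linearMap R P) := by
    ext p
    simp only [Submodule.mem_map, LinearMap.mem_range, Algebra.linearMap_apply]
    constructor
    · rintro ⟨_, ⟨r, rfl⟩, rfl⟩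
      exact ⟨r, (e.commutes r).symm⟩
    · rintro ⟨r, rfl⟩
      exact ⟨_, ⟨r, rfl⟩, e.commutes r⟩
  let E₁ := (Submodule.Quotient.equiv _ _ e.toLinearEquiv h1).restrictScalars k
  have h2 : (LinearMap.range (Algebra.linearMap R P)).restrictScalars k = LinearMap.ker Ψ := by
    ext p
    rw [Submodule.restrictScalars_mem, LinearMap.mem_ker, hker, LinearMap.mem_range]
    rfl
  let E₂ := (Submodule.Quotient.restrictScalarsEquiv k (LinearMap.range (Algebra.linearMap R P))).symm
  let E := E₁.trans (E₂.trans ((Submodule.quotEquivOfEq _ _ h2).trans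
    (Ψ.quotKerEquivOfSurjective hsurj)))
  exact ⟨Module.Finite.equiv E.symm, by rw [E.finrank_eq, Module.finrank_fintype_fun_eq_card]⟩

/-- A prime containing a finite intersection of ideals contains one of them; `hle` says that there
are no inclusions between different members of the family. -/
theorem Ideal.minimalPrimes_eq_range_of_iInf {ι : Type*} [Finite ι] (p : ι → Ideal R)
    (hp : ∀ i, (p i).IsPrime) (hle : ∀ i j, p i ≤ p j → i = j) :
    (⨅ i, p i).minimalPrimes = Set.range p := by
  classical
  cases nonempty_fintype ι
  have key : ∀ q : Ideal R, q.IsPrime → ⨅ i, p i ≤ q → ∃ i, p i ≤ q := by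
    intro q hq h
    rw [← Finset.inf_univ_eq_iInf] at h
    obtain ⟨i, -, hi⟩ := (Ideal.IsPrime.inf_le' hq).1 h
    exact ⟨i, hi⟩
  ext q
  constructor
  · intro hq
    obtain ⟨i, hi⟩ := key q hq.1.1 hq.1.2
    exact ⟨i, le_antisymm hi (hq.2 ⟨hp i, iInf_le p i⟩ hi)⟩
  · rintro ⟨i, rfl⟩
    refine ⟨⟨hp i, iInf_le p i⟩, fun q hq hqi => ?_⟩
    obtain ⟨j, hj⟩ := key q hq.1 hq.2
    obtain rfl := hle j i (hj.trans hqi)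
    exact hj

end Normalization

/-! ### The elements of nonnegative degree as a basis of a product of polynomial rings -/

section FourierTransform

open scoped nonZeroDivisors

variable {X : Type*} [AddCommGroup X] {deg : X →+ ℤ} {τ : X} (hτ : deg τ = 1)

/-- The projection to the kernel of the degree along an element of degree one. -/
def torsionPart : X →+ deg.ker :=
  AddMonoidHom.mk' (fun x => ⟨x - deg x • τ, by
      rw [AddMonoidHom.mem_ker, map_sub, map_zsmul, hτ, smul_eq_mul, mul_one, sub_self]⟩)
    fun x y => Subtype.ext (by
      simp only [map_add, add_smul, AddSubgroup.coe_add]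
      abel)

theorem torsionPart_zsmul (n : ℤ) : torsionPart hτ (n • τ) = 0 := by
  apply Subtype.ext
  change n • τ - deg (n • τ) • τ = 0
  rw [map_zsmul, hτ, smul_eq_mul, mul_one, sub_self]

theorem torsionPart_coe (f : deg.ker) : torsionPart hτ (f : X) = f := by
  apply Subtype.ext
  change (f : X) - deg (f : X) • τ = f
  rw [AddMonoidHom.mem_ker.1 f.2, zero_smul, sub_zero]

theorem eq_of_torsionPart_eq {x y : X} (hd : deg x = deg y)
    (h : torsionPart hτ x = torsionPart hτ y) : x = y := by
  have h' : x - deg x • τ = y - deg y • τ := congrArg Subtype.val h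
  rw [hd] at h'
  exact sub_left_injective h'

/-- The element of the product of polynomial rings, over the characters of the kernel of the
degree, corresponding to a group element. -/
noncomputable def fourierMonomial (x : X) : AddChar deg.ker ℂ → Polynomial ℂ :=
  fun χ => Polynomial.monomial (deg x).toNat (χ (torsionPart hτ x))

theorem fourierMonomial_add {x y : X} (hx : 0 ≤ deg x) (hy : 0 ≤ deg y) :
    fourierMonomial hτ (x + y) = fourierMonomial hτ x * fourierMonomial hτ y := by
  ext1 χ
  rw [Pi.mul_apply, fourierMonomial, fourierMonomial, fourierMonomial,
    Polynomial.monomial_mul_monomial, map_add, map_add, AddChar.map_add_eq_mul,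
    Int.toNat_add hx hy]

theorem fourierMonomial_zero : fourierMonomial hτ (0 : X) = 1 := by
  ext1 χ
  rw [fourierMonomial, map_zero, map_zero, AddChar.map_zero_eq_one]
  rfl

theorem fourierMonomial_nsmul {x : X} (hx : 0 ≤ deg x) (n : ℕ) :
    fourierMonomial hτ (n • x) = fourierMonomial hτ x ^ n := by
  induction n with
  | zero => rw [zero_smul, fourierMonomial_zero, pow_zero]
  | succ n ih =>
    rw [succ_nsmul, fourierMonomial_add hτ (by rw [map_nsmul]; positivity) hx, ih, pow_succ]

variable [Finite deg.ker]

/-- The coefficient of `fourierMonomial x`. -/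
noncomputable def branchCoeff (x : X) : (AddChar deg.ker ℂ → Polynomial ℂ) →ₗ[ℂ] ℂ :=
  (Nat.card deg.ker : ℂ)⁻¹ • ∑ χ : AddChar deg.ker ℂ,
    χ (-torsionPart hτ x) • (Polynomial.lcoeff ℂ (deg x).toNat).comp (LinearMap.proj χ)

/-- In equal degrees this is orthogonality of characters on the finite group of degree-zero
elements; in different degrees the polynomial coefficients vanish. -/
theorem branchCoeff_fourierMonomial [DecidableEq X] {x y : X} (hx : 0 ≤ deg x) (hy : 0 ≤ deg y) :
    branchCoeff hτ x (fourierMonomial hτ y) = if x = y then 1 else 0 := by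
  classical
  cases nonempty_fintype deg.ker
  have h1 : branchCoeff hτ x (fourierMonomial hτ y) = (Nat.card deg.ker : ℂ)⁻¹ *
      ∑ χ : AddChar deg.ker ℂ, χ (-torsionPart hτ x) *
        (Polynomial.monomial (deg y).toNat (χ (torsionPart hτ y))).coeff (deg x).toNat := by
    simp [branchCoeff, fourierMonomial, LinearMap.sum_apply]
  rw [h1]
  simp only [Polynomial.coeff_monomial]
  by_cases hd : deg x = deg y
  · simp only [hd, if_true, ← AddChar.map_add_eq_mul]
    rw [AddChar.sum_apply_eq_ite, Nat.card_eq_fintype_card]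
    have hc : (Fintype.card deg.ker : ℂ) ≠ 0 := Nat.cast_ne_zero.2 Fintype.card_ne_zero
    by_cases hxy : x = y
    · subst hxy
      simp
    · have : -torsionPart hτ x + torsionPart hτ y ≠ 0 := by
        intro h
        exact hxy (eq_of_torsionPart_eq hτ hd (neg_add_eq_zero.1 h))
      simp [this, hxy]
  · have h2 : (deg y).toNat ≠ (deg x).toNat := by omega
    have h3 : x ≠ y := fun h => hd (by rw [h])
    simp [h2, h3]

/-- Fourier inversion: averaging over the degree-zero elements f with weights χ(-f) isolates the
component at χ. -/
theorem span_fourierMonomial :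
    Submodule.span ℂ (fourierMonomial hτ '' {x | 0 ≤ deg x}) = ⊤ := by
  classical
  cases nonempty_fintype deg.ker
  rw [eq_top_iff]
  rintro p -
  rw [← Finset.univ_sum_single p]
  refine Submodule.sum_mem _ fun χ _ => ?_
  induction p χ using Polynomial.induction_on' with
  | add p q hp hq =>
    rw [Pi.single_add]
    exact Submodule.add_mem _ hp hq
  | monomial n c =>
    have : (Pi.single χ (Polynomial.monomial n c) : AddChar deg.ker ℂ → Polynomial ℂ) =
        ∑ f : deg.ker, ((Fintype.card deg.ker : ℂ)⁻¹ * c * χ (-f)) •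
          fourierMonomial hτ ((f : X) + (n : ℤ) • τ) := by
      ext1 χ'
      have hdeg : ∀ f : deg.ker, deg ((f : X) + (n : ℤ) • τ) = n := fun f => by
        rw [map_add, AddMonoidHom.mem_ker.1 f.2, map_zsmul, hτ]
        simp
      simp only [Finset.sum_apply, Pi.smul_apply, fourierMonomial, hdeg, Int.toNat_natCast,
        map_add, torsionPart_coe, torsionPart_zsmul, add_zero, Polynomial.smul_monomial,
        smul_eq_mul, ← map_sum, mul_assoc, ← Finset.mul_sum]
      have hsum : ∑ f : deg.ker, χ (-f) * χ' f = if χ = χ' then (Fintype.card deg.ker : ℂ) else 0 := by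
        have h1 : ∀ f : deg.ker, χ (-f) * χ' f = (χ' - χ) f := fun f => by
          rw [AddChar.sub_apply', AddChar.map_neg_eq_inv, mul_comm, div_eq_mul_inv]
        simp only [h1]
        rw [AddChar.sum_eq_ite]
        simp only [sub_eq_zero, eq_comm]
      rw [hsum]
      have hc : (Fintype.card deg.ker : ℂ) ≠ 0 := Nat.cast_ne_zero.2 Fintype.card_ne_zero
      by_cases h : χ = χ'
      · subst h
        rw [Pi.single_eq_same, if_pos rfl]
        congr 1
        field_simp
      · rw [Pi.single_eq_of_ne (Ne.symm h), if_neg h]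
        simp
    rw [this]
    refine Submodule.sum_mem _ fun f _ => Submodule.smul_mem _ _ (Submodule.subset_span ⟨_, ?_, rfl⟩)
    rw [Set.mem_ofPred_eq, map_add, AddMonoidHom.mem_ker.1 f.2, map_zsmul, hτ]
    simp

end FourierTransform

/-! ### Delta invariant and branches of a semigroup ring -/

section SemigroupRing

open scoped nonZeroDivisors

variable {X Λ : Type*} [AddCommGroup X] {deg : X →+ ℤ} {τ : X} (hτ : deg τ = 1) (g : Λ → X)

/-- The parametrization of the branches of the curve attached to a semigroup. -/
noncomputable def branchHom : MvPolynomial Λ ℂ →ₐ[ℂ] (AddChar deg.ker ℂ → Polynomial ℂ) :=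
  MvPolynomial.aeval fun w => fourierMonomial hτ (g w)

variable {g}

theorem deg_linearCombination_nonneg (hg : ∀ w, 0 < deg (g w)) (a : Λ →₀ ℕ) :
    0 ≤ deg (Finsupp.linearCombination ℕ g a) := by
  rw [Finsupp.linearCombination_apply, Finsupp.sum, map_sum]
  refine Finset.sum_nonneg fun w _ => ?_
  rw [map_nsmul]
  exact nsmul_nonneg (hg w).le _

theorem branchHom_monomial (hg : ∀ w, 0 < deg (g w)) (a : Λ →₀ ℕ) (c : ℂ) :
    branchHom hτ g (MvPolynomial.monomial a c) =
      c • fourierMonomial hτ (Finsupp.linearCombination ℕ g a) := by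
  classical
  rw [branchHom, MvPolynomial.aeval_monomial, ← Algebra.smul_def]
  congr 1
  induction a using Finsupp.induction with
  | zero => simp [fourierMonomial_zero]
  | single_add w n f _ _ ih =>
    rw [Finsupp.prod_add_index' (by simp) (by simp [pow_add]), ih,
      Finsupp.prod_single_index (by simp), map_add, Finsupp.linearCombination_single,
      fourierMonomial_add hτ (by rw [map_nsmul]; exact nsmul_nonneg (hg w).le _)
        (deg_linearCombination_nonneg hg f), fourierMonomial_nsmul hτ (hg w).le]

theorem fourierMonomial_mem_range (hg : ∀ w, 0 < deg (g w)) [Fintype Λ] {x : X}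
    (hx : x ∈ leafSemigroup g Finset.univ) : ∃ f, branchHom hτ g f = fourierMonomial hτ x := by
  obtain ⟨a, -, rfl⟩ := (mem_leafSemigroup_iff g).1 hx
  exact ⟨MvPolynomial.monomial a 1, by rw [branchHom_monomial hτ hg, one_smul]⟩

theorem branchCoeff_branchHom [Finite deg.ker] (hg : ∀ w, 0 < deg (g w)) {x : X} (hx : 0 ≤ deg x) (f : MvPolynomial Λ ℂ) :
    branchCoeff hτ x (branchHom hτ g f) = (semigroupAlgHom ℂ g f).coeff x := by
  classical
  induction f using MvPolynomial.induction_on' with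
  | monomial a c =>
    rw [branchHom_monomial hτ hg, semigroupAlgHom_monomial, map_smul,
      branchCoeff_fourierMonomial hτ hx (deg_linearCombination_nonneg hg a),
      AddMonoidAlgebra.coeff_single, Finsupp.single_apply]
    simp [eq_comm]
  | add p q hp hq =>
    rw [map_add, map_add, hp, hq, map_add, AddMonoidAlgebra.coeff_add, Finsupp.add_apply]

theorem coeff_semigroupAlgHom_eq_zero {x : X} (hx : ∀ a : Λ →₀ ℕ,
    Finsupp.linearCombination ℕ g a ≠ x) (f : MvPolynomial Λ ℂ) :
    (semigroupAlgHom ℂ g f).coeff x = 0 := by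
  classical
  induction f using MvPolynomial.induction_on' with
  | monomial a c =>
    rw [semigroupAlgHom_monomial, AddMonoidAlgebra.coeff_single, Finsupp.single_apply,
      if_neg (hx a)]
  | add p q hp hq =>
    rw [map_add, AddMonoidAlgebra.coeff_add, Finsupp.add_apply, hp, hq, add_zero]

/-- The Fourier monomials of nonnegative degree have the dual functionals `branchCoeff`, so passing
from the group algebra to the product of polynomial rings loses nothing. -/
theorem ker_branchHom [Finite deg.ker] (hg : ∀ w, 0 < deg (g w)) :
    RingHom.ker (branchHom hτ g) = RingHom.ker (semigroupAlgHom ℂ g) := by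
  classical
  ext f
  rw [RingHom.mem_ker, RingHom.mem_ker]
  constructor
  · intro h
    ext x
    by_cases hx : 0 ≤ deg x
    · rw [← branchCoeff_branchHom hτ hg hx, h, map_zero]
      rfl
    · rw [coeff_semigroupAlgHom_eq_zero]
      · rfl
      · rintro a rfl
        exact hx (deg_linearCombination_nonneg hg a)
  · intro h
    let ψ : (X →₀ ℂ) →ₗ[ℂ] (AddChar deg.ker ℂ → Polynomial ℂ) :=
      Finsupp.linearCombination ℂ (fourierMonomial hτ)
    have key : ∀ f, branchHom hτ g f = ψ (semigroupAlgHom ℂ g f).coeff := by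
      intro f
      induction f using MvPolynomial.induction_on' with
      | monomial a c =>
        rw [branchHom_monomial hτ hg, semigroupAlgHom_monomial, AddMonoidAlgebra.coeff_single]
        exact (Finsupp.linearCombination_single _ _ _).symm
      | add p q hp hq =>
        rw [map_add, hp, hq, map_add (semigroupAlgHom ℂ g), AddMonoidAlgebra.coeff_add, map_add]
    rw [key, h]
    exact map_zero ψ

theorem exists_conductor [Fintype Λ]
    (hfin : (semigroupGaps deg ⊤ (leafSemigroup g Finset.univ)).Finite) :
    ∃ N : ℕ, ∀ x : X, (N : ℤ) ≤ deg x → x ∈ leafSemigroup g Finset.univ := by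
  obtain ⟨N, hN⟩ := (hfin.image fun x => deg x).bddAbove
  refine ⟨(N + 1).toNat, fun x hx => ?_⟩
  have h1 : N + 1 ≤ deg x := (Int.self_le_toNat _).trans hx
  have h2 : 0 ≤ deg x := le_trans (by positivity) hx
  by_contra h
  have := hN ⟨x, ⟨AddSubgroup.mem_top x, h2, h⟩, rfl⟩
  change deg x ≤ N at this
  omega

/-- Otherwise all positive multiples of x are gaps. There are only finitely many gaps, so two
multiples coincide and some positive multiple is 0, which is in the semigroup. This is what makes
the product of polynomial rings integral over the semigroup ring. -/
theorem exists_nsmul_mem [Fintype Λ]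
    (hfin : (semigroupGaps deg ⊤ (leafSemigroup g Finset.univ)).Finite) {x : X} (hx : 0 ≤ deg x) :
    ∃ n : ℕ, 0 < n ∧ n • x ∈ leafSemigroup g Finset.univ := by
  by_contra! h
  have hmem : ∀ n : ℕ, (n + 1) • x ∈ semigroupGaps deg ⊤ (leafSemigroup g Finset.univ) :=
    fun n => ⟨AddSubgroup.mem_top _, by rw [map_nsmul]; exact nsmul_nonneg hx _,
      h (n + 1) n.succ_pos⟩
  have hni : ¬ Function.Injective fun n : ℕ => (n + 1) • x := fun hinj =>
    (Set.infinite_range_of_injective hinj) (hfin.subset (Set.range_subset_iff.2 hmem))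
  rw [Function.not_injective_iff] at hni
  obtain ⟨a, b, hab, hne⟩ := hni
  wlog hlt : a < b generalizing a b
  · exact this b a hab.symm hne.symm (by omega)
  refine h (b - a) (by omega) ?_
  have h0 : (b - a) • x = 0 := by
    have h1 : (b + 1) • x = (b - a) • x + (a + 1) • x := by
      rw [← add_smul]
      congr 1
      omega
    change (a + 1) • x = (b + 1) • x at hab
    rw [h1] at hab
    exact left_eq_add.1 (hab.trans (add_comm _ _))
  rw [h0]
  exact AddSubmonoid.zero_mem _

/-- The finiteness and the value of the `δ`-invariant of a semigroup ring, given as a subring of a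
product of polynomial rings. -/
theorem finite_and_finrank_of_range_branchHom [Finite deg.ker]
    (hτ : deg τ = 1) (hg : ∀ w, 0 < deg (g w)) [Fintype Λ]
    (hfin : (semigroupGaps deg ⊤ (leafSemigroup g Finset.univ)).Finite)
    {R : Type*} [CommRing R] [Algebra ℂ R] [Algebra R (AddChar deg.ker ℂ → Polynomial ℂ)]
    [IsScalarTower ℂ R (AddChar deg.ker ℂ → Polynomial ℂ)]
    (hinj : Function.Injective (algebraMap R (AddChar deg.ker ℂ → Polynomial ℂ)))
    (hrange : ∀ p, (∃ r, algebraMap R (AddChar deg.ker ℂ → Polynomial ℂ) r = p) ↔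
      ∃ f, branchHom hτ g f = p) :
    Module.Finite ℂ (integralClosure R (FractionRing R) ⧸
      LinearMap.range (Algebra.linearMap R (integralClosure R (FractionRing R)))) ∧
    Module.finrank ℂ (integralClosure R (FractionRing R) ⧸
      LinearMap.range (Algebra.linearMap R (integralClosure R (FractionRing R)))) =
      (semigroupGaps deg ⊤ (leafSemigroup g Finset.univ)).ncard := by
  classical
  have : Algebra.IsIntegral R (AddChar deg.ker ℂ → Polynomial ℂ) := by
    constructor
    intro p
    have hp : p ∈ Submodule.span ℂ (fourierMonomial hτ '' {x | 0 ≤ deg x}) := by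
      rw [span_fourierMonomial]
      trivial
    induction hp using Submodule.span_induction with
    | mem p hp =>
      obtain ⟨x, hx, rfl⟩ := hp
      obtain ⟨n, hn, hS⟩ := exists_nsmul_mem hfin hx
      obtain ⟨r, hr⟩ := (hrange _).2 (fourierMonomial_mem_range hτ hg hS)
      refine IsIntegral.of_pow hn ?_
      rw [← fourierMonomial_nsmul hτ hx, ← hr]
      exact isIntegral_algebraMap
    | zero => exact isIntegral_zero
    | add p q _ _ hp hq => exact hp.add hq
    | smul c p _ hp =>
      have hcp : c • p = algebraMap R (AddChar deg.ker ℂ → Polynomial ℂ) (algebraMap ℂ R c) * p := by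
        rw [← IsScalarTower.algebraMap_apply, Algebra.smul_def]
      rw [hcp]
      exact isIntegral_algebraMap.mul hp
  have : IsIntegrallyClosed (AddChar deg.ker ℂ → Polynomial ℂ) :=
    Pi.isIntegrallyClosed fun _ => Polynomial ℂ
  obtain ⟨N, hN⟩ := exists_conductor hfin
  have hτN : deg ((N : ℤ) • τ) = N := by rw [map_zsmul, hτ]; simp
  -- The conductor element is t^N on every branch, with N beyond the degrees of all gaps.
  have hcN : fourierMonomial hτ ((N : ℤ) • τ) ∈ (AddChar deg.ker ℂ → Polynomial ℂ)⁰ := by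
    rw [mem_nonZeroDivisors_iff_right]
    intro p hp
    ext1 χ
    have := congrFun hp χ
    rw [Pi.mul_apply, fourierMonomial, torsionPart_zsmul, AddChar.map_zero_eq_one] at this
    refine (mul_eq_zero.1 this).resolve_right ?_
    exact fun h => one_ne_zero ((Polynomial.monomial_eq_zero_iff _ _).1 h)
  have hcond : ∀ p, ∃ r, algebraMap R (AddChar deg.ker ℂ → Polynomial ℂ) r =
      fourierMonomial hτ ((N : ℤ) • τ) * p := by
    intro p
    rw [hrange]
    have hp : p ∈ Submodule.span ℂ (fourierMonomial hτ '' {x | 0 ≤ deg x}) := by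
      rw [span_fourierMonomial]
      trivial
    induction hp using Submodule.span_induction with
    | mem p hp =>
      obtain ⟨x, hx, rfl⟩ := hp
      rw [← fourierMonomial_add hτ (by rw [hτN]; positivity) hx]
      refine fourierMonomial_mem_range hτ hg (hN _ ?_)
      rw [map_add, hτN]
      have : 0 ≤ deg x := hx
      linarith
    | zero => exact ⟨0, by simp⟩
    | add p q _ _ hp hq =>
      obtain ⟨a, ha⟩ := hp
      obtain ⟨b, hb⟩ := hq
      exact ⟨a + b, by rw [map_add, ha, hb, mul_add]⟩
    | smul c p _ hp =>
      obtain ⟨a, ha⟩ := hp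
      exact ⟨c • a, by rw [map_smul, ha, mul_smul_comm]⟩
  obtain ⟨e⟩ := nonempty_integralClosure_algEquiv hinj hcN hcond
  have : Fintype (semigroupGaps deg ⊤ (leafSemigroup g Finset.univ)) := hfin.fintype
  have hnot : ∀ (x : semigroupGaps deg ⊤ (leafSemigroup g Finset.univ)) (a : Λ →₀ ℕ),
      Finsupp.linearCombination ℕ g a ≠ x := by
    intro x a h
    exact x.2.2.2 ((mem_leafSemigroup_iff g).2 ⟨a, fun _ _ => Finset.mem_univ _, h⟩)
  let Ψ : (AddChar deg.ker ℂ → Polynomial ℂ) →ₗ[ℂ]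
      (semigroupGaps deg ⊤ (leafSemigroup g Finset.univ) → ℂ) :=
    LinearMap.pi fun x => branchCoeff hτ (x : X)
  have hΨ : ∀ y : semigroupGaps deg ⊤ (leafSemigroup g Finset.univ) → ℂ,
      Ψ (∑ x, y x • fourierMonomial hτ (x : X)) = y := by
    intro y
    ext x
    simp only [Ψ, LinearMap.pi_apply, map_sum, map_smul]
    rw [Finset.sum_eq_single x]
    · rw [branchCoeff_fourierMonomial hτ x.2.2.1 x.2.2.1, if_pos rfl, smul_eq_mul, mul_one]
    · intro z _ hz
      rw [branchCoeff_fourierMonomial hτ x.2.2.1 z.2.2.1,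
        if_neg fun h => hz (Subtype.ext h.symm), smul_zero]
    · simp
  have hΨ0 : ∀ f, Ψ (branchHom hτ g f) = 0 := by
    intro f
    ext x
    simp only [Ψ, LinearMap.pi_apply, Pi.zero_apply]
    rw [branchCoeff_branchHom hτ hg x.2.2.1, coeff_semigroupAlgHom_eq_zero (hnot x)]
  have hker : ∀ p, Ψ p = 0 ↔ ∃ r, algebraMap R (AddChar deg.ker ℂ → Polynomial ℂ) r = p := by
    intro p
    rw [hrange]
    constructor
    · intro hp
      -- Each Fourier monomial belongs either to the semigroup ring or to a gap, so every element is
      -- a sum of the two kinds; Ψ sees exactly the gap coefficients.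
      have hdec : ∃ f, ∃ y : semigroupGaps deg ⊤ (leafSemigroup g Finset.univ) → ℂ,
          p = branchHom hτ g f + ∑ x, y x • fourierMonomial hτ (x : X) := by
        clear hp
        have hp : p ∈ Submodule.span ℂ (fourierMonomial hτ '' {x | 0 ≤ deg x}) := by
          rw [span_fourierMonomial]
          trivial
        induction hp using Submodule.span_induction with
        | mem p hp =>
          obtain ⟨x, hx, rfl⟩ := hp
          by_cases hS : x ∈ leafSemigroup g Finset.univ
          · obtain ⟨f, hf⟩ := fourierMonomial_mem_range hτ hg hS
            exact ⟨f, 0, by simp [hf]⟩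
          · refine ⟨0, Pi.single ⟨x, AddSubgroup.mem_top x, hx, hS⟩ 1, ?_⟩
            rw [map_zero, zero_add, Finset.sum_eq_single ⟨x, AddSubgroup.mem_top x, hx, hS⟩]
            · simp
            · intro z _ hz
              rw [Pi.single_eq_of_ne hz, zero_smul]
            · simp
        | zero => exact ⟨0, 0, by simp⟩
        | add p q _ _ hp hq =>
          obtain ⟨a, y, rfl⟩ := hp
          obtain ⟨b, z, rfl⟩ := hq
          refine ⟨a + b, y + z, ?_⟩
          simp only [map_add, Pi.add_apply, add_smul, Finset.sum_add_distrib]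
          abel
        | smul c p _ hp =>
          obtain ⟨a, y, rfl⟩ := hp
          refine ⟨c • a, c • y, ?_⟩
          simp only [map_smul, Pi.smul_apply, smul_add, Finset.smul_sum, smul_assoc]
      obtain ⟨f, y, rfl⟩ := hdec
      rw [map_add, hΨ0, hΨ, zero_add] at hp
      exact ⟨f, by simp [hp]⟩
    · rintro ⟨f, rfl⟩
      exact hΨ0 f
  have := finite_and_finrank_normalization_quotient (k := ℂ) e Ψ (fun y => ⟨_, hΨ y⟩) hker
  refine ⟨this.1, this.2.trans ?_⟩
  rw [← Nat.card_eq_fintype_card, Nat.card_coe_set_eq]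

/-- The finiteness and the value of the `δ`-invariant of a semigroup ring. -/
theorem finite_and_finrank_semigroupRing [Finite deg.ker]
    (hτ : deg τ = 1) (hg : ∀ w, 0 < deg (g w)) [Fintype Λ]
    (hfin : (semigroupGaps deg ⊤ (leafSemigroup g Finset.univ)).Finite) {I : Ideal (MvPolynomial Λ ℂ)}
    (hI : I = RingHom.ker (semigroupAlgHom ℂ g)) :
    Module.Finite ℂ (integralClosure (MvPolynomial Λ ℂ ⧸ I) (FractionRing (MvPolynomial Λ ℂ ⧸ I)) ⧸
      LinearMap.range (Algebra.linearMap (MvPolynomial Λ ℂ ⧸ I)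
        (integralClosure (MvPolynomial Λ ℂ ⧸ I) (FractionRing (MvPolynomial Λ ℂ ⧸ I))))) ∧
    Module.finrank ℂ (integralClosure (MvPolynomial Λ ℂ ⧸ I)
      (FractionRing (MvPolynomial Λ ℂ ⧸ I)) ⧸
      LinearMap.range (Algebra.linearMap (MvPolynomial Λ ℂ ⧸ I)
        (integralClosure (MvPolynomial Λ ℂ ⧸ I) (FractionRing (MvPolynomial Λ ℂ ⧸ I))))) =
      (semigroupGaps deg ⊤ (leafSemigroup g Finset.univ)).ncard := by
  classical
  rw [← ker_branchHom hτ hg] at hI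
  subst hI
  let φ : (MvPolynomial Λ ℂ ⧸ RingHom.ker (branchHom hτ g)) →ₐ[ℂ]
    (AddChar deg.ker ℂ → Polynomial ℂ) := Ideal.kerLiftAlg (branchHom hτ g)
  let _ : Algebra (MvPolynomial Λ ℂ ⧸ RingHom.ker (branchHom hτ g))
    (AddChar deg.ker ℂ → Polynomial ℂ) := φ.toRingHom.toAlgebra
  have : IsScalarTower ℂ (MvPolynomial Λ ℂ ⧸ RingHom.ker (branchHom hτ g))
    (AddChar deg.ker ℂ → Polynomial ℂ) :=
    IsScalarTower.of_algebraMap_eq fun c => (φ.commutes c).symm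
  refine finite_and_finrank_of_range_branchHom hτ hg hfin
    (Ideal.kerLiftAlg_injective (branchHom hτ g)) fun p => ⟨?_, ?_⟩
  · rintro ⟨r, rfl⟩
    obtain ⟨f, rfl⟩ := Ideal.Quotient.mk_surjective r
    exact ⟨f, rfl⟩
  · rintro ⟨f, rfl⟩
    exact ⟨Ideal.Quotient.mk _ f, rfl⟩

/-- The number of branches of the curve attached to a semigroup. -/
theorem ncard_minimalPrimes_semigroupRing [Finite deg.ker]
    (hτ : deg τ = 1) (hg : ∀ w, 0 < deg (g w)) [Fintype Λ]
    (hfin : (semigroupGaps deg ⊤ (leafSemigroup g Finset.univ)).Finite) :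
    (RingHom.ker (semigroupAlgHom ℂ g)).minimalPrimes.ncard = Nat.card deg.ker := by
  classical
  cases nonempty_fintype deg.ker
  let p : AddChar deg.ker ℂ → Ideal (MvPolynomial Λ ℂ) := fun χ =>
    RingHom.ker ((Pi.evalRingHom (fun _ : AddChar deg.ker ℂ => Polynomial ℂ) χ).comp
      (branchHom hτ g).toRingHom)
  have hpmem : ∀ χ f, f ∈ p χ ↔ branchHom hτ g f χ = 0 := fun χ f => Iff.rfl
  have hker : RingHom.ker (semigroupAlgHom ℂ g) = ⨅ χ, p χ := by
    rw [← ker_branchHom hτ hg]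
    ext f
    rw [RingHom.mem_ker, Ideal.mem_iInf]
    exact funext_iff
  obtain ⟨N, hN⟩ := exists_conductor hfin
  have hle : ∀ χ χ', p χ ≤ p χ' → χ = χ' := by
    intro χ χ' h
    ext f
    have hd : ∀ f : deg.ker, deg ((f : X) + (N : ℤ) • τ) = N := fun f => by
      rw [map_add, AddMonoidHom.mem_ker.1 f.2, map_zsmul, hτ]
      simp
    have hb : ∀ f : deg.ker, ∃ b, branchHom hτ g b = fourierMonomial hτ ((f : X) + (N : ℤ) • τ) :=
      fun f => fourierMonomial_mem_range hτ hg (hN _ (hd f).ge)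
    obtain ⟨a, ha⟩ := hb f
    obtain ⟨b, hb⟩ := hb 0
    -- The elements f + Nτ and Nτ both lie in the semigroup. On the branch of ψ their functions are
    -- ψ(f) t^N and t^N, so the values of ψ are read off from its ideal.
    have hmem : ∀ ψ : AddChar deg.ker ℂ, a - χ f • b ∈ p ψ ↔ χ f = ψ f := by
      intro ψ
      rw [hpmem, map_sub, map_smul, ha, hb, Pi.sub_apply, Pi.smul_apply, fourierMonomial,
        fourierMonomial, hd, hd, map_add (torsionPart hτ), map_add (torsionPart hτ), torsionPart_coe, torsionPart_coe,
        torsionPart_zsmul, add_zero, add_zero, AddChar.map_zero_eq_one,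
        Polynomial.smul_monomial, smul_eq_mul, mul_one, ← map_sub,
        Polynomial.monomial_eq_zero_iff, sub_eq_zero, eq_comm]
    exact (hmem χ').1 (h ((hmem χ).2 rfl))
  rw [hker, Ideal.minimalPrimes_eq_range_of_iInf p (fun χ => RingHom.ker_isPrime _) hle,
    ← Set.image_univ, Set.ncard_image_of_injective _ fun χ χ' h => hle χ χ' h.le,
    Set.ncard_univ, Nat.card_eq_fintype_card, AddChar.card_eq, Nat.card_eq_fintype_card]

end SemigroupRing

/-! ### Branches and paths in the tree -/

namespace RootedResolutionDiagram

section Branches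

variable {V : Type*} [Fintype V] [DecidableEq V] (Γ : RootedResolutionDiagram V)

theorem self_mem_branch {v u : V} (h : u ≠ v) : u ∈ Γ.branch v u :=
  ⟨SimpleGraph.Walk.nil, by simpa using h.symm⟩

theorem notMem_branch_self (v u : V) : v ∉ Γ.branch v u := fun ⟨p, hp⟩ => hp p.end_mem_support

variable {Γ}

theorem branch_closed {v u x y : V} (hx : x ∈ Γ.branch v u) (hxy : Γ.graph.Adj x y) (hy : y ≠ v) :
    y ∈ Γ.branch v u := by
  obtain ⟨p, hp⟩ := hx
  refine ⟨p.concat hxy, ?_⟩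
  rw [SimpleGraph.Walk.support_concat, List.mem_append]
  simp [hp, hy.symm]

theorem branch_trans {v u x y : V} (hx : x ∈ Γ.branch v u) (hy : y ∈ Γ.branch v x) :
    y ∈ Γ.branch v u := by
  obtain ⟨p, hp⟩ := hx
  obtain ⟨q, hq⟩ := hy
  refine ⟨p.append q, ?_⟩
  rw [SimpleGraph.Walk.mem_support_append_iff]
  tauto

theorem branch_symm {v u x : V} (hx : x ∈ Γ.branch v u) : u ∈ Γ.branch v x := by
  obtain ⟨p, hp⟩ := hx
  exact ⟨p.reverse, by simpa using hp⟩

theorem exists_isPath_of_mem_branch {v u x : V} (hx : x ∈ Γ.branch v u) :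
    ∃ p : Γ.graph.Walk u x, p.IsPath ∧ v ∉ p.support := by
  obtain ⟨p, hp⟩ := hx
  exact ⟨p.bypass, p.bypass_isPath, fun h => hp (p.support_bypass_subset_support h)⟩

theorem isPath_unique {u x : V} {p q : Γ.graph.Walk u x} (hp : p.IsPath) (hq : q.IsPath) : p = q :=
  congrArg Subtype.val ((Γ.isTree.isAcyclic.subsingleton_path u x).elim ⟨p, hp⟩ ⟨q, hq⟩)

/-- A second neighbour of v in the same component would give two paths from v to it, one direct and
one through u. -/
theorem eq_of_adj_of_mem_branch {v u x : V} (huv : Γ.graph.Adj v u) (hxv : Γ.graph.Adj v x)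
    (hx : x ∈ Γ.branch v u) : x = u := by
  obtain ⟨p, hp, hv⟩ := exists_isPath_of_mem_branch hx
  have h1 : (SimpleGraph.Walk.cons huv p).IsPath := hp.cons hv
  have h2 : (SimpleGraph.Walk.cons hxv SimpleGraph.Walk.nil).IsPath :=
    SimpleGraph.Walk.IsPath.nil.cons (by simpa using hxv.ne)
  have := congrArg SimpleGraph.Walk.length (isPath_unique h1 h2)
  simp only [SimpleGraph.Walk.length_cons, SimpleGraph.Walk.length_nil, zero_add,
    Nat.add_eq_right] at this
  exact (SimpleGraph.Walk.eq_of_length_eq_zero this).symm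

theorem exists_adj_mem_branch {v x : V} (hx : x ≠ v) :
    ∃ u, Γ.graph.Adj v u ∧ x ∈ Γ.branch v u := by
  obtain ⟨p, hp, -⟩ := Γ.isTree.existsUnique_path v x
  cases p with
  | nil => exact absurd rfl hx
  | cons h q =>
    rw [SimpleGraph.Walk.cons_isPath_iff] at hp
    exact ⟨_, h, q, hp.2⟩

theorem disjoint_branch {v u u' : V} (hu : Γ.graph.Adj v u) (hu' : Γ.graph.Adj v u') (h : u ≠ u') :
    Disjoint (Γ.branch v u) (Γ.branch v u') := by
  rw [Set.disjoint_left]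
  intro x hx hx'
  exact h (eq_of_adj_of_mem_branch hu hu' (branch_trans hx (branch_symm hx'))).symm

theorem disjoint_branch_swap {v u : V} (hu : Γ.graph.Adj v u) :
    Disjoint (Γ.branch v u) (Γ.branch u v) := by
  rw [Set.disjoint_left]
  intro x hx hx'
  obtain ⟨p, hp, hv⟩ := exists_isPath_of_mem_branch hx
  obtain ⟨q, hq, hq'⟩ := exists_isPath_of_mem_branch hx'
  rw [isPath_unique hq (hp.cons hv : (SimpleGraph.Walk.cons hu p).IsPath)] at hq'
  simp at hq'

theorem branch_subset {v u u' : V} (hu : Γ.graph.Adj v u) (hu' : Γ.graph.Adj u u') (h : u' ≠ v) :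
    Γ.branch u u' ⊆ Γ.branch v u := by
  rintro x ⟨p, hp⟩
  by_cases hv : v ∈ p.support
  · refine absurd (eq_of_adj_of_mem_branch hu' hu.symm ⟨p.takeUntil v hv, fun h' => ?_⟩) h.symm
    exact hp (p.support_takeUntil_subset_support hv h')
  · refine ⟨SimpleGraph.Walk.cons hu' p, ?_⟩
    simp [hv, hu.ne]

theorem exists_branch_of_mem_branch {v u x : V} (hu : Γ.graph.Adj v u) (hx : x ∈ Γ.branch v u)
    (hxu : x ≠ u) : ∃ u', Γ.graph.Adj u u' ∧ u' ≠ v ∧ x ∈ Γ.branch u u' := by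
  obtain ⟨u', h1, h2⟩ := exists_adj_mem_branch hxu
  refine ⟨u', h1, ?_, h2⟩
  rintro rfl
  exact Set.disjoint_left.1 (disjoint_branch_swap hu) hx h2

theorem eq_of_adj_branch_compl {v u x y : V} (hu : Γ.graph.Adj v u) (hx : x ∈ Γ.branch v u)
    (hy : y ∉ Γ.branch v u) (hxy : Γ.graph.Adj x y) : x = u ∧ y = v := by
  have h : y = v := by
    by_contra h
    exact hy (branch_closed hx hxy h)
  subst h
  exact ⟨eq_of_adj_of_mem_branch hu hxy.symm hx, rfl⟩

theorem mem_branch_iff {v u x : V} (hu : Γ.graph.Adj v u) :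
    x ∈ Γ.branch v u ↔ x = u ∨ ∃ u', Γ.graph.Adj u u' ∧ u' ≠ v ∧ x ∈ Γ.branch u u' := by
  constructor
  · intro hx
    by_cases h : x = u
    · exact Or.inl h
    · exact Or.inr (exists_branch_of_mem_branch hu hx h)
  · rintro (rfl | ⟨u', h1, h2, h3⟩)
    · exact Γ.self_mem_branch hu.ne'
    · exact branch_subset hu h1 h2 h3

/-! ### Paths -/

theorem onPath_self_iff {v x : V} : Γ.OnPath v v x ↔ x = v := by
  constructor
  · rintro ⟨p, hp, hx⟩
    rw [isPath_unique hp SimpleGraph.Walk.IsPath.nil] at hx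
    simpa using hx
  · rintro rfl
    exact ⟨SimpleGraph.Walk.nil, SimpleGraph.Walk.IsPath.nil, by simp⟩

theorem onPath_right (v w : V) : Γ.OnPath v w w := by
  obtain ⟨p, hp, -⟩ := Γ.isTree.existsUnique_path v w
  exact ⟨p, hp, p.end_mem_support⟩

theorem notMem_branch_of_onPath {v p u x : V} (hv : v ∉ Γ.branch p u) (hx : Γ.OnPath v p x) :
    x ∉ Γ.branch p u := by
  obtain ⟨q, hq, hxq⟩ := hx
  intro hxb
  have hxp : x ≠ p := by
    rintro rfl
    exact Γ.notMem_branch_self _ _ hxb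
  refine hv (branch_trans hxb (branch_symm ⟨q.takeUntil x hxq, ?_⟩))
  exact SimpleGraph.Walk.endpoint_notMem_support_takeUntil hq hxq hxp.symm

theorem onPath_adj_iff {v p u x : V} (hu : Γ.graph.Adj p u) (hv : v ∉ Γ.branch p u) :
    Γ.OnPath v u x ↔ Γ.OnPath v p x ∨ x = u := by
  obtain ⟨q, hq, -⟩ := Γ.isTree.existsUnique_path v p
  have huq : u ∉ q.support := fun h =>
    notMem_branch_of_onPath hv ⟨q, hq, h⟩ (Γ.self_mem_branch hu.ne')
  have hq' : (q.concat hu).IsPath := hq.concat huq hu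
  constructor
  · rintro ⟨r, hr, hx⟩
    rw [isPath_unique hr hq', SimpleGraph.Walk.support_concat,
      List.mem_append, List.mem_singleton] at hx
    exact hx.imp_left fun h => ⟨q, hq, h⟩
  · intro h
    refine ⟨_, hq', ?_⟩
    rw [SimpleGraph.Walk.support_concat, List.mem_append,
      List.mem_singleton]
    refine h.imp_left ?_
    rintro ⟨r, hr, hx⟩
    rwa [isPath_unique hq hr]

open Classical in
-- When the path from v is prolonged from p to u, the weight at p towards u drops out of the product
-- and the weights at u on the edges other than up enter.
theorem linking_mul_spliceWeight {v p u : V} (hu : Γ.graph.Adj p u) (hv : v ∉ Γ.branch p u) :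
    Γ.linking v u * Γ.spliceWeight p u =
      Γ.linking v p * ∏ y with Γ.graph.Adj u y ∧ y ≠ p, Γ.spliceWeight u y := by
  have huP : ¬ Γ.OnPath v p u := fun h =>
    notMem_branch_of_onPath hv h (Γ.self_mem_branch hu.ne')
  have hset : (Finset.univ.filter fun x => Γ.OnPath v u x) =
      insert u (Finset.univ.filter fun x => Γ.OnPath v p x) := by
    ext x
    simp only [Finset.mem_filter, Finset.mem_univ, true_and, Finset.mem_insert,
      onPath_adj_iff hu hv]
    tauto
  have hpmem : p ∈ Finset.univ.filter fun x => Γ.OnPath v p x := by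
    simpa using onPath_right v p
  rw [linking, hset, Finset.prod_insert (by simpa using huP), linking,
    ← Finset.mul_prod_erase _ _ hpmem, ← Finset.mul_prod_erase _ _ hpmem]
  have h1 : (Finset.univ.filter fun y => Γ.graph.Adj u y ∧ ¬ Γ.OnPath v u y) =
      Finset.univ.filter fun y => Γ.graph.Adj u y ∧ y ≠ p := by
    refine Finset.filter_congr fun y _ => and_congr_right fun hy => not_congr ?_
    rw [onPath_adj_iff hu hv]
    constructor
    · rintro (h | rfl)
      · exact (eq_of_adj_branch_compl hu (Γ.self_mem_branch hu.ne')
          (notMem_branch_of_onPath hv h) hy).2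
      · exact absurd rfl hy.ne
    · rintro rfl
      exact Or.inl (onPath_right v y)
  have h2 : (Finset.univ.filter fun y => Γ.graph.Adj p y ∧ ¬ Γ.OnPath v p y) =
      insert u (Finset.univ.filter fun y => Γ.graph.Adj p y ∧ ¬ Γ.OnPath v u y) := by
    ext y
    simp only [Finset.mem_filter, Finset.mem_univ, true_and, Finset.mem_insert,
      onPath_adj_iff hu hv]
    constructor
    · tauto
    · rintro (rfl | h)
      · exact ⟨hu, huP⟩
      · tauto
  -- At earlier vertices of the path nothing changes, since only p among them is adjacent to u.
  have h3 : ∀ x ∈ (Finset.univ.filter fun x => Γ.OnPath v p x).erase p,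
      (∏ y with Γ.graph.Adj x y ∧ ¬ Γ.OnPath v u y, Γ.spliceWeight x y) =
      ∏ y with Γ.graph.Adj x y ∧ ¬ Γ.OnPath v p y, Γ.spliceWeight x y := by
    intro x hx
    rw [Finset.mem_erase, Finset.mem_filter] at hx
    refine Finset.prod_congr (Finset.filter_congr fun y _ => and_congr_right fun hy =>
      not_congr ?_) fun _ _ => rfl
    rw [onPath_adj_iff hu hv]
    refine ⟨fun h => h.resolve_right ?_, Or.inl⟩
    rintro rfl
    exact hx.1 (eq_of_adj_branch_compl hu (Γ.self_mem_branch hu.ne')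
      (notMem_branch_of_onPath hv hx.2.2) hy.symm).2
  rw [Finset.prod_congr rfl h3, h1, h2, Finset.prod_insert]
  · ring
  · simp only [Finset.mem_filter, Finset.mem_univ, true_and, not_and, not_not]
    exact fun _ => onPath_right v u

open Classical in
theorem linking_self (v : V) : Γ.linking v v = ∏ y with Γ.graph.Adj v y, Γ.spliceWeight v y := by
  have h : (Finset.univ.filter fun x => Γ.OnPath v v x) = {v} := by
    ext x
    simp [onPath_self_iff]
  rw [linking, h, Finset.prod_singleton]
  refine Finset.prod_congr (Finset.filter_congr fun y _ => ?_) fun _ _ => rfl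
  rw [onPath_self_iff]
  exact ⟨fun h => h.1, fun h => ⟨h, h.ne'⟩⟩

end Branches

end RootedResolutionDiagram

/-! ### Principal minors of a definite matrix -/

section MinorMatrix

/-- The form vanishes on such an η, which definiteness forbids unless η = 0. In effect every
principal block is nondegenerate; this is used to show that two vectors solving the same equations
on T are proportional. -/
theorem eq_zero_of_vecMul_eq_zero {V : Type*} [Fintype V] (B : Matrix V V ℤ)
    (hB : (B.map (Int.cast : ℤ → ℝ)).PosDef) {T : Set V} {η : V → ℤ} (h : ∀ x, x ∉ T → η x = 0)
    (h' : ∀ x ∈ T, (η ᵥ* B) x = 0) : η = 0 := by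
  by_contra hne
  have hne' : (fun v => (η v : ℝ)) ≠ 0 := by
    intro h0
    apply hne
    ext v
    exact Int.cast_eq_zero.1 (congrFun h0 v)
  have hpos := hB.dotProduct_mulVec_pos hne'
  have hz : (η ᵥ* B) ⬝ᵥ η = 0 := by
    refine Finset.sum_eq_zero fun x _ => ?_
    by_cases hx : x ∈ T
    · rw [h' x hx, zero_mul]
    · rw [h x hx, mul_zero]
  rw [← Matrix.dotProduct_mulVec] at hz
  refine hpos.ne' ?_
  have := congrArg (Int.cast : ℤ → ℝ) hz
  simpa [dotProduct, Matrix.mulVec] using this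

variable {V : Type*} [DecidableEq V]

open Classical in
/-- The matrix `B` on `T × T`, extended by the identity. -/
noncomputable def minorMatrix (B : Matrix V V ℤ) (T : Set V) : Matrix V V ℤ :=
  Matrix.of fun i j => if i ∈ T ∧ j ∈ T then B i j else if i = j then 1 else 0

theorem minorMatrix_empty (B : Matrix V V ℤ) : minorMatrix B ∅ = 1 := by
  ext i j
  simp [minorMatrix, Matrix.one_apply]

theorem minorMatrix_univ (B : Matrix V V ℤ) : minorMatrix B Set.univ = B := by
  ext i j
  simp [minorMatrix]

variable [Fintype V]

/-- Padding with the identity puts blocks on different vertex sets into matrices of the same size.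
For two sets without entries between them the product has both blocks, and so determinants multiply.
-/
theorem minorMatrix_union (B : Matrix V V ℤ) {T T' : Set V} (hd : Disjoint T T')
    (h : ∀ i ∈ T, ∀ j ∈ T', B i j = 0) (h' : ∀ i ∈ T', ∀ j ∈ T, B i j = 0) :
    minorMatrix B (T ∪ T') = minorMatrix B T * minorMatrix B T' := by
  classical
  have hTT : ∀ x, x ∈ T → x ∉ T' := fun x hx => Set.disjoint_left.1 hd hx
  ext i j
  rw [Matrix.mul_apply]
  by_cases hi : i ∈ T
  · by_cases hj : j ∈ T'
    · have hj' : j ∉ T := fun h => hTT j h hj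
      rw [Finset.sum_eq_zero]
      · simp [minorMatrix, hi, hj, h i hi j hj]
      · intro k _
        by_cases hk : k ∈ T
        · have : k ≠ j := fun e => hj' (e ▸ hk)
          simp [minorMatrix, hTT k hk, this]
        · have : i ≠ k := fun e => hk (e ▸ hi)
          simp [minorMatrix, hk, this]
    · rw [Finset.sum_eq_single j]
      · by_cases hj' : j ∈ T
        · simp [minorMatrix, hi, hj', hj]
        · simp [minorMatrix, hj', hj]
      · intro k _ hk
        simp [minorMatrix, hj, hk]
      · simp
  · rw [Finset.sum_eq_single i]
    · by_cases hi' : i ∈ T'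
      · by_cases hj : j ∈ T
        · have : i ≠ j := fun e => hi (e ▸ hj)
          simp [minorMatrix, hi, hi', hj, hTT j hj, h' i hi' j hj, this]
        · simp [minorMatrix, hi, hi', hj]
      · simp [minorMatrix, hi, hi']
    · intro k _ hk
      simp [minorMatrix, hi, hk.symm]
    · simp

open Classical in
theorem det_minorMatrix (B : Matrix V V ℤ) (T : Set V) :
    (minorMatrix B T).det =
      (B.submatrix (Subtype.val : {x : V // x ∈ T} → V) Subtype.val).det := by
  rw [Matrix.twoBlockTriangular_det (minorMatrix B T) (· ∈ T)]
  · have h1 : Matrix.toSquareBlockProp (minorMatrix B T) (· ∈ T) =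
        B.submatrix (Subtype.val : {x : V // x ∈ T} → V) Subtype.val := by
      ext i j
      simp [Matrix.toSquareBlockProp_def, minorMatrix]
    have h2 : Matrix.toSquareBlockProp (minorMatrix B T) (fun i => ¬ i ∈ T) = 1 := by
      ext i j
      simp [Matrix.toSquareBlockProp_def, minorMatrix, i.2, Matrix.one_apply, Subtype.ext_iff]
    rw [h1, h2, Matrix.det_one, mul_one]
  · intro i hi j hj
    have : i ≠ j := fun e => hi (e ▸ hj)
    simp [minorMatrix, hi, this]

theorem det_minorMatrix_pos (B : Matrix V V ℤ)
    (hB : (B.map (Int.cast : ℤ → ℝ)).PosDef) (T : Set V) : 0 < (minorMatrix B T).det := by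
  classical
  rw [det_minorMatrix]
  have h := (hB.submatrix (e := (Subtype.val : {x : V // x ∈ T} → V)) Subtype.val_injective).det_pos
  have h2 : (B.map (Int.cast : ℤ → ℝ)).submatrix (Subtype.val : {x : V // x ∈ T} → V) Subtype.val =
      (Int.castRingHom ℝ).mapMatrix
        (B.submatrix (Subtype.val : {x : V // x ∈ T} → V) Subtype.val) := by
    ext i j
    rfl
  rw [h2, ← RingHom.map_det, eq_intCast] at h
  exact_mod_cast h

/-- Subtracting multiples of the unit row u from the other rows clears column u. -/
theorem det_updateRow_minorMatrix (B : Matrix V V ℤ) {T : Set V} {u : V} (hu : u ∈ T) :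
    ((minorMatrix B T).updateRow u (Pi.single u 1)).det = (minorMatrix B (T \ {u})).det := by
  classical
  refine Matrix.det_eq_of_forall_row_eq_smul_add_const
    (fun i => if i = u then 0 else minorMatrix B T i u) u (by simp) ?_
  intro i j
  by_cases hi : i = u
  · subst hi
    simp [minorMatrix, Pi.single_apply, eq_comm]
  · rw [Matrix.updateRow_ne hi]
    by_cases hj : j = u
    · subst hj
      simp [minorMatrix, hi]
    · simp [minorMatrix, hi, hj, Ne.symm hj]

end MinorMatrix

/-! ### Linking numbers as entries of the adjugate of -A -/

namespace RootedResolutionDiagram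

section Linking

variable {V : Type*} [Fintype V] [DecidableEq V] (Γ : RootedResolutionDiagram V)

theorem intersectionMatrix_apply_ne {v w : V} (h : v ≠ w) (h' : ¬ Γ.graph.Adj v w) :
    Γ.intersectionMatrix v w = 0 := by
  simp [intersectionMatrix, weightedGraphMatrix, h, h']

theorem intersectionMatrix_apply_adj {v w : V} (h : Γ.graph.Adj v w) :
    Γ.intersectionMatrix v w = 1 := by
  simp [intersectionMatrix, weightedGraphMatrix, h.ne, h]

theorem intersectionMatrix_symm (v w : V) :
    Γ.intersectionMatrix v w = Γ.intersectionMatrix w v := by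
  by_cases h : v = w
  · rw [h]
  · by_cases h' : Γ.graph.Adj v w
    · rw [Γ.intersectionMatrix_apply_adj h', Γ.intersectionMatrix_apply_adj h'.symm]
    · rw [Γ.intersectionMatrix_apply_ne h h',
        Γ.intersectionMatrix_apply_ne (Ne.symm h) fun e => h' e.symm]

theorem neg_intersectionMatrix_posDef :
    ((-Γ.intersectionMatrix).map (Int.cast : ℤ → ℝ)).PosDef := by
  have h : (-Γ.intersectionMatrix).map (Int.cast : ℤ → ℝ) =
      -((weightedGraphMatrix Γ.graph Γ.weight).map (Int.cast : ℤ → ℝ)) := by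
    ext i j
    simp [intersectionMatrix]
  rw [h]
  exact Γ.negDef

/-- The determinant of `-A` restricted to a set of vertices. -/
noncomputable def minorDet (T : Set V) : ℤ := (minorMatrix (-Γ.intersectionMatrix) T).det

theorem minorDet_pos (T : Set V) : 0 < Γ.minorDet T :=
  det_minorMatrix_pos _ Γ.neg_intersectionMatrix_posDef T

theorem spliceWeight_eq_minorDet (v u : V) : Γ.spliceWeight v u = Γ.minorDet (Γ.branch v u) := by
  classical
  rw [minorDet, det_minorMatrix, spliceWeight]

variable {Γ}

theorem minorDet_iUnion_branch {u : V} (s : Finset V) (hs : ∀ y ∈ s, Γ.graph.Adj u y) :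
    Γ.minorDet (⋃ y ∈ s, Γ.branch u y) = ∏ y ∈ s, Γ.spliceWeight u y := by
  induction s using Finset.induction_on with
  | empty => simp [minorDet, minorMatrix_empty]
  | insert a s ha ih =>
    have hd : ∀ y ∈ s, Disjoint (Γ.branch u a) (Γ.branch u y) := fun y hy =>
      disjoint_branch (hs a (Finset.mem_insert_self a s)) (hs y (Finset.mem_insert_of_mem hy))
        fun e => ha (e ▸ hy)
    have hd' : Disjoint (Γ.branch u a) (⋃ y ∈ s, Γ.branch u y) := by
      simpa only [Set.disjoint_iUnion_right] using hd
    have hno : ∀ i ∈ Γ.branch u a, ∀ j ∈ ⋃ y ∈ s, Γ.branch u y, (-Γ.intersectionMatrix) i j = 0 := by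
      intro i hi j hj
      have hj' : j ∉ Γ.branch u a := fun h => Set.disjoint_left.1 hd' h hj
      rw [Matrix.neg_apply, Γ.intersectionMatrix_apply_ne, neg_zero]
      · rintro rfl
        exact hj' hi
      · intro hadj
        obtain ⟨-, rfl⟩ := eq_of_adj_branch_compl (hs a (Finset.mem_insert_self a s)) hi hj' hadj
        obtain ⟨y, -, h⟩ := Set.mem_iUnion₂.1 hj
        exact Γ.notMem_branch_self _ _ h
    rw [Finset.set_biUnion_insert, minorDet, minorMatrix_union _ hd' hno, Matrix.det_mul,
      Finset.prod_insert ha, spliceWeight_eq_minorDet,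
      ← ih fun y hy => hs y (Finset.mem_insert_of_mem hy)]
    · rfl
    · intro i hi j hj
      rw [Matrix.neg_apply, intersectionMatrix_symm, ← Matrix.neg_apply]
      exact hno j hj i hi

open Classical in
theorem minorDet_compl_singleton (v : V) :
    Γ.minorDet (Set.univ \ {v}) = ∏ y with Γ.graph.Adj v y, Γ.spliceWeight v y := by
  rw [← minorDet_iUnion_branch]
  · congr 1
    ext x
    simp only [Set.mem_sdiff, Set.mem_univ, true_and, Set.mem_singleton_iff, Set.mem_iUnion,
      Finset.mem_filter, Finset.mem_univ, exists_prop]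
    constructor
    · exact exists_adj_mem_branch
    · rintro ⟨y, hy, hx⟩ rfl
      exact Γ.notMem_branch_self _ _ hx
  · simp

open Classical in
theorem minorDet_branch_diff {p u : V} (hu : Γ.graph.Adj p u) :
    Γ.minorDet (Γ.branch p u \ {u}) =
      ∏ y with Γ.graph.Adj u y ∧ y ≠ p, Γ.spliceWeight u y := by
  rw [← minorDet_iUnion_branch]
  · congr 1
    ext x
    simp only [Set.mem_sdiff, Set.mem_singleton_iff, Set.mem_iUnion,
      Finset.mem_filter, Finset.mem_univ, true_and, exists_prop, mem_branch_iff hu]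
    constructor
    · rintro ⟨h1 | ⟨y, h1, h2, h3⟩, h⟩
      · exact absurd h1 h
      · exact ⟨y, ⟨h1, h2⟩, h3⟩
    · rintro ⟨y, ⟨h1, h2⟩, h3⟩
      refine ⟨Or.inr ⟨y, h1, h2, h3⟩, ?_⟩
      rintro rfl
      exact Γ.notMem_branch_self _ _ h3
  · intro y hy
    simp only [Finset.mem_filter, Finset.mem_univ, true_and] at hy
    exact hy.1

theorem adjugate_vecMul (v : V) :
    (fun w => (-Γ.intersectionMatrix).adjugate v w) ᵥ* (-Γ.intersectionMatrix) =
      Pi.single v (-Γ.intersectionMatrix).det := by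
  ext x
  have := congrFun (congrFun (Matrix.adjugate_mul (-Γ.intersectionMatrix)) v) x
  rw [Matrix.mul_apply, Matrix.smul_apply, Matrix.one_apply] at this
  rw [Matrix.vecMul, dotProduct, this, Pi.single_apply]
  simp [eq_comm]

/-- Restrict row v of the adjugate to T, the branch beyond u. Since v lies outside T and the only
edge leaving T is up, its product with the block of -A on T is supported at u, with value the entry
at p. Row u of the adjugate of that block solves the same equation up to scale; comparing the
entries at u gives the identity. -/
theorem adjugate_mul_minorDet {v p u : V} (hu : Γ.graph.Adj p u) (hv : v ∉ Γ.branch p u) :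
    (-Γ.intersectionMatrix).adjugate v u * Γ.minorDet (Γ.branch p u) =
      (-Γ.intersectionMatrix).adjugate v p * Γ.minorDet (Γ.branch p u \ {u}) := by
  classical
  set B := -Γ.intersectionMatrix with hB
  set T := Γ.branch p u with hT
  set D := Γ.minorDet T with hD
  set k : V → ℤ := fun w => (minorMatrix B T).adjugate u w with hk
  have huT : u ∈ T := Γ.self_mem_branch hu.ne'
  have hku : k u = Γ.minorDet (T \ {u}) := by
    rw [hk]
    simp only
    rw [Matrix.adjugate_apply, det_updateRow_minorMatrix B huT]
    rfl
  have hkB : ∀ x ∈ T, ∑ w, (if w ∈ T then k w else 0) * B w x = if x = u then D else 0 := by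
    intro x hx
    have := congrFun (congrFun (Matrix.adjugate_mul (minorMatrix B T)) u) x
    rw [Matrix.mul_apply, Matrix.smul_apply, Matrix.one_apply, smul_eq_mul, mul_ite, mul_one,
      mul_zero] at this
    simp only [eq_comm (a := x)]
    rw [hD, minorDet, ← hB, ← this]
    refine Finset.sum_congr rfl fun w _ => ?_
    by_cases hw : w ∈ T
    · simp [minorMatrix, hw, hx, hk]
    · have : w ≠ x := fun e => hw (e ▸ hx)
      simp [minorMatrix, hw, this]
  have haB : ∀ x ∈ T, ∑ w, (if w ∈ T then B.adjugate v w else 0) * B w x =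
      if x = u then B.adjugate v p else 0 := by
    intro x hx
    have h1 := congrFun (adjugate_vecMul (Γ := Γ) v) x
    have hxv : x ≠ v := fun e => hv (e ▸ hx)
    rw [Pi.single_eq_of_ne hxv, Matrix.vecMul, dotProduct, ← hB] at h1
    have h2 : ∑ w, (if w ∈ T then 0 else B.adjugate v w) * B w x =
        if x = u then -B.adjugate v p else 0 := by
      rw [Finset.sum_eq_single p]
      · rw [if_neg (Γ.notMem_branch_self p u)]
        by_cases hxu : x = u
        · subst hxu
          rw [hB, Matrix.neg_apply, Γ.intersectionMatrix_apply_adj hu]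
          simp
        · rw [hB, Matrix.neg_apply, Γ.intersectionMatrix_apply_ne]
          · simp [hxu]
          · rintro rfl
            exact Γ.notMem_branch_self _ _ hx
          · intro h
            exact hxu (eq_of_adj_of_mem_branch hu h hx)
      · intro w _ hw
        by_cases hwT : w ∈ T
        · simp [hwT]
        · rw [hB, Matrix.neg_apply, Γ.intersectionMatrix_apply_ne]
          · simp
          · rintro rfl
            exact hwT hx
          · intro h
            exact hw (eq_of_adj_branch_compl hu hx hwT h.symm).2
      · simp
    have h3 : ∑ w, (if w ∈ T then B.adjugate v w else 0) * B w x +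
        ∑ w, (if w ∈ T then 0 else B.adjugate v w) * B w x = 0 := by
      rw [← Finset.sum_add_distrib]
      refine (Finset.sum_congr rfl fun w _ => ?_).trans h1
      split_ifs <;> simp
    rw [h2] at h3
    split_ifs at h3 ⊢ <;> linarith
  have hη := eq_zero_of_vecMul_eq_zero B Γ.neg_intersectionMatrix_posDef (T := T)
    (η := fun w => D * (if w ∈ T then B.adjugate v w else 0) -
      B.adjugate v p * (if w ∈ T then k w else 0)) (fun x hx => by simp [hx]) (fun x hx => by
      rw [Matrix.vecMul, dotProduct]
      simp only [sub_mul, Finset.sum_sub_distrib, mul_assoc, ← Finset.mul_sum]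
      rw [hkB x hx, haB x hx]
      split_ifs <;> ring)
  have := congrFun hη u
  simp only [huT, if_true, Pi.zero_apply] at this
  rw [hku] at this
  linarith

/-- The linking numbers are the entries of the adjugate of `-A`. -/
theorem linking_eq_adjugate (v w : V) :
    Γ.linking v w = (-Γ.intersectionMatrix).adjugate v w := by
  classical
  obtain ⟨q, hq, -⟩ := Γ.isTree.existsUnique_path w v
  induction q with
  | @nil v =>
    rw [linking_self, Matrix.adjugate_apply]
    conv_rhs => rw [← minorMatrix_univ (-Γ.intersectionMatrix)]
    rw [det_updateRow_minorMatrix _ (Set.mem_univ v), ← minorDet_compl_singleton]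
    rfl
  | @cons u p v h q ih =>
    rw [SimpleGraph.Walk.cons_isPath_iff] at hq
    -- Linking numbers and adjugate entries change by the same factor along an edge away from v, so
    -- agreement passes from p to u; positive minors permit cancellation.
    have hv : v ∉ Γ.branch p u := fun hv =>
      Set.disjoint_left.1 (disjoint_branch_swap h.symm) hv ⟨q, hq.2⟩
    have h1 := linking_mul_spliceWeight h.symm hv
    have h2 := adjugate_mul_minorDet h.symm hv
    rw [minorDet_branch_diff h.symm, ← spliceWeight_eq_minorDet] at h2
    rw [ih hq.1, ← h2] at h1
    refine mul_right_cancel₀ ?_ h1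
    rw [spliceWeight_eq_minorDet]
    exact (Γ.minorDet_pos _).ne'

theorem linking_pos (v w : V) : 0 < Γ.linking v w := by
  classical
  refine Finset.prod_pos fun x _ => Finset.prod_pos fun y _ => ?_
  rw [spliceWeight_eq_minorDet]
  exact Γ.minorDet_pos _

theorem linking_comm (v w : V) : Γ.linking v w = Γ.linking w v := by
  have h : (-Γ.intersectionMatrix)ᵀ = -Γ.intersectionMatrix := by
    ext i j
    simp [Γ.intersectionMatrix_symm i j]
  rw [linking_eq_adjugate, linking_eq_adjugate]
  have h2 := congrFun (congrFun (Matrix.adjugate_transpose (-Γ.intersectionMatrix)) v) w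
  rw [h, Matrix.transpose_apply] at h2
  exact h2.symm

theorem linking_vecMul (v : V) :
    (fun w => Γ.linking v w) ᵥ* Γ.intersectionMatrix =
      Pi.single v (-(-Γ.intersectionMatrix).det) := by
  have h := adjugate_vecMul (Γ := Γ) v
  simp only [← linking_eq_adjugate, Matrix.vecMul_neg] at h
  rw [Pi.single_neg, ← h, neg_neg]

/-- The rows of v and of u are both annihilated by A at the vertices beyond u. Scaled to agree at u,
they agree beyond it by nondegeneracy, because that part of the tree meets the rest only through u.
-/
theorem linking_mul_linking_of_mem_branch {v p u w : V} (hu : Γ.graph.Adj p u)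
    (hv : v ∉ Γ.branch p u) (hw : w ∈ Γ.branch p u) :
    Γ.linking v w * Γ.linking u u = Γ.linking v u * Γ.linking u w := by
  classical
  set B := -Γ.intersectionMatrix with hB
  set T := Γ.branch p u with hT
  by_cases hwu : w = u
  · rw [hwu]
  have hη := eq_zero_of_vecMul_eq_zero B Γ.neg_intersectionMatrix_posDef (T := T \ {u})
    (η := fun w => if w ∈ T \ {u} then
      B.adjugate v w * B.adjugate u u - B.adjugate v u * B.adjugate u w else 0)
    (fun x hx => by simp [hx]) (fun x hx => by
      have h1 := congrFun (adjugate_vecMul (Γ := Γ) v) x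
      have h2 := congrFun (adjugate_vecMul (Γ := Γ) u) x
      rw [Pi.single_eq_of_ne (by rintro rfl; exact hv hx.1), Matrix.vecMul, dotProduct, ← hB] at h1
      rw [Pi.single_eq_of_ne (by rintro rfl; exact hx.2 rfl), Matrix.vecMul, dotProduct, ← hB] at h2
      have h3 : ∑ w, (B.adjugate v w * B.adjugate u u - B.adjugate v u * B.adjugate u w) * B w x =
          0 := by
        calc _ = B.adjugate u u * ∑ w, B.adjugate v w * B w x -
            B.adjugate v u * ∑ w, B.adjugate u w * B w x := by
              rw [Finset.mul_sum, Finset.mul_sum, ← Finset.sum_sub_distrib]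
              exact Finset.sum_congr rfl fun _ _ => by ring
          _ = 0 := by rw [h1, h2]; ring
      rw [Matrix.vecMul, dotProduct]
      refine (Finset.sum_congr rfl fun w _ => ?_).trans h3
      by_cases hwT : w ∈ T \ {u}
      · simp [hwT]
      · rw [if_neg hwT]
        by_cases hwu : w = u
        · subst hwu
          ring
        · have hwT' : w ∉ T := fun h => hwT ⟨h, hwu⟩
          rw [hB, Matrix.neg_apply, Γ.intersectionMatrix_apply_ne]
          · simp
          · rintro rfl
            exact hwT' hx.1
          · intro h
            exact hx.2 (eq_of_adj_branch_compl hu hx.1 hwT' h.symm).1)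
  have := congrFun hη w
  simp only [Pi.zero_apply] at this
  rw [if_pos ⟨hw, hwu⟩] at this
  simp only [linking_eq_adjugate]
  linarith

end Linking

end RootedResolutionDiagram

/-! ### The character group and its relations -/

namespace RootedResolutionDiagram

section CharGroup

variable {V : Type*} [Fintype V] [DecidableEq V] (Γ : RootedResolutionDiagram V)

/-- The sublattice generated by the columns of the intersection matrix other than the one of the
root. -/
noncomputable def rootKernel : AddSubgroup (V → ℤ) :=
  (Pi.evalAddMonoidHom (fun _ : V => ℤ) Γ.root).ker.map
    Γ.intersectionMatrix.mulVecLin.toAddMonoidHom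

theorem mem_rootKernel {x : V → ℤ} :
    x ∈ Γ.rootKernel ↔ ∃ z : V → ℤ, z Γ.root = 0 ∧ Γ.intersectionMatrix *ᵥ z = x := Iff.rfl

/-- The quotient of `ℤ^V` by the columns of the intersection matrix other than the one of the root.
This is the character group of the group `G`. -/
abbrev CharGroup : Type _ := (V → ℤ) ⧸ Γ.rootKernel

/-- The class of a vertex. -/
noncomputable def charClass (v : V) : Γ.CharGroup := QuotientAddGroup.mk (Pi.single v 1)

theorem mk_eq_sum (x : V → ℤ) :
    (QuotientAddGroup.mk x : Γ.CharGroup) = ∑ v, x v • Γ.charClass v := by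
  have h : x = ∑ v, x v • Pi.single v (1 : ℤ) := by
    ext w
    simp [Finset.sum_apply, Pi.single_apply]
  conv_lhs => rw [h]
  change QuotientAddGroup.mk' Γ.rootKernel _ = _
  rw [map_sum]
  exact Finset.sum_congr rfl fun v _ => map_zsmul (QuotientAddGroup.mk' Γ.rootKernel) _ _

theorem linking_dotProduct_mulVec (v : V) (z : V → ℤ) :
    (fun w => Γ.linking v w) ⬝ᵥ (Γ.intersectionMatrix *ᵥ z) =
      -(-Γ.intersectionMatrix).det * z v := by
  rw [Matrix.dotProduct_mulVec, linking_vecMul, single_dotProduct]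

theorem det_neg_intersectionMatrix_pos : 0 < (-Γ.intersectionMatrix).det := by
  have := Γ.minorDet_pos Set.univ
  rwa [minorDet, minorMatrix_univ] at this

/-- The degree on the character group given by the linking numbers with the root. -/
noncomputable def linkingDeg : Γ.CharGroup →+ ℤ :=
  QuotientAddGroup.lift _
    (AddMonoidHom.mk' (fun x : V → ℤ => (fun w => Γ.linking Γ.root w) ⬝ᵥ x)
      fun x y => dotProduct_add _ x y) (by
    rintro _ ⟨z, hz, rfl⟩
    change (fun w => Γ.linking Γ.root w) ⬝ᵥ (Γ.intersectionMatrix *ᵥ z) = 0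
    have hz' : z Γ.root = 0 := hz
    rw [linking_dotProduct_mulVec, hz', mul_zero])

theorem linkingDeg_mk (x : V → ℤ) :
    Γ.linkingDeg (QuotientAddGroup.mk x) = (fun w => Γ.linking Γ.root w) ⬝ᵥ x := rfl

theorem linkingDeg_charClass (v : V) : Γ.linkingDeg (Γ.charClass v) = Γ.linking Γ.root v := by
  rw [charClass, linkingDeg_mk, dotProduct_single, mul_one]

open Classical in
-- This is the relation given by column v of A. The root is excluded because its column is not
-- divided out.
theorem sum_adj_charClass {v : V} (hv : v ≠ Γ.root) :
    Γ.weight v • Γ.charClass v + ∑ u with Γ.graph.Adj v u, Γ.charClass u = 0 := by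
  have h : (QuotientAddGroup.mk (Γ.intersectionMatrix *ᵥ Pi.single v 1) : Γ.CharGroup) = 0 :=
    (QuotientAddGroup.eq_zero_iff _).2 (Γ.mem_rootKernel.2 ⟨_, Pi.single_eq_of_ne hv.symm _, rfl⟩)
  rw [mk_eq_sum, ← Finset.add_sum_erase _ _ (Finset.mem_univ v)] at h
  rw [← h]
  congr 1
  · simp [intersectionMatrix, weightedGraphMatrix]
  · rw [Finset.sum_filter, ← Finset.add_sum_erase _ _ (Finset.mem_univ v), if_neg (by simp),
      zero_add]
    refine Finset.sum_congr rfl fun u hu => ?_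
    have hne : u ≠ v := Finset.ne_of_mem_erase hu
    simp [intersectionMatrix, weightedGraphMatrix, hne, Γ.graph.adj_comm u v]

variable {Γ}

/-- On the branch beyond pu the linking numbers with the root are a fixed multiple of those with u.
Pairing Az with the former gives a multiple of the root coordinate, which is 0, so pairing with the
latter, a nonzero multiple of z u, gives 0 as well. -/
theorem eq_zero_of_mulVec_eq_zero {p u : V} (hu : Γ.AwayFromRoot p u) {z : V → ℤ}
    (hz : z Γ.root = 0) (h : ∀ x, x ∉ Γ.branch p u → (Γ.intersectionMatrix *ᵥ z) x = 0) :
    z u = 0 := by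
  have h1 := Γ.linking_dotProduct_mulVec Γ.root z
  have h2 := Γ.linking_dotProduct_mulVec u z
  rw [hz, mul_zero] at h1
  have h3 : Γ.linking u u * ((fun w => Γ.linking Γ.root w) ⬝ᵥ (Γ.intersectionMatrix *ᵥ z)) =
      Γ.linking Γ.root u * ((fun w => Γ.linking u w) ⬝ᵥ (Γ.intersectionMatrix *ᵥ z)) := by
    rw [dotProduct, dotProduct, Finset.mul_sum, Finset.mul_sum]
    refine Finset.sum_congr rfl fun w _ => ?_
    by_cases hw : w ∈ Γ.branch p u
    · have := linking_mul_linking_of_mem_branch hu.1 hu.2 hw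
      linear_combination (Γ.intersectionMatrix *ᵥ z) w * this
    · rw [h w hw]
      ring
  rw [h1, h2, mul_zero] at h3
  have hd := Γ.det_neg_intersectionMatrix_pos
  have hl := linking_pos (Γ := Γ) Γ.root u
  rcases mul_eq_zero.1 h3.symm with h4 | h4
  · exact absurd h4 hl.ne'
  · rcases mul_eq_zero.1 h4 with h5 | h5
    · exact absurd h5 (neg_ne_zero.2 hd.ne')
    · exact h5

theorem AwayFromRoot.child {p u y : V} (hu : Γ.AwayFromRoot p u) (hy : Γ.graph.Adj u y)
    (hyp : y ≠ p) : Γ.AwayFromRoot u y :=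
  ⟨hy, fun h => hu.2 (branch_subset hu.1 hy hyp h)⟩

theorem AwayFromRoot.ne_root {p u : V} (hu : Γ.AwayFromRoot p u) : u ≠ Γ.root := fun h =>
  hu.2 (h ▸ Γ.self_mem_branch hu.1.ne')

theorem root_mem_branch_swap {p u : V} (hu : Γ.AwayFromRoot p u) : Γ.root ∈ Γ.branch u p := by
  obtain ⟨y, h1, h2⟩ := exists_adj_mem_branch hu.ne_root.symm
  by_cases h : y = p
  · exact h ▸ h2
  · exact absurd (branch_subset hu.1 h1 h h2) hu.2

theorem AwayFromRoot.ne_parent {p u y : V} (hu : Γ.AwayFromRoot p u) (hy : Γ.AwayFromRoot u y) :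
    y ≠ p := by
  rintro rfl
  exact hy.2 (root_mem_branch_swap hu)

theorem exists_parent {v : V} (hv : v ≠ Γ.root) : ∃ p, Γ.AwayFromRoot p v := by
  obtain ⟨p, h1, h2⟩ := exists_adj_mem_branch hv.symm
  exact ⟨p, h1.symm, fun h => Set.disjoint_left.1 (disjoint_branch_swap h1) h2 h⟩

/-- Write x - x' = Az. The previous vanishing result gives z u = 0, so z can be cut off outside the
branch of y without changing Az on that branch. Subtracting the truncated relation from x leaves
only a multiple of the class of u. -/
theorem mk_mem_zmultiples_of_branch {p u y : V} (hu : Γ.AwayFromRoot p u) (hy : Γ.graph.Adj u y)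
    (hyp : y ≠ p) {x x' : V → ℤ} (hx : ∀ v, v ∉ Γ.branch u y → v ≠ u → x v = 0)
    (hx' : ∀ v ∈ Γ.branch u y, x' v = 0) (hx'' : ∀ v, v ∉ Γ.branch p u → x' v = 0)
    (h : (QuotientAddGroup.mk x : Γ.CharGroup) = QuotientAddGroup.mk x') :
    (QuotientAddGroup.mk x : Γ.CharGroup) ∈ AddSubgroup.zmultiples (Γ.charClass u) := by
  classical
  rw [eq_comm, QuotientAddGroup.eq, mem_rootKernel] at h
  obtain ⟨z, hz, hAz⟩ := h
  have hAz' : ∀ v, (Γ.intersectionMatrix *ᵥ z) v = x v - x' v := fun v => by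
    rw [hAz]
    simp only [Pi.add_apply, Pi.neg_apply]
    ring
  have huT : u ∈ Γ.branch p u := Γ.self_mem_branch hu.1.ne'
  have hsub := branch_subset hu.1 hy hyp
  have hzu : z u = 0 := eq_zero_of_mulVec_eq_zero hu hz fun v hv => by
    rw [hAz', hx v (fun h => hv (hsub h)) (fun h => hv (h ▸ huT)), hx'' v hv, sub_zero]
  -- Because z u = 0, cutting z off here affects Az only at u and outside the branch.
  set z₁ : V → ℤ := fun v => if v ∈ Γ.branch u y then z v else 0 with hz₁
  have hz₁r : z₁ Γ.root = 0 := if_neg fun h => hu.2 (hsub h)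
  have key : x - Γ.intersectionMatrix *ᵥ z₁ =
      (x u - (Γ.intersectionMatrix *ᵥ z₁) u) • Pi.single u (1 : ℤ) := by
    ext v
    by_cases hvu : v = u
    · subst hvu
      simp
    · rw [Pi.smul_apply, Pi.single_eq_of_ne hvu, smul_zero, Pi.sub_apply]
      by_cases hv : v ∈ Γ.branch u y
      · have : (Γ.intersectionMatrix *ᵥ z₁) v = (Γ.intersectionMatrix *ᵥ z) v := by
          rw [Matrix.mulVec, Matrix.mulVec, dotProduct, dotProduct]
          refine Finset.sum_congr rfl fun w _ => ?_
          by_cases hw : w ∈ Γ.branch u y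
          · simp [hz₁, hw]
          · by_cases hwu : w = u
            · subst hwu
              simp [hz₁, hzu]
            · rw [Γ.intersectionMatrix_apply_ne, zero_mul, zero_mul]
              · rintro rfl
                exact hw hv
              · intro h
                exact hwu (eq_of_adj_branch_compl hy hv hw h).2
        rw [this, hAz', hx' v hv]
        ring
      · have : (Γ.intersectionMatrix *ᵥ z₁) v = 0 := by
          refine Finset.sum_eq_zero fun w _ => ?_
          change Γ.intersectionMatrix v w * z₁ w = 0
          by_cases hw : w ∈ Γ.branch u y
          · rw [Γ.intersectionMatrix_apply_ne, zero_mul]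
            · rintro rfl
              exact hv hw
            · intro h
              exact hvu (eq_of_adj_branch_compl hy hw hv h.symm).2
          · simp [hz₁, hw]
        rw [this, hx v hv hvu, sub_zero]
  have hmk : (QuotientAddGroup.mk x : Γ.CharGroup) =
      QuotientAddGroup.mk (x - Γ.intersectionMatrix *ᵥ z₁) := by
    rw [QuotientAddGroup.eq, mem_rootKernel]
    refine ⟨-z₁, by simp [hz₁r], ?_⟩
    rw [Matrix.mulVec_neg]
    abel
  rw [hmk, key]
  exact AddSubgroup.mem_zmultiples_iff.2 ⟨_, rfl⟩

end CharGroup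

/-! ### The discriminant group as a quotient of the character group -/

section Discriminant

variable {V : Type*} [Fintype V] [DecidableEq V] (Γ : RootedResolutionDiagram V)

theorem natCard_disc : (Nat.card Γ.Disc : ℤ) = (-Γ.intersectionMatrix).det := by
  have hdet : Γ.intersectionMatrix.det ≠ 0 := by
    intro h
    have := Γ.det_neg_intersectionMatrix_pos
    rw [Matrix.det_neg, h, mul_zero] at this
    exact this.ne rfl
  have hinj : Function.Injective Γ.intersectionMatrix.mulVecLin :=
    (injective_iff_map_eq_zero _).2 fun x hx => Matrix.eq_zero_of_mulVec_eq_zero hdet hx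
  have h := Submodule.natAbs_det_equiv (LinearMap.range Γ.intersectionMatrix.mulVecLin)
    (LinearEquiv.ofInjective _ hinj)
  have h2 : (LinearMap.range Γ.intersectionMatrix.mulVecLin).subtype ∘ₗ
      AddMonoidHom.toIntLinearMap ((LinearEquiv.ofInjective _ hinj :
        (V → ℤ) ≃ₗ[ℤ] LinearMap.range Γ.intersectionMatrix.mulVecLin) :
        (V → ℤ) →+ LinearMap.range Γ.intersectionMatrix.mulVecLin) =
      Matrix.toLin' Γ.intersectionMatrix := LinearMap.ext fun x => rfl
  rw [h2, LinearMap.det_toLin'] at h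
  have h3 : Nat.card Γ.Disc = Γ.intersectionMatrix.det.natAbs := h.symm
  have h4 : (-Γ.intersectionMatrix).det.natAbs = Γ.intersectionMatrix.det.natAbs := by
    rw [Matrix.det_neg, Int.natAbs_mul, Int.natAbs_pow]
    simp
  rw [h3, ← h4, Int.natAbs_of_nonneg Γ.det_neg_intersectionMatrix_pos.le]

/-- The projection from the character group to the discriminant group. -/
noncomputable def toDisc : Γ.CharGroup →+ Γ.Disc :=
  QuotientAddGroup.lift _ (QuotientAddGroup.mk' _) (by
    rintro _ ⟨z, -, rfl⟩
    exact (QuotientAddGroup.eq_zero_iff _).2 ⟨z, rfl⟩)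

theorem toDisc_mk (x : V → ℤ) : Γ.toDisc (QuotientAddGroup.mk x) = QuotientAddGroup.mk x := rfl

/-- A generator of the kernel of the projection to the discriminant group. -/
noncomputable def rootRelation : Γ.CharGroup :=
  QuotientAddGroup.mk (-(Γ.intersectionMatrix *ᵥ Pi.single Γ.root 1))

theorem linkingDeg_rootRelation :
    Γ.linkingDeg Γ.rootRelation = (-Γ.intersectionMatrix).det := by
  rw [rootRelation, linkingDeg_mk, dotProduct_neg, linking_dotProduct_mulVec]
  simp

theorem exists_zsmul_of_toDisc_eq_zero {x : Γ.CharGroup} (hx : Γ.toDisc x = 0) :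
    ∃ n : ℤ, x = n • Γ.rootRelation := by
  obtain ⟨x, rfl⟩ := QuotientAddGroup.mk_surjective x
  rw [toDisc_mk, QuotientAddGroup.eq_zero_iff] at hx
  obtain ⟨z, rfl⟩ := hx
  refine ⟨-z Γ.root, ?_⟩
  change _ = QuotientAddGroup.mk ((-z Γ.root) • (-(Γ.intersectionMatrix *ᵥ Pi.single Γ.root 1)))
  rw [QuotientAddGroup.eq, mem_rootKernel]
  refine ⟨-z + z Γ.root • Pi.single Γ.root 1, by simp, ?_⟩
  rw [Matrix.mulVec_add, Matrix.mulVec_neg, Matrix.mulVec_smul, neg_smul, smul_neg, neg_neg]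
  rfl

/-- The root relation generates the kernel of the projection to D and has degree det(-A), so the
slab is a set of representatives for D, a group of order det(-A). Hence the character group has one
element per unit of degree. -/
theorem ncard_degreeSlab_rootRelation :
    ((degreeSlab Γ.linkingDeg ⊤ (Γ.linkingDeg Γ.rootRelation)).ncard : ℤ) =
      Γ.linkingDeg Γ.rootRelation := by
  have hpos : 0 < Γ.linkingDeg Γ.rootRelation := by
    rw [linkingDeg_rootRelation]
    exact Γ.det_neg_intersectionMatrix_pos
  conv_rhs => rw [linkingDeg_rootRelation, ← natCard_disc]
  rw [← Nat.card_coe_set_eq]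
  congr 1
  refine Nat.card_congr (Equiv.ofBijective (fun x => Γ.toDisc x.1) ⟨?_, ?_⟩)
  · rintro ⟨x, hx⟩ ⟨y, hy⟩ h
    have h' : Γ.toDisc (x - y) = 0 := by
      rw [map_sub, sub_eq_zero]
      exact h
    obtain ⟨n, hn⟩ := Γ.exists_zsmul_of_toDisc_eq_zero h'
    refine Subtype.ext (degreeSlab_injective Γ.linkingDeg hx hy (n := 0) (n' := n) ?_).1
    rw [← hn]
    simp
  · intro d
    obtain ⟨x, rfl⟩ := QuotientAddGroup.mk_surjective d
    obtain ⟨q, hq, n, hn⟩ := exists_mem_degreeSlab_add_zsmul Γ.linkingDeg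
      (AddSubgroup.mem_top Γ.rootRelation) hpos
      (AddSubgroup.mem_top (QuotientAddGroup.mk x : Γ.CharGroup))
    refine ⟨⟨q, hq⟩, ?_⟩
    rw [← toDisc_mk, hn, map_add, map_zsmul]
    have : Γ.toDisc Γ.rootRelation = 0 := by
      rw [rootRelation, toDisc_mk, QuotientAddGroup.eq_zero_iff]
      exact ⟨-Pi.single Γ.root 1, by simp [Matrix.mulVec_neg]⟩
    rw [this, smul_zero, add_zero]

end Discriminant

end RootedResolutionDiagram

/-! ### The leaf semigroup as a gluing along the tree -/

namespace RootedResolutionDiagram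

section TreeInduction

variable {V : Type*} [Fintype V] [DecidableEq V] (Γ : RootedResolutionDiagram V)

open Classical in
/-- The non-root leaves in a set of vertices. -/
noncomputable def leavesIn (T : Set V) : Finset Γ.Leaf := Finset.univ.filter fun w => (w : V) ∈ T

/-- The elements of the character group attached to the non-root leaves. -/
noncomputable def leafClass (w : Γ.Leaf) : Γ.CharGroup := Γ.charClass w

open Classical in
/-- The contribution of a set of vertices to `ν(Γ,*)`. -/
noncomputable def nuOn (T : Set V) : ℤ :=
  ∑ v with v ∈ T, ((Γ.valency v : ℤ) - 2) * Γ.linking Γ.root v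

variable {Γ}

theorem mem_leavesIn {T : Set V} {w : Γ.Leaf} : w ∈ Γ.leavesIn T ↔ (w : V) ∈ T := by
  classical
  simp [leavesIn]

theorem nuOn_union {T T' : Set V} (h : Disjoint T T') :
    Γ.nuOn (T ∪ T') = Γ.nuOn T + Γ.nuOn T' := by
  classical
  rw [nuOn, nuOn, nuOn, ← Finset.sum_union]
  · refine Finset.sum_congr ?_ fun _ _ => rfl
    ext v
    simp
  · rw [Finset.disjoint_filter]
    exact fun v _ => fun h1 h2 => Set.disjoint_left.1 h h1 h2

theorem nuOn_singleton (v : V) : Γ.nuOn {v} = ((Γ.valency v : ℤ) - 2) * Γ.linking Γ.root v := by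
  classical
  rw [nuOn, ← Finset.sum_singleton (fun x => ((Γ.valency x : ℤ) - 2) * Γ.linking Γ.root x) v]
  exact Finset.sum_congr (by ext x; simp) fun _ _ => rfl

theorem leavesIn_union [DecidableEq Γ.Leaf] (T T' : Set V) :
    Γ.leavesIn (T ∪ T') = Γ.leavesIn T ∪ Γ.leavesIn T' := by
  ext w
  simp [mem_leavesIn]

theorem exists_mk_of_mem_leafGroup {T : Set V} {x : Γ.CharGroup}
    (hx : x ∈ leafGroup Γ.leafClass (Γ.leavesIn T)) :
    ∃ y : V → ℤ, (∀ v, v ∉ T → y v = 0) ∧ QuotientAddGroup.mk y = x := by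
  induction hx using AddSubgroup.closure_induction with
  | mem x hx =>
    obtain ⟨w, hw, rfl⟩ := hx
    refine ⟨Pi.single (w : V) 1, fun v hv => ?_, rfl⟩
    refine Pi.single_eq_of_ne ?_ _
    rintro rfl
    exact hv (mem_leavesIn.1 hw)
  | zero => exact ⟨0, by simp, rfl⟩
  | add x y _ _ hx hy =>
    obtain ⟨a, ha, rfl⟩ := hx
    obtain ⟨b, hb, rfl⟩ := hy
    exact ⟨a + b, fun v hv => by simp [ha v hv, hb v hv], rfl⟩
  | neg x _ hx =>
    obtain ⟨a, ha, rfl⟩ := hx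
    exact ⟨-a, fun v hv => by simp [ha v hv], rfl⟩

theorem leafGroup_mono {T T' : Set V} (h : T ⊆ T') :
    leafGroup Γ.leafClass (Γ.leavesIn T) ≤ leafGroup Γ.leafClass (Γ.leavesIn T') :=
  AddSubgroup.closure_mono (Set.image_mono fun _ hw => mem_leavesIn.2 (h (mem_leavesIn.1 hw)))

theorem valency_eq_card [DecidableRel Γ.graph.Adj] (v : V) :
    Γ.valency v = (Finset.univ.filter fun y => Γ.graph.Adj v y).card := by
  rw [valency, ← Set.ncard_coe_finset]
  congr 1
  ext y
  simp

/-- A set of vertices whose leaves generate a glued semigroup, with the value `W`, and whose gluing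
elements include those at all nodes in the set. -/
def IsGluedOn (Γ : RootedResolutionDiagram V) [DecidableEq Γ.Leaf] (T : Set V) (W : ℤ)
    (N : Set (V × V)) : Prop :=
  ∃ C, GluedSemigroup Γ.linkingDeg Γ.leafClass (Γ.leavesIn T) W C ∧
    (∀ v ∈ T, ∀ y, Γ.AwayFromRoot v y → 3 ≤ Γ.valency v →
      (Γ.leavesIn (Γ.branch v y), Γ.charClass v) ∈ C) ∧
    ∀ e ∈ N, (Γ.leavesIn (Γ.branch e.1 e.2), Γ.charClass e.1) ∈ C

/-- Branches at u are glued one after another along the class of u. Each gluing adds deg = ℓ_{*,u}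
to the bound, so there are one fewer such terms than branches. -/
theorem isGluedOn_children [DecidableEq Γ.Leaf] {p u : V} (hu : Γ.AwayFromRoot p u)
    (ih : ∀ y, Γ.graph.Adj u y → y ≠ p → Γ.IsGluedOn (Γ.branch u y) (Γ.nuOn (Γ.branch u y)) ∅ ∧
      Γ.charClass y ∈ leafGroup Γ.leafClass (Γ.leavesIn (Γ.branch u y)) ∧
      Γ.charClass u ∈ leafGroup Γ.leafClass (Γ.leavesIn (Γ.branch u y)))
    {s : Finset V} (hne : s.Nonempty) (hs : ∀ y ∈ s, Γ.graph.Adj u y ∧ y ≠ p) :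
    Γ.IsGluedOn (⋃ y ∈ s, Γ.branch u y)
      (Γ.nuOn (⋃ y ∈ s, Γ.branch u y) + ((s.card : ℤ) - 1) * Γ.linking Γ.root u)
      {e | e.1 = u ∧ e.2 ∈ s ∧ 2 ≤ s.card} := by
  induction hne using Finset.Nonempty.cons_induction with
  | singleton a =>
    obtain ⟨⟨C, h1, h2, -⟩, -⟩ := ih a (hs a (Finset.mem_singleton_self a)).1
      (hs a (Finset.mem_singleton_self a)).2
    refine ⟨C, ?_, ?_, ?_⟩
    · simpa using h1
    · simpa using h2
    · rintro e ⟨-, -, h⟩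
      simp at h
  | cons a s ha hne' ihs =>
    obtain ⟨haj, hap⟩ := hs a (Finset.mem_cons_self a s)
    have hs' : ∀ y ∈ s, Γ.graph.Adj u y ∧ y ≠ p := fun y hy => hs y (Finset.mem_cons.2 (Or.inr hy))
    obtain ⟨⟨C₁, g₁, c₁, -⟩, -, e₁⟩ := ih a haj hap
    obtain ⟨C₂, g₂, c₂, n₂⟩ := ihs hs'
    have hd : ∀ y ∈ s, Disjoint (Γ.branch u a) (Γ.branch u y) := fun y hy =>
      disjoint_branch haj (hs' y hy).1 fun e => ha (e ▸ hy)
    have hd' : Disjoint (Γ.branch u a) (⋃ y ∈ s, Γ.branch u y) := by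
      simpa only [Set.disjoint_iUnion_right] using hd
    have hunion : (⋃ y ∈ Finset.cons a s ha, Γ.branch u y) =
        Γ.branch u a ∪ ⋃ y ∈ s, Γ.branch u y := by
      ext x
      simp
    have e₂ : Γ.charClass u ∈ leafGroup Γ.leafClass (Γ.leavesIn (⋃ y ∈ s, Γ.branch u y)) := by
      obtain ⟨y, hy⟩ := hne'
      exact leafGroup_mono (Set.subset_biUnion_of_mem (u := fun y => Γ.branch u y) hy)
        (ih y (hs' y hy).1 (hs' y hy).2).2.2
    -- The class of u lies in the group of every branch; conversely, a common element has
    -- representatives supported on disjoint branches.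
    have hinf : leafGroup Γ.leafClass (Γ.leavesIn (Γ.branch u a)) ⊓
        leafGroup Γ.leafClass (Γ.leavesIn (⋃ y ∈ s, Γ.branch u y)) =
        AddSubgroup.zmultiples (Γ.charClass u) := by
      refine le_antisymm ?_ ((AddSubgroup.zmultiples_le).2 ⟨e₁, e₂⟩)
      rintro x ⟨hx₁, hx₂⟩
      obtain ⟨y₁, h₁, rfl⟩ := exists_mk_of_mem_leafGroup hx₁
      obtain ⟨y₂, h₂, h⟩ := exists_mk_of_mem_leafGroup hx₂
      refine mk_mem_zmultiples_of_branch hu haj hap (fun v hv _ => h₁ v hv)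
        (fun v hv => h₂ v fun h => Set.disjoint_left.1 hd' hv h) (fun v hv => h₂ v fun h => hv ?_)
        h.symm
      obtain ⟨y, hy, hvy⟩ := Set.mem_iUnion₂.1 h
      exact branch_subset hu.1 (hs' y hy).1 (hs' y hy).2 hvy
    have hdisj : Disjoint (Γ.leavesIn (Γ.branch u a)) (Γ.leavesIn (⋃ y ∈ s, Γ.branch u y)) := by
      rw [Finset.disjoint_left]
      intro w hw hw'
      exact Set.disjoint_left.1 hd' (mem_leavesIn.1 hw) (mem_leavesIn.1 hw')
    have hpos : 0 < Γ.linkingDeg (Γ.charClass u) := by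
      rw [linkingDeg_charClass]
      exact linking_pos _ _
    refine ⟨C₁ ∪ C₂ ∪ {(Γ.leavesIn (Γ.branch u a), Γ.charClass u),
      (Γ.leavesIn (⋃ y ∈ s, Γ.branch u y), Γ.charClass u)}, ?_, ?_, ?_⟩
    · have := GluedSemigroup.glue hdisj hinf hpos g₁ g₂
      rw [hunion, leavesIn_union, nuOn_union hd', Finset.card_cons]
      convert this using 1
      rw [linkingDeg_charClass]
      push_cast
      ring
    · rw [hunion]
      rintro v (hv | hv) y hy h3
      · exact Or.inl (Or.inl (c₁ v hv y hy h3))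
      · exact Or.inl (Or.inr (c₂ v hv y hy h3))
    · rintro ⟨x, y⟩ ⟨rfl, hy, -⟩
      rcases Finset.mem_cons.1 hy with rfl | hy
      · exact Or.inr (Or.inl rfl)
      -- When only one branch was present before, the second set of the new gluing is that branch
      -- itself, so it is recorded now.
      · by_cases h2 : 2 ≤ s.card
        · exact Or.inl (Or.inr (n₂ (x, y) ⟨rfl, hy, h2⟩))
        · have h1 : s.card = 1 := by
            have := hne'.card_pos
            omega
          obtain ⟨b, rfl⟩ := Finset.card_eq_one.1 h1
          obtain rfl : y = b := by simpa using hy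
          right
          right
          simp

theorem branch_eq_insert {p u : V} (hu : Γ.graph.Adj p u) {s : Finset V}
    (hs : ∀ y, y ∈ s ↔ Γ.graph.Adj u y ∧ y ≠ p) :
    Γ.branch p u = {u} ∪ ⋃ y ∈ s, Γ.branch u y := by
  ext x
  rw [mem_branch_iff hu]
  simp [hs, and_assoc]

/-- Induction on the size of the branch. The class of the parent p has to be carried along, since at
the next level it is the element along which branches are glued; it comes from the relation at u,
which expresses it through the classes of u and its children. -/
theorem isGluedOn_branch [DecidableEq Γ.Leaf] {p u : V} (hu : Γ.AwayFromRoot p u) :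
    Γ.IsGluedOn (Γ.branch p u) (Γ.nuOn (Γ.branch p u)) ∅ ∧
      Γ.charClass u ∈ leafGroup Γ.leafClass (Γ.leavesIn (Γ.branch p u)) ∧
      Γ.charClass p ∈ leafGroup Γ.leafClass (Γ.leavesIn (Γ.branch p u)) := by
  classical
  induction hn : (Γ.branch p u).ncard using Nat.strong_induction_on generalizing p u with
  | _ n ihn =>
  have ih : ∀ y, Γ.graph.Adj u y → y ≠ p →
      Γ.IsGluedOn (Γ.branch u y) (Γ.nuOn (Γ.branch u y)) ∅ ∧
      Γ.charClass y ∈ leafGroup Γ.leafClass (Γ.leavesIn (Γ.branch u y)) ∧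
      Γ.charClass u ∈ leafGroup Γ.leafClass (Γ.leavesIn (Γ.branch u y)) := by
    intro y hy hyp
    refine ihn _ ?_ (hu.child hy hyp) rfl
    rw [← hn]
    refine Set.ncard_lt_ncard ⟨branch_subset hu.1 hy hyp, fun h => ?_⟩ (Set.toFinite _)
    exact Γ.notMem_branch_self u y (h (Γ.self_mem_branch hu.1.ne'))
  set K := Finset.univ.filter fun y => Γ.graph.Adj u y ∧ y ≠ p with hK
  have hKmem : ∀ y, y ∈ K ↔ Γ.graph.Adj u y ∧ y ≠ p := fun y => by simp [hK]
  have hbr := branch_eq_insert hu.1 hKmem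
  have hnbr : (Finset.univ.filter fun y => Γ.graph.Adj u y) = insert p K := by
    ext y
    simp only [Finset.mem_filter, Finset.mem_univ, true_and, Finset.mem_insert, hKmem]
    constructor
    · tauto
    · rintro (rfl | h)
      exacts [hu.1.symm, h.1]
  have hval : Γ.valency u = K.card + 1 := by
    rw [valency_eq_card, hnbr, Finset.card_insert_of_notMem (by simp [hKmem])]
  have huU : u ∉ ⋃ y ∈ K, Γ.branch u y := by
    intro h
    obtain ⟨y, -, h⟩ := Set.mem_iUnion₂.1 h
    exact Γ.notMem_branch_self _ _ h
  have hrel := Γ.sum_adj_charClass hu.ne_root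
  rw [hnbr, Finset.sum_insert (by simp [hKmem])] at hrel
  have hparent : Γ.charClass u ∈ leafGroup Γ.leafClass (Γ.leavesIn (Γ.branch p u)) →
      Γ.charClass p ∈ leafGroup Γ.leafClass (Γ.leavesIn (Γ.branch p u)) := by
    intro h
    have : Γ.charClass p = -(Γ.weight u • Γ.charClass u + ∑ y ∈ K, Γ.charClass y) := by
      rw [eq_neg_iff_add_eq_zero, ← hrel]
      abel
    rw [this]
    refine AddSubgroup.neg_mem _ (AddSubgroup.add_mem _ (AddSubgroup.zsmul_mem _ h _)
      (AddSubgroup.sum_mem _ fun y hy => ?_))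
    rw [hKmem] at hy
    exact leafGroup_mono (branch_subset hu.1 hy.1 hy.2) (ih y hy.1 hy.2).2.1
  -- With k children the valency is k + 1, so d - 2 = k - 1 is the number of gluings at u; for k = 0
  -- it is the initial value -1 of a leaf.
  have hnu : Γ.nuOn (Γ.branch p u) = Γ.nuOn (⋃ y ∈ K, Γ.branch u y) +
      ((K.card : ℤ) - 1) * Γ.linking Γ.root u := by
    rw [hbr, nuOn_union (Set.disjoint_singleton_left.2 huU), nuOn_singleton, hval]
    push_cast
    ring
  rcases K.eq_empty_or_nonempty with hK0 | hKne
  · have hval1 : Γ.valency u = 1 := by rw [hval, hK0, Finset.card_empty]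
    have hleaf : Γ.IsNonRootLeaf u := Or.inl ⟨hu.ne_root, hval1⟩
    have hbr' : Γ.branch p u = {u} := by rw [hbr, hK0]; simp
    have hL : Γ.leavesIn (Γ.branch p u) = {⟨u, hleaf⟩} := by
      ext w
      rw [mem_leavesIn, hbr', Set.mem_singleton_iff, Finset.mem_singleton, Subtype.ext_iff]
    have hmem : Γ.charClass u ∈ leafGroup Γ.leafClass (Γ.leavesIn (Γ.branch p u)) := by
      rw [hL]
      exact AddSubgroup.subset_closure ⟨⟨u, hleaf⟩, by simp, rfl⟩
    refine ⟨⟨∅, ?_, ?_, by simp⟩, hmem, hparent hmem⟩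
    · rw [hL, hnu, hK0]
      have := GluedSemigroup.leaf (deg := Γ.linkingDeg) (g := Γ.leafClass) ⟨u, hleaf⟩
      rw [leafClass, linkingDeg_charClass] at this
      convert this using 1
      simp [nuOn]
    · rw [hbr']
      rintro v rfl y _ h3
      omega
  · have hnl : ¬ Γ.IsNonRootLeaf u := by
      rintro (⟨-, h⟩ | ⟨h, -⟩)
      · have := hKne.card_pos
        omega
      · exact hu.ne_root h
    have hL : Γ.leavesIn (Γ.branch p u) = Γ.leavesIn (⋃ y ∈ K, Γ.branch u y) := by
      ext w
      rw [mem_leavesIn, mem_leavesIn, hbr, Set.mem_union]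
      refine or_iff_right ?_
      intro h
      exact hnl (h ▸ w.2)
    obtain ⟨C, hC, hC', hN⟩ := isGluedOn_children hu ih hKne fun y hy => (hKmem y).1 hy
    have hmem : Γ.charClass u ∈ leafGroup Γ.leafClass (Γ.leavesIn (Γ.branch p u)) := by
      obtain ⟨y, hy⟩ := hKne
      rw [hKmem] at hy
      exact leafGroup_mono (branch_subset hu.1 hy.1 hy.2) (ih y hy.1 hy.2).2.2
    refine ⟨⟨C, ?_, ?_, by simp⟩, hmem, hparent hmem⟩
    · rw [hL, hnu]
      exact hC
    · rw [hbr]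
      rintro v (rfl | hv) y hy h3
      · exact hN (v, y) ⟨rfl, (hKmem y).2 ⟨hy.1, hu.ne_parent hy⟩, by omega⟩
      · exact hC' v hv y hy h3

theorem eq_root_of_valency_eq_zero (h : Γ.valency Γ.root = 0) (v : V) : v = Γ.root := by
  by_contra hv
  obtain ⟨u, hu, -⟩ := exists_adj_mem_branch hv
  have h0 := (Set.ncard_eq_zero (Set.toFinite _)).1 h
  exact Set.notMem_empty u (h0 ▸ hu)

variable (Γ)

/-- The semigroup generated by all non-root leaves is glued, with the value `ν(Γ,*)`. -/
theorem exists_gluedSemigroup [DecidableEq Γ.Leaf] :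
    ∃ C, GluedSemigroup Γ.linkingDeg Γ.leafClass Finset.univ Γ.nu C ∧
    ∀ v y, Γ.AwayFromRoot v y → 3 ≤ Γ.valency v →
      (Γ.leavesIn (Γ.branch v y), Γ.charClass v) ∈ C := by
  classical
  by_cases h0 : Γ.valency Γ.root = 0
  · have hleaf : Γ.IsNonRootLeaf Γ.root := Or.inr ⟨rfl, h0⟩
    have huniv : (Finset.univ : Finset Γ.Leaf) = {⟨Γ.root, hleaf⟩} := by
      ext w
      simp only [Finset.mem_univ, Finset.mem_singleton, true_iff]
      exact Subtype.ext (eq_root_of_valency_eq_zero h0 w)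
    refine ⟨∅, ?_, ?_⟩
    · rw [huniv, nu, if_pos h0]
      -- The single vertex is its own leaf of degree 1, the empty product, which matches ν = -1.
      have := GluedSemigroup.leaf (deg := Γ.linkingDeg) (g := Γ.leafClass) ⟨Γ.root, hleaf⟩
      rw [leafClass, linkingDeg_charClass, linking_self, Finset.prod_eq_one] at this
      · exact this
      · intro y hy
        simp only [Finset.mem_filter, Finset.mem_univ, true_and] at hy
        exact absurd (eq_root_of_valency_eq_zero h0 y) hy.ne'
    · intro v y _ h3
      rw [eq_root_of_valency_eq_zero h0 v] at h3
      omega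
  · have h1 : Γ.valency Γ.root = 1 := by
      have h : Γ.valency Γ.root ≤ 1 := Γ.root_isLeaf
      omega
    obtain ⟨v₀, hv₀⟩ := Set.ncard_eq_one.1 h1
    have hadj : Γ.graph.Adj Γ.root v₀ := by
      have : v₀ ∈ Γ.graph.neighborSet Γ.root := hv₀ ▸ rfl
      exact this
    have haway : Γ.AwayFromRoot Γ.root v₀ := ⟨hadj, Γ.notMem_branch_self _ _⟩
    have hmem : ∀ v, v ∈ Γ.branch Γ.root v₀ ↔ v ≠ Γ.root := by
      intro v
      constructor
      · rintro h rfl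
        exact haway.2 h
      · intro h
        obtain ⟨u, hu, hv⟩ := exists_adj_mem_branch h
        have : u ∈ Γ.graph.neighborSet Γ.root := hu
        rw [hv₀, Set.mem_singleton_iff] at this
        exact this ▸ hv
    obtain ⟨⟨C, hC, hC', -⟩, -⟩ := isGluedOn_branch haway
    refine ⟨C, ?_, fun v y hy h3 => hC' v ?_ y hy h3⟩
    · have hL : Γ.leavesIn (Γ.branch Γ.root v₀) = Finset.univ := by
        ext w
        simp only [mem_leavesIn, hmem, Finset.mem_univ, iff_true]
        rcases w.2 with h | h
        exacts [h.1, absurd h.2 h0]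
      have hnu : Γ.nu = Γ.nuOn (Γ.branch Γ.root v₀) := by
        rw [nu, if_neg h0, nuOn]
        refine Finset.sum_congr (Finset.filter_congr fun v _ => ?_) fun _ _ => rfl
        rw [hmem]
      rw [hnu, ← hL]
      exact hC
    · rw [hmem]
      rintro rfl
      omega

/-- The relations away from the root, used from the leaves inward, express every vertex class, the
root's included, through leaf classes. -/
theorem leafGroup_univ : leafGroup Γ.leafClass Finset.univ = ⊤ := by
  classical
  have huniv : ∀ T, leafGroup Γ.leafClass (Γ.leavesIn T) ≤ leafGroup Γ.leafClass Finset.univ :=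
    fun T => AddSubgroup.closure_mono (Set.image_mono fun _ _ => Finset.mem_coe.2 (Finset.mem_univ _))
  have hclass : ∀ v, Γ.charClass v ∈ leafGroup Γ.leafClass Finset.univ := by
    intro v
    by_cases hv : v = Γ.root
    · subst hv
      by_cases h0 : Γ.valency Γ.root = 0
      · exact AddSubgroup.subset_closure ⟨⟨Γ.root, Or.inr ⟨rfl, h0⟩⟩, by simp, rfl⟩
      · have hne := Set.nonempty_of_ncard_ne_zero h0
        obtain ⟨u, hu⟩ := hne
        exact huniv _ (isGluedOn_branch (p := Γ.root) (u := u)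
          ⟨hu, Γ.notMem_branch_self _ _⟩).2.2
    · obtain ⟨p, hp⟩ := exists_parent hv
      exact huniv _ (isGluedOn_branch hp).2.1
  rw [eq_top_iff]
  rintro x -
  obtain ⟨x, rfl⟩ := QuotientAddGroup.mk_surjective x
  rw [mk_eq_sum]
  exact AddSubgroup.sum_mem _ fun v _ => AddSubgroup.zsmul_mem _ (hclass v) _

end TreeInduction

end RootedResolutionDiagram

/-! ### Polynomials vanishing on an orbit -/

section Orbit

variable {X Λ E : Type*} [AddCommGroup X] [Group E] (g : Λ → X)

/-- The kernel of the map to the group algebra consists of the polynomials that vanish on the orbit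
of `(1,…,1)` under a group on which the elements of `X` are distinct characters. -/
theorem semigroupAlgHom_eq_zero_iff (Θ : Multiplicative X →* E →* ℂˣ)
    (hΘ : Function.Injective Θ) (f : MvPolynomial Λ ℂ) :
    semigroupAlgHom ℂ g f = 0 ↔
      ∀ t, MvPolynomial.aeval (fun w => (Θ (Multiplicative.ofAdd (g w)) t : ℂ)) f = 0 := by
  let F : E → Multiplicative X →* ℂ := fun t =>
    (Units.coeHom ℂ).comp ((MonoidHom.eval t).comp Θ)
  have hF : ∀ t f, MvPolynomial.aeval (fun w => (Θ (Multiplicative.ofAdd (g w)) t : ℂ)) f =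
      AddMonoidAlgebra.lift ℂ ℂ X (F t) (semigroupAlgHom ℂ g f) := by
    intro t f
    have : MvPolynomial.aeval (fun w => (Θ (Multiplicative.ofAdd (g w)) t : ℂ)) =
        (AddMonoidAlgebra.lift ℂ ℂ X (F t)).comp (semigroupAlgHom ℂ g) := by
      refine MvPolynomial.algHom_ext fun w => ?_
      rw [AlgHom.comp_apply, semigroupAlgHom, MvPolynomial.aeval_X, MvPolynomial.aeval_X,
        AddMonoidAlgebra.lift_single, one_smul]
      rfl
    rw [this, AlgHom.comp_apply]
  constructor
  · intro h t
    rw [hF, h, map_zero]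
  · intro h
    -- Distinct elements of X give distinct characters, and these are linearly independent: a
    -- combination that vanishes as a function has zero coefficients.
    have hinj : Function.Injective fun x : X =>
        (Units.coeHom ℂ).comp (Θ (Multiplicative.ofAdd x)) := fun x y hxy =>
      Multiplicative.ofAdd.injective (hΘ (MonoidHom.ext fun t =>
        Units.ext (DFunLike.congr_fun hxy t)))
    have hli := (linearIndependent_monoidHom E ℂ).comp _ hinj
    have h0 := linearIndependent_iff.1 hli (semigroupAlgHom ℂ g f).coeff (by
      ext t
      have := h t
      rw [hF, AddMonoidAlgebra.lift_apply] at this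
      rw [Finsupp.linearCombination_apply, Finsupp.sum_apply']
      exact this)
    exact AddMonoidAlgebra.coeff_injective h0

end Orbit

/-! ### The ideal of the curve -/

namespace RootedResolutionDiagram

section CurveIdeal

variable {V : Type*} [Fintype V] [DecidableEq V] (Γ : RootedResolutionDiagram V)

theorem weightGcd_dvd_linkingDeg (x : Γ.CharGroup) : Γ.weightGcd ∣ Γ.linkingDeg x := by
  have hx : x ∈ leafGroup Γ.leafClass Finset.univ := Γ.leafGroup_univ ▸ AddSubgroup.mem_top x
  induction hx using AddSubgroup.closure_induction with
  | mem x hx =>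
    obtain ⟨w, -, rfl⟩ := hx
    rw [leafClass, linkingDeg_charClass, linking_comm]
    exact Finset.gcd_dvd (Finset.mem_univ w)
  | zero => simp
  | add x y _ _ hx hy =>
    rw [map_add]
    exact dvd_add hx hy
  | neg x _ hx =>
    rw [map_neg]
    exact hx.neg_right

theorem weightGcd_pos : 0 < Γ.weightGcd := by
  refine lt_of_le_of_ne ?_ fun h => ?_
  · rw [weightGcd, ← Finset.normalize_gcd]
    exact Int.nonneg_of_normalize_eq_self (normalize_idem _)
  · have h1 := Γ.weightGcd_dvd_linkingDeg (Γ.charClass Γ.root)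
    rw [← h, zero_dvd_iff, linkingDeg_charClass] at h1
    exact (linking_pos (Γ := Γ) Γ.root Γ.root).ne' h1

/-- The degree on the character group given by the one-parameter group with the reduced weights. -/
noncomputable def reducedDeg : Γ.CharGroup →+ ℤ :=
  AddMonoidHom.mk' (fun x => Γ.linkingDeg x / Γ.weightGcd) fun x y => by
    rw [map_add, Int.add_ediv_of_dvd_left (Γ.weightGcd_dvd_linkingDeg x)]

theorem weightGcd_mul_reducedDeg (x : Γ.CharGroup) :
    Γ.weightGcd * Γ.reducedDeg x = Γ.linkingDeg x :=
  Int.mul_ediv_cancel' (Γ.weightGcd_dvd_linkingDeg x)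

/-- The character of the discriminant group given by an element of the character group. -/
noncomputable def discPairing : Multiplicative Γ.CharGroup →* Multiplicative Γ.Disc →* ℂˣ :=
  MonoidHom.mk' (fun x => Circle.toUnits.comp
      { toFun := fun e => AddCircle.toCircle (Γ.discForm e.toAdd (Γ.toDisc x.toAdd))
        map_one' := by simp
        map_mul' := fun e e' => by simp [AddCircle.toCircle_add] })
    fun x y => by
      ext e
      simp [AddCircle.toCircle_add]

theorem discPairing_charClass (v : V) :
    Γ.discPairing (Multiplicative.ofAdd (Γ.charClass v)) = Γ.discChar v := rfl

/-- The characters of `D × ℂˣ` given by the elements of the character group. -/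
noncomputable def groupPairing :
    Multiplicative Γ.CharGroup →* Multiplicative Γ.Disc × ℂˣ →* ℂˣ :=
  MonoidHom.mk' (fun x => (Γ.discPairing x).coprod (zpowGroupHom (Γ.reducedDeg x.toAdd)))
    fun x y => by
      refine MonoidHom.ext fun t => ?_
      simp only [MonoidHom.coprod_apply, MonoidHom.mul_apply, map_mul, zpowGroupHom_apply,
        toAdd_mul, map_add, zpow_add]
      exact mul_mul_mul_comm _ _ _ _

theorem groupPairing_leafClass (w : Γ.Leaf) (t : Multiplicative Γ.Disc × ℂˣ) :
    Γ.groupPairing (Multiplicative.ofAdd (Γ.leafClass w)) t =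
      Γ.discAction t.1 w * Γ.scaling t.2 w := by
  have h : Γ.reducedDeg (Γ.leafClass w) = Γ.linking w Γ.root / Γ.weightGcd := by
    change Γ.linkingDeg (Γ.charClass w) / Γ.weightGcd = _
    rw [linkingDeg_charClass, linking_comm]
  change Γ.discChar w t.1 * t.2 ^ Γ.reducedDeg (Γ.leafClass w) = _
  rw [h]
  rfl

/-- Triviality on D says that A⁻¹y is integral, so y = Az. Triviality on the one-parameter group
says that the degree, a nonzero multiple of the root coordinate of z, is zero. Together these are
the relations divided out in the character group. -/
theorem groupPairing_injective : Function.Injective Γ.groupPairing := by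
  refine (injective_iff_map_eq_one _).2 fun x hx => ?_
  have hdeg : Γ.linkingDeg x.toAdd = 0 := by
    -- The scalar 2 is not a root of unity, so it detects the exponent.
    have h2 : (Units.mk0 (2 : ℂ) two_ne_zero) ^ Γ.reducedDeg x.toAdd = 1 := by
      have := DFunLike.congr_fun hx (1, Units.mk0 (2 : ℂ) two_ne_zero)
      change Γ.discPairing x 1 * (Units.mk0 (2 : ℂ) two_ne_zero) ^ Γ.reducedDeg x.toAdd = 1 at this
      rwa [map_one, one_mul] at this
    have h3 : ‖(2 : ℂ)‖ ^ Γ.reducedDeg x.toAdd = 1 := by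
      rw [← norm_zpow]
      have := congrArg (fun u : ℂˣ => ‖(u : ℂ)‖) h2
      simpa using this
    have h4 : Γ.reducedDeg x.toAdd = 0 :=
      (zpow_eq_one_iff_right₀ (by simp) (by simp)).1 h3
    rw [← weightGcd_mul_reducedDeg, h4, mul_zero]
  have hdisc : ∀ e, Γ.discForm e (Γ.toDisc x.toAdd) = 0 := by
    intro e
    have := DFunLike.congr_fun hx (Multiplicative.ofAdd e, 1)
    change Γ.discPairing x (Multiplicative.ofAdd e) * 1 ^ Γ.reducedDeg x.toAdd = 1 at this
    rw [one_zpow, mul_one] at this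
    have h2 : AddCircle.toCircle (Γ.discForm e (Γ.toDisc x.toAdd)) = 1 :=
      Subtype.ext (congrArg Units.val this)
    exact AddCircle.injective_toCircle one_ne_zero (h2.trans AddCircle.toCircle_zero.symm)
  obtain ⟨y, hy⟩ := QuotientAddGroup.mk_surjective x.toAdd
  rw [← hy] at hdeg hdisc
  have hint : ∀ v, ∃ n : ℤ, (n : ℝ) = (Γ.realMatrix⁻¹ *ᵥ fun v => (y v : ℝ)) v := by
    intro v
    have h1 : Γ.latticeForm (Pi.single v 1) y = 0 := hdisc (Γ.vertexClass v)
    have h2 : (((fun w => (((Pi.single v 1 : V → ℤ) w : ℤ) : ℝ)) ⬝ᵥ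
        (Γ.realMatrix⁻¹ *ᵥ fun v => (y v : ℝ)) : ℝ) : UnitAddCircle) = 0 := h1
    obtain ⟨n, hn⟩ := (AddCircle.coe_eq_zero_iff 1).1 h2
    refine ⟨n, ?_⟩
    have h3 : (fun w => (((Pi.single v 1 : V → ℤ) w : ℤ) : ℝ)) = Pi.single v 1 := by
      ext w
      by_cases h : w = v
      · subst h
        simp
      · simp [h]
    rw [h3, single_dotProduct] at hn
    simpa using hn
  choose z hz using hint
  have hAz : Γ.intersectionMatrix *ᵥ z = y := by
    have h1 : (fun v => ((Γ.intersectionMatrix *ᵥ z) v : ℝ)) = fun v => (y v : ℝ) := by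
      rw [cast_mulVec, show (fun v => (z v : ℝ)) = _ from funext hz, Matrix.mulVec_mulVec,
        Matrix.mul_nonsing_inv _ Γ.realMatrix_isUnit_det, Matrix.one_mulVec]
    ext v
    exact_mod_cast congrFun h1 v
  rw [linkingDeg_mk, ← hAz, linking_dotProduct_mulVec] at hdeg
  have hz0 : z Γ.root = 0 := (mul_eq_zero.1 hdeg).resolve_left
    (neg_ne_zero.2 Γ.det_neg_intersectionMatrix_pos.ne')
  have h0 : (QuotientAddGroup.mk y : Γ.CharGroup) = 0 :=
    (QuotientAddGroup.eq_zero_iff y).2 (Γ.mem_rootKernel.2 ⟨z, hz0, hAz⟩)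
  exact Multiplicative.toAdd.injective (hy.symm.trans h0)

theorem curveIdeal_eq_ker :
    Γ.curveIdeal = RingHom.ker (semigroupAlgHom ℂ Γ.leafClass) := by
  ext f
  rw [RingHom.mem_ker, semigroupAlgHom_eq_zero_iff _ _ Γ.groupPairing_injective, curveIdeal,
    MvPolynomial.mem_vanishingIdeal_iff]
  constructor
  · intro h t
    refine h _ (subset_closure ⟨Γ.discAction t.1 * Γ.scaling t.2, ?_, ?_⟩)
    · exact Subgroup.mul_mem_sup ⟨_, rfl⟩ ⟨_, rfl⟩
    · funext w
      rw [groupPairing_leafClass]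
      rfl
  · intro h
    -- The zero set of a polynomial is closed, so passing to the closure of the orbit does not
    -- change the ideal.
    have hcont : Continuous fun x : Γ.Leaf → ℂ => MvPolynomial.aeval x f :=
      MvPolynomial.continuous_eval f
    have hclosed : IsClosed {x : Γ.Leaf → ℂ | MvPolynomial.aeval x f = 0} :=
      isClosed_eq hcont continuous_const
    refine fun x hx => closure_minimal ?_ hclosed hx
    rintro _ ⟨u, hu, rfl⟩
    obtain ⟨_, ⟨d, rfl⟩, _, ⟨c, rfl⟩, rfl⟩ := Subgroup.mem_sup.1 hu
    have := h (d, c)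
    simp only [groupPairing_leafClass] at this
    exact this

end CurveIdeal

end RootedResolutionDiagram

/-! ### From the semigroup to the curve, and the main theorem -/

namespace RootedResolutionDiagram

section MainTheorem

variable {V : Type*} [Fintype V] [DecidableEq V] (Γ : RootedResolutionDiagram V)

theorem linkingDeg_leafClass_pos (w : Γ.Leaf) : 0 < Γ.linkingDeg (Γ.leafClass w) := by
  rw [leafClass, linkingDeg_charClass]
  exact linking_pos _ _

theorem reducedDeg_pos_iff {x : Γ.CharGroup} : 0 < Γ.reducedDeg x ↔ 0 < Γ.linkingDeg x := by
  rw [← weightGcd_mul_reducedDeg]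
  exact (mul_pos_iff_of_pos_left Γ.weightGcd_pos).symm

theorem reducedDeg_nonneg_iff {x : Γ.CharGroup} : 0 ≤ Γ.reducedDeg x ↔ 0 ≤ Γ.linkingDeg x := by
  rw [← weightGcd_mul_reducedDeg]
  exact (mul_nonneg_iff_of_pos_left Γ.weightGcd_pos).symm

theorem reducedDeg_eq_zero_iff {x : Γ.CharGroup} : Γ.reducedDeg x = 0 ↔ Γ.linkingDeg x = 0 := by
  rw [← weightGcd_mul_reducedDeg, mul_eq_zero, or_iff_right Γ.weightGcd_pos.ne']

/-- The image of the degree is cℤ for some c; c divides all leaf degrees, hence their gcd, which is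
therefore attained. -/
theorem exists_reducedDeg_eq_one : ∃ τ, Γ.reducedDeg τ = 1 := by
  obtain ⟨c, hc⟩ := Int.subgroup_cyclic Γ.linkingDeg.range
  have hmem : ∀ x, c ∣ Γ.linkingDeg x := fun x => by
    have h : Γ.linkingDeg x ∈ Γ.linkingDeg.range := ⟨x, rfl⟩
    rw [hc, ← AddSubgroup.zmultiples_eq_closure] at h
    exact Int.mem_zmultiples_iff.1 h
  have hdvd : c ∣ Γ.weightGcd := Finset.dvd_gcd fun w _ => by
    have := hmem (Γ.leafClass w)
    rwa [leafClass, linkingDeg_charClass, linking_comm] at this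
  have h : Γ.weightGcd ∈ Γ.linkingDeg.range := by
    rw [hc, ← AddSubgroup.zmultiples_eq_closure]
    exact Int.mem_zmultiples_iff.2 hdvd
  obtain ⟨τ, hτ⟩ := h
  refine ⟨τ, mul_left_cancel₀ Γ.weightGcd_pos.ne' ?_⟩
  rw [weightGcd_mul_reducedDeg, hτ, mul_one]

/-- The normalization needs the reduced degree, which takes the value 1; the bound needs the
unreduced one, for which the group has one element per unit of degree. Gaps do not see the
difference. -/
theorem semigroupGaps_reducedDeg (H : AddSubgroup Γ.CharGroup) (S : AddSubmonoid Γ.CharGroup) :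
    semigroupGaps Γ.reducedDeg H S = semigroupGaps Γ.linkingDeg H S := by
  ext x
  simp only [semigroupGaps, Set.mem_ofPred_eq, reducedDeg_nonneg_iff]

theorem coe_ker_reducedDeg :
    (Γ.reducedDeg.ker : Set Γ.CharGroup) = degreeSlab Γ.linkingDeg ⊤ 1 := by
  ext x
  simp only [degreeSlab, SetLike.mem_coe, AddMonoidHom.mem_ker, reducedDeg_eq_zero_iff,
    Set.mem_ofPred_eq, AddSubgroup.mem_top, true_and]
  omega

/-- An element of the character group that is the class of a node and lies in the semigroup of the
leaves beyond an edge pointing away from the root yields an admissible monomial. -/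
theorem exists_isAdmissible {v u : V} (hu : Γ.AwayFromRoot v u) (hv : v ≠ Γ.root)
    (h : Γ.charClass v ∈ leafSemigroup Γ.leafClass (Γ.leavesIn (Γ.branch v u))) :
    ∃ M, Γ.IsAdmissible v u M ∧ Γ.monomialChar M = Γ.discChar v := by
  classical
  obtain ⟨a, ha, hsum⟩ := (mem_leafSemigroup_iff _).1 h
  rw [Finsupp.linearCombination_apply, Finsupp.sum_fintype _ _ (by simp)] at hsum
  obtain ⟨p, hp⟩ := exists_parent hv
  refine ⟨a, ⟨fun w hw => mem_leavesIn.1 (ha w hw), ?_⟩, ?_⟩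
  · have hmk : (QuotientAddGroup.mk (Pi.single v 1) : Γ.CharGroup) =
        QuotientAddGroup.mk (∑ w : Γ.Leaf, a w • Pi.single (w : V) (1 : ℤ)) := by
      change Γ.charClass v = QuotientAddGroup.mk' Γ.rootKernel _
      rw [map_sum, ← hsum]
      exact Finset.sum_congr rfl fun w _ => (map_nsmul (QuotientAddGroup.mk' Γ.rootKernel) _ _).symm
    rw [QuotientAddGroup.eq, mem_rootKernel] at hmk
    obtain ⟨z, hz, hAz⟩ := hmk
    -- The relation is supported in the branch at v pointing away from the parent, so its multiplier
    -- vanishes at v; pairing it with the linking numbers of v then gives the weight condition.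
    have hzv : z v = 0 := by
      refine eq_zero_of_mulVec_eq_zero hp hz fun x hx => ?_
      have hxv : x ≠ v := by
        rintro rfl
        exact hx (Γ.self_mem_branch hp.1.ne')
      rw [hAz, Pi.add_apply, Pi.neg_apply, Pi.single_eq_of_ne hxv, neg_zero, zero_add,
        Finset.sum_apply]
      refine Finset.sum_eq_zero fun w _ => ?_
      rw [Pi.smul_apply]
      by_cases hw : a w = 0
      · rw [hw, zero_smul]
      · rw [Pi.single_eq_of_ne, smul_zero]
        rintro rfl
        exact hx (branch_subset hp.1 hu.1 (hp.ne_parent hu) (mem_leavesIn.1 (ha w hw)))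
    have key := Γ.linking_dotProduct_mulVec v z
    rw [hzv, mul_zero, hAz, dotProduct_add, dotProduct_neg, dotProduct_single, mul_one,
      dotProduct_sum] at key
    simp only [dotProduct_smul, dotProduct_single, mul_one] at key
    simp only [nsmul_eq_mul] at key
    linarith
  -- The character depends only on the represented element, the class of v, and so not on the edge.
  · rw [← discPairing_charClass, ← hsum, ofAdd_sum, map_prod, monomialChar]
    refine Finset.prod_congr rfl fun w _ => ?_
    rw [ofAdd_nsmul, map_pow, leafClass, discPairing_charClass]

theorem semigroupCongruenceAt {v : V} (hv : v ≠ Γ.root)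
    (h : ∀ u, Γ.AwayFromRoot v u →
      Γ.charClass v ∈ leafSemigroup Γ.leafClass (Γ.leavesIn (Γ.branch v u))) :
    Γ.SemigroupCongruenceAt v := by
  have : ∀ u, ∃ M, Γ.AwayFromRoot v u →
      Γ.IsAdmissible v u M ∧ Γ.monomialChar M = Γ.discChar v := by
    intro u
    by_cases hu : Γ.AwayFromRoot v u
    · obtain ⟨M, hM⟩ := Γ.exists_isAdmissible hu hv (h u hu)
      exact ⟨M, fun _ => hM⟩
    · exact ⟨0, fun h => absurd h hu⟩
  choose M hM using this
  exact ⟨M, fun u hu => (hM u hu).1, fun u u' hu hu' => (hM u hu).2.trans (hM u' hu').2.symm⟩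

theorem isCompleteIntersection_of_gluedSemigroup [DecidableEq Γ.Leaf] {W : ℤ}
    {C : Set (Finset Γ.Leaf × Γ.CharGroup)}
    (h : GluedSemigroup Γ.linkingDeg Γ.leafClass Finset.univ W C)
    (hC : ∀ p ∈ C, p.2 ∈ leafSemigroup Γ.leafClass p.1) : Γ.IsCompleteIntersection := by
  obtain ⟨l, hl, hker, hmem⟩ := h.exists_binomials ℂ Γ.linkingDeg_leafClass_pos hC
  refine ⟨l.length, l.get, hl, ?_⟩
  rw [Set.range_list_get, curveIdeal_eq_ker]
  refine le_antisymm (ker_semigroupAlgHom_le ℂ _ fun a b hab => ?_) (Ideal.span_le.2 hker)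
  exact hmem a b (fun w _ => Finset.mem_univ w) (fun w _ => Finset.mem_univ w) hab

theorem finite_ker_reducedDeg_and_gaps : Finite Γ.reducedDeg.ker ∧
    (semigroupGaps Γ.reducedDeg ⊤ (leafSemigroup Γ.leafClass Finset.univ)).Finite := by
  classical
  obtain ⟨C, hG, -⟩ := Γ.exists_gluedSemigroup
  obtain ⟨hgaps, e, he, hepos, hslab, -⟩ := hG.exists_bound Γ.linkingDeg_leafClass_pos
  rw [Γ.leafGroup_univ] at hgaps he hslab
  rw [Γ.semigroupGaps_reducedDeg]
  refine ⟨Set.Finite.to_subtype (s := (Γ.reducedDeg.ker : Set Γ.CharGroup)) ?_, hgaps⟩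
  rw [Γ.coe_ker_reducedDeg]
  exact degreeSlab_finite_of_finite _ he hepos hslab 1

theorem finite_deltaModule_and_delta_eq : Module.Finite ℂ Γ.DeltaModule ∧
    Γ.delta = (semigroupGaps Γ.linkingDeg ⊤ (leafSemigroup Γ.leafClass Finset.univ)).ncard := by
  obtain ⟨τ, hτ⟩ := Γ.exists_reducedDeg_eq_one
  obtain ⟨hker, hgaps⟩ := Γ.finite_ker_reducedDeg_and_gaps
  rw [← Γ.semigroupGaps_reducedDeg]
  exact finite_and_finrank_semigroupRing hτ
    (fun w => Γ.reducedDeg_pos_iff.2 (Γ.linkingDeg_leafClass_pos w)) hgaps Γ.curveIdeal_eq_ker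

theorem numBranches_eq : Γ.numBranches = (degreeSlab Γ.linkingDeg ⊤ 1).ncard := by
  obtain ⟨τ, hτ⟩ := Γ.exists_reducedDeg_eq_one
  obtain ⟨hker, hgaps⟩ := Γ.finite_ker_reducedDeg_and_gaps
  rw [numBranches, curveIdeal_eq_ker, ← Γ.coe_ker_reducedDeg, ← Nat.card_coe_set_eq]
  exact ncard_minimalPrimes_semigroupRing hτ
    (fun w => Γ.reducedDeg_pos_iff.2 (Γ.linkingDeg_leafClass_pos w)) hgaps

end MainTheorem

end RootedResolutionDiagram

theorem mainTheorem2 {V : Type*} [Fintype V] [DecidableEq V] (Γ : RootedResolutionDiagram V) :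
    Module.Finite ℂ Γ.DeltaModule ∧
    2 * (Γ.delta : ℤ) - Γ.numBranches ≤ Γ.nu ∧
    (2 * (Γ.delta : ℤ) - Γ.numBranches = Γ.nu →
      Γ.IsCompleteIntersection ∧
      ∀ v : V, 3 ≤ Γ.valency v → Γ.SemigroupCongruenceAt v) := by
  classical
  obtain ⟨C, hG, hC⟩ := Γ.exists_gluedSemigroup
  have hpos : 0 < Γ.linkingDeg Γ.rootRelation := by
    rw [Γ.linkingDeg_rootRelation]
    exact Γ.det_neg_intersectionMatrix_pos
  have hb := hG.bound Γ.linkingDeg_leafClass_pos (e := Γ.rootRelation)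
    (Γ.leafGroup_univ ▸ AddSubgroup.mem_top _) hpos (by
      rw [Γ.leafGroup_univ]
      exact Γ.ncard_degreeSlab_rootRelation)
  rw [Γ.leafGroup_univ, ← Γ.numBranches_eq, ← Γ.finite_deltaModule_and_delta_eq.2] at hb
  refine ⟨Γ.finite_deltaModule_and_delta_eq.1, hb.1, fun h => ?_⟩
  have hmem := hb.2 h
  refine ⟨Γ.isCompleteIntersection_of_gluedSemigroup hG hmem, fun v hv => ?_⟩
  refine Γ.semigroupCongruenceAt ?_ fun u hu =>
    hmem (Γ.leavesIn (Γ.branch v u), Γ.charClass v) (hC v u hu hv)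
  -- A node is never the root, whose valency is at most 1.
  rintro rfl
  exact absurd (hv.trans Γ.root_isLeaf) (by decide)
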